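/- **The basic invariants of $H_4$ on the algebraic Frobenius manifold $H_4(2)$.** Let $Z=Z(t)$ be a holomorphic function on an open set $U\subseteq\mathbb C^4$, with coordinates $t=(t_1,t_2,t_3,t_4)$, that satisfies $$P(t_2,t_3,t_4,Z)=Z^3-12t_4^4Z-11t_4^6+\tfrac{27}{4}t_3^2t_4-t_2=0 .$$ Consider on $U$ the prepotential of the Frobenius manifold $H_4(2)$, \begin{align*} F(t)=F(t,Z)=& \, -\frac{66084040}{73920}t_4^{16}+\frac{143564400}{73920}t_3^2t_4^{11}-\frac{40727610}{73920}t_3^4t_4^6-\frac{392931}{73920}t_3^6t_4 \\ &+t_1t_2t_3+\frac{1}{2}t_1^2t_4-\frac{3}{4}t_4^4\left(2288t_4^{10}-1620t_3^2t_4^5-27t_3^4\right)Z-760t_4^{12}Z^2 \\ &+\left(\frac{1744}{48}t_4^{10}-\frac{4860}{48}t_3^2t_4^5-\frac{81}{48}t_3^4\right)Z^3+140t_4^8Z^4+24t_4^6Z^5 \\ &-\frac{53}{6}t_4^4Z^6-\frac{10}{7}t_4^2Z^7+\frac{Z^8}{4} \end{align*} with Euler vector field $E=t_1\partial_{t_1}+\frac45t_2\partial_{t_2}+\frac13t_3\partial_{t_3}+\frac2{15}t_4\partial_{t_4}$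 and charge $d=\frac{13}{15}$. Put $c_{ijk}=\partial_{t_i}\partial_{t_j}\partial_{t_k}F$ and $\eta_{ij}=c_{ij1}$, let $\eta^{ij}$ be the inverse matrix of $\eta_{ij}$, and let $c^{ij}_k=\sum_{\lambda,\mu}\eta^{i\lambda}\eta^{j\mu}c_{\lambda\mu k}$. The intersection form is $g^{ij}(t)=\sum_\lambda E^\lambda(t)\,c^{ij}_\lambda(t)$. Flat coordinates of $g$ on an open set $V\subseteq U$ are holomorphic functions $x=(x_1,\dots,x_4)$ on $V$ with $$\sum_{\lambda,\mu}g^{\lambda\mu}(t)\frac{\partial x_a}{\partial t_\lambda}\frac{\partial x_b}{\partial t_\mu}=\delta^{ab},\qquad E(x_a)=\frac{1-d}2\,x_a \qquad (1\le a,b\le4).$$ For $x\in\mathbb C^4$ let $y_1,\dots,y_4$ be the following basic invariants of the Coxeter group $H_4$, of degrees $30,20,12,2$: \begin{align*} y_1=& \, \frac{32}{3}x_1^{24}h_2^3-40x_1^{22}\left(2h_2^4+3h_2h_6\right)+x_1^{20}\left(360h_{10}+\frac{1344}{5}h_2^5+672h_2^2h_6\right) \\ &+x_1^{18}\left(1080h_6^2-1608h_2^3h_6-\frac{1328}{3}h_2^6-2880h_{10}h_2\right)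 \\ &+x_1^{16}\left(10024h_{10}h_2^2+272h_2^7+1248h_2^4h_6-5628h_2h_6^2\right) \\ &+x_1^{14}\left(18588h_2^2h_6^2+272h_2^8-7620h_{10}h_6-16856h_{10}h_2^3\right) \\ &+x_1^{12}\left(14216h_{10}h_2^4+23508h_{10}h_6h_2-\frac{1328}{3}h_2^9-1248h_6h_2^6-27396h_6^2h_2^3 \right. \\ &\biggl. -5796h_6^3\biggr)+x_1^{10}\left(3240h_{10}^2-7160h_{10}h_2^5-25332h_{10}h_6h_2^2+\frac{1344}{5}h_2^{10} \right. \\ &\biggl. +1608h_2^7h_6+19968h_2^4h_6^2+7350h_2h_6^3\biggr)+x_1^8\left(2144h_{10}h_2^6-3232h_{10}^2h_2 \right. \\ &\left. +10908h_{10}h_2^3h_6-906h_{10}h_6^2-80h_2^{11}-672h_2^8h_6-6924h_2^5h_6^2-1956h_2^2h_6^3\right) \\ &+x_1^6\left(1168h_{10}^2h_2^2-344h_{10}h_2^7-2172h_{10}h_2^4h_6-1908h_{10}h_2h_6^2+\frac{32}{3}h_2^{12} \right. \\ &\biggl. +120h_2^9h_6+1332h_2^6h_6^2+288h_2^3h_6^3+2394h_6^4\biggr)+x_1^4\left(348h_{10}^2h_6-152h_{10}^2h_2^3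 \right. \\ &\left. +16h_{10}h_2^8+60h_{10}h_6h_2^5+408h_{10}h_6^2h_2^2-84h_2^7h_6^2+84h_2^4h_6^3-909h_2h_6^4\right) \\ &+x_1^2\left(8h_{10}^2h_2^4-42h_{10}h_6^2h_2^3-87h_{10}h_6^3-6h_2^5h_6^3+135h_2^2h_6^4\right) \\ &+\frac{4}{3}h_{10}^3-3h_{10}h_2h_6^3+\frac{9}{5}h_6^5, \\ y_2=& \, 4x_1^{16}h_2^2-10x_1^{14}\left(2h_2^3+3h_6\right)+x_1^{12}\left(44h_2^4+138h_2h_6\right) \\ &+x_1^{10}\left(180h_{10}-44h_2^5-402h_2^2h_6\right)+x_1^8\left(44h_2^6-464h_{10}h_2+402h_2^3h_6+294h_6^2\right) \\ &+x_1^6\left(296h_{10}h_2^2-20h_2^7-138h_2^4h_6-306h_2h_6^2\right)+x_1^4\left(4h_2^8-76h_{10}h_2^3-114h_{10}h_6 \right. \\ &\left. +30h_2^5h_6+168h_2^2h_6^2\right)+x_1^2\left(4h_{10}h_2^4-21h_2^3h_6^2+\frac{57}{2}h_6^3\right)+h_{10}^2-\frac{3}{2}h_2h_6^3, \\ y_3=&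 \, -2x_1^{10}h_2+6x_1^8h_2^2+x_1^6\left(33h_6-14h_2^3\right)-x_1^4\left(33h_2h_6-6h_2^4\right) \\ &+x_1^2\left(11h_{10}-2h_2^5\right)-h_{10}h_2+\frac{3}{2}h_6^2, \\ y_4=& \, x_1^2+h_2, \end{align*} where \begin{align*} h_2=& \, \epsilon_1, \\ h_6=& \, \sqrt{5}\delta+\epsilon_1\epsilon_2-11\epsilon_3, \\ h_{10}=& \, 95\epsilon_2\epsilon_3-32\epsilon_1^2\epsilon_3-5\epsilon_1\epsilon_2^2+2\epsilon_1^3\epsilon_2+3\sqrt{5}\delta\epsilon_2, \end{align*} and \begin{align*} \epsilon_1=& \, x_2^2+x_3^2+x_4^2, \\ \epsilon_2=& \, x_2^2x_3^2+x_2^2x_4^2+x_3^2x_4^2, \\ \epsilon_3=& \, x_2^2x_3^2x_4^2, \\ \delta=& \, (x_2^2-x_3^2)(x_2^2-x_4^2)(x_3^2-x_4^2). \end{align*} Consider the relations \begin{align*} y_1=& \, 2^8\cdot3^2\cdot5^9\left(5760t_1^2-51840Z^2t_2t_3^2+187920t_1t_3^3+302535t_3^6+30720Zt_2^2t_4 \right.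 \\ &+349920Z^2t_3^4t_4-155520Zt_2t_3^2t_4^2+266240t_2^2t_4^3-349920Zt_3^4t_4^3+2782080t_2t_3^2t_4^4 \\ &-393216Z^2t_2t_4^5+4665600t_1t_3t_4^5+45198000t_3^4t_4^5+3120768Z^2t_3^2t_4^6 \\ &+3747840Zt_2t_4^7-25764480Zt_3^2t_4^8+75859968t_2t_4^9+952477056t_3^2t_4^{10} \\ &\left. +7962624Z^2t_4^{11}+4478976Zt_4^{13}+4105230336t_4^{15}\right), \\ y_2=& \, -2^4\cdot3^2\cdot5^6\left(256Z^2t_2-1440t_1t_3-5265t_3^4-1728Z^2t_3^2t_4-1280Zt_2t_4^2 \right. \\ &\left. +8640Zt_3^2t_4^3-31488t_2t_4^4-370656t_3^2t_4^5-2304Z^2t_4^6+2304Zt_4^8-2566656t_4^{10}\right), \\ y_3=& \, -2^3\cdot5^4\cdot3\left(16t_2+297t_3^2t_4+4320t_4^6\right), \\ y_4=& \, 30t_4. \end{align*} (i) The points of $U$ that have an open neighbourhood $V\subseteq U$ with an injective system of flat coordinates $x=x(t)$ of $g$ on $V$ for which these four relations hold on all of $V$, where $y_i=y_i(x(t))$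 and $Z=Z(t)$, are dense in $U$. (ii) If $U$ is connected and $x=x(t)$ is any system of flat coordinates of $g$ on $U$, then there is a complex orthogonal $4\times4$ matrix $T$ such that the four relations hold on all of $U$ with $y_i=y_i(T\,x(t))$ and $Z=Z(t)$. -/

import Mathlib

noncomputable section

namespace AlgFrobenius

/-! Four-dimensional Frobenius manifolds given by a prepotential. Points are vectors
`t : Fin 4 → ℂ`, so that `t 0, t 1, t 2, t 3` are the coordinates `t₁, t₂, t₃, t₄`. -/

/-- The (complex) partial derivative `∂f/∂tᵢ`. -/
def partialD (i : Fin 4) (f : (Fin 4 → ℂ) → ℂ) (t : Fin 4 → ℂ) : ℂ :=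
  fderiv ℂ f t (Pi.single i 1)

/-- The third derivatives `c_ijk = ∂³F/∂tᵢ∂tⱼ∂tₖ` of the prepotential. -/
def cLow (F : (Fin 4 → ℂ) → ℂ) (t : Fin 4 → ℂ) (i j k : Fin 4) : ℂ :=
  partialD i (partialD j (partialD k F)) t

/-- The metric `η_ij = ∂³F/∂tᵢ∂tⱼ∂t₁`. -/
def eta (F : (Fin 4 → ℂ) → ℂ) (t : Fin 4 → ℂ) : Matrix (Fin 4) (Fin 4) ℂ :=
  Matrix.of fun i j => cLow F t i j 0

/-- The tensor `c^ij_k = η^iλ η^jμ c_λμk`, where `η^ij` is the inverse of `η_ij`. -/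
def cUp (F : (Fin 4 → ℂ) → ℂ) (t : Fin 4 → ℂ) (i j k : Fin 4) : ℂ :=
  ∑ l : Fin 4, ∑ m : Fin 4, (eta F t)⁻¹ i l * (eta F t)⁻¹ j m * cLow F t l m k

/-- The intersection form `g^ij = E^λ c^ij_λ` in the coordinates `t`, for the Euler vector field
`E = ∑ deg i • tᵢ ∂/∂tᵢ`. -/
def interForm (F : (Fin 4 → ℂ) → ℂ) (deg : Fin 4 → ℂ) (t : Fin 4 → ℂ) :
    Matrix (Fin 4) (Fin 4) ℂ :=
  Matrix.of fun i j => ∑ k : Fin 4, deg k * t k * cUp F t i j k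

/-- `x = (x₁, …, x₄)` is a system of flat coordinates of the intersection form on the open set `V`:
the functions `xₐ` are holomorphic on `V`, the intersection form is `g^ab(x) = δ^ab` in these
coordinates (in particular the Jacobi matrix of `x` is invertible on `V`), and the Euler vector
field is `E = (1 - d)/2 ∑ xₐ ∂/∂xₐ`. -/
def IsFlatCoordinates (F : (Fin 4 → ℂ) → ℂ) (deg : Fin 4 → ℂ) (d : ℂ)
    (V : Set (Fin 4 → ℂ)) (x : (Fin 4 → ℂ) → Fin 4 → ℂ) : Prop :=
  DifferentiableOn ℂ x V ∧
  (∀ t ∈ V, ∀ a b : Fin 4,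
    ∑ l : Fin 4, ∑ m : Fin 4, interForm F deg t l m *
      partialD l (fun s => x s a) t * partialD m (fun s => x s b) t = if a = b then 1 else 0) ∧
  (∀ t ∈ V, ∀ a : Fin 4,
    ∑ l : Fin 4, deg l * t l * partialD l (fun s => x s a) t = (1 - d) / 2 * x t a)

end AlgFrobenius

/-! The Frobenius manifold `H₄(2)`. -/

namespace H42

/-- The polynomial `P(t₂, t₃, t₄, Z)`, of which `Z` is a root. -/
def cubicP (t2 t3 t4 Z : ℂ) : ℂ :=
  Z ^ 3 - 12 * t4 ^ 4 * Z - 11 * t4 ^ 6 + (27 / 4) * t3 ^ 2 * t4 - t2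

/-- The prepotential `F(t, Z)` as a polynomial in `t` and `Z`. -/
def prepotPoly (t1 t2 t3 t4 Z : ℂ) : ℂ :=
  -(66084040 / 73920) * t4 ^ 16 + (143564400 / 73920) * t3 ^ 2 * t4 ^ 11
    - (40727610 / 73920) * t3 ^ 4 * t4 ^ 6 - (392931 / 73920) * t3 ^ 6 * t4 + t1 * t2 * t3
    + (1 / 2) * t1 ^ 2 * t4 - (3 / 4) * t4 ^ 4 * (2288 * t4 ^ 10 - 1620 * t3 ^ 2 * t4 ^ 5
    - 27 * t3 ^ 4) * Z - 760 * t4 ^ 12 * Z ^ 2 + ((1744 / 48) * t4 ^ 10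
    - (4860 / 48) * t3 ^ 2 * t4 ^ 5 - (81 / 48) * t3 ^ 4) * Z ^ 3 + 140 * t4 ^ 8 * Z ^ 4
    + 24 * t4 ^ 6 * Z ^ 5 - (53 / 6) * t4 ^ 4 * Z ^ 6 - (10 / 7) * t4 ^ 2 * Z ^ 7
    + (1 / 4) * Z ^ 8

/-- The prepotential as a function of `t`, for a branch `Z = Z(t)`. -/
def prepot (Z : (Fin 4 → ℂ) → ℂ) (t : Fin 4 → ℂ) : ℂ :=
  prepotPoly (t 0) (t 1) (t 2) (t 3) (Z t)

/-- The degrees: `E = t₁∂₁ + (4/5)t₂∂₂ + (1/3)t₃∂₃ + (2/15)t₄∂₄`. -/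
def deg : Fin 4 → ℂ := ![1, 4 / 5, 1 / 3, 2 / 15]

/-- The charge. -/
def charge : ℂ := 13 / 15

/-! The basic invariants of the Coxeter group `H₄` in orthonormal coordinates `x₁, …, x₄`, written
through the basic invariants `h₂, h₆, h₁₀` of `H₃` in `x₂, x₃, x₄`. -/

def sqrtFive : ℂ := ((Real.sqrt 5 : ℝ) : ℂ)

def eps1 (x2 x3 x4 : ℂ) : ℂ := x2 ^ 2 + x3 ^ 2 + x4 ^ 2

def eps2 (x2 x3 x4 : ℂ) : ℂ := x2 ^ 2 * x3 ^ 2 + x2 ^ 2 * x4 ^ 2 + x3 ^ 2 * x4 ^ 2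

def eps3 (x2 x3 x4 : ℂ) : ℂ := x2 ^ 2 * x3 ^ 2 * x4 ^ 2

def delta (x2 x3 x4 : ℂ) : ℂ := (x2 ^ 2 - x3 ^ 2) * (x2 ^ 2 - x4 ^ 2) * (x3 ^ 2 - x4 ^ 2)

def h2 (x2 x3 x4 : ℂ) : ℂ := eps1 x2 x3 x4

def h6 (x2 x3 x4 : ℂ) : ℂ :=
  sqrtFive * delta x2 x3 x4 + eps1 x2 x3 x4 * eps2 x2 x3 x4 - 11 * eps3 x2 x3 x4

def h10 (x2 x3 x4 : ℂ) : ℂ :=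
  95 * eps2 x2 x3 x4 * eps3 x2 x3 x4 - 32 * eps1 x2 x3 x4 ^ 2 * eps3 x2 x3 x4
    - 5 * eps1 x2 x3 x4 * eps2 x2 x3 x4 ^ 2 + 2 * eps1 x2 x3 x4 ^ 3 * eps2 x2 x3 x4
    + 3 * sqrtFive * delta x2 x3 x4 * eps2 x2 x3 x4

def inv1Poly (x1 h2 h6 h10 : ℂ) : ℂ :=
  (32 / 3) * x1 ^ 24 * h2 ^ 3 - 40 * x1 ^ 22 * (2 * h2 ^ 4 + 3 * h2 * h6)
    + x1 ^ 20 * (360 * h10 + (1344 / 5) * h2 ^ 5 + 672 * h2 ^ 2 * h6) + x1 ^ 18 * (1080 * h6 ^ 2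
    - 1608 * h2 ^ 3 * h6 - (1328 / 3) * h2 ^ 6 - 2880 * h10 * h2)
    + x1 ^ 16 * (10024 * h10 * h2 ^ 2 + 272 * h2 ^ 7 + 1248 * h2 ^ 4 * h6 - 5628 * h2 * h6 ^ 2)
    + x1 ^ 14 * (18588 * h2 ^ 2 * h6 ^ 2 + 272 * h2 ^ 8 - 7620 * h10 * h6
    - 16856 * h10 * h2 ^ 3) + x1 ^ 12 * (14216 * h10 * h2 ^ 4 + 23508 * h10 * h6 * h2
    - (1328 / 3) * h2 ^ 9 - 1248 * h6 * h2 ^ 6 - 27396 * h6 ^ 2 * h2 ^ 3 - 5796 * h6 ^ 3)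
    + x1 ^ 10 * (3240 * h10 ^ 2 - 7160 * h10 * h2 ^ 5 - 25332 * h10 * h6 * h2 ^ 2
    + (1344 / 5) * h2 ^ 10 + 1608 * h2 ^ 7 * h6 + 19968 * h2 ^ 4 * h6 ^ 2 + 7350 * h2 * h6 ^ 3)
    + x1 ^ 8 * (2144 * h10 * h2 ^ 6 - 3232 * h10 ^ 2 * h2 + 10908 * h10 * h2 ^ 3 * h6
    - 906 * h10 * h6 ^ 2 - 80 * h2 ^ 11 - 672 * h2 ^ 8 * h6 - 6924 * h2 ^ 5 * h6 ^ 2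
    - 1956 * h2 ^ 2 * h6 ^ 3) + x1 ^ 6 * (1168 * h10 ^ 2 * h2 ^ 2 - 344 * h10 * h2 ^ 7
    - 2172 * h10 * h2 ^ 4 * h6 - 1908 * h10 * h2 * h6 ^ 2 + (32 / 3) * h2 ^ 12
    + 120 * h2 ^ 9 * h6 + 1332 * h2 ^ 6 * h6 ^ 2 + 288 * h2 ^ 3 * h6 ^ 3 + 2394 * h6 ^ 4)
    + x1 ^ 4 * (348 * h10 ^ 2 * h6 - 152 * h10 ^ 2 * h2 ^ 3 + 16 * h10 * h2 ^ 8
    + 60 * h10 * h6 * h2 ^ 5 + 408 * h10 * h6 ^ 2 * h2 ^ 2 - 84 * h2 ^ 7 * h6 ^ 2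
    + 84 * h2 ^ 4 * h6 ^ 3 - 909 * h2 * h6 ^ 4) + x1 ^ 2 * (8 * h10 ^ 2 * h2 ^ 4
    - 42 * h10 * h6 ^ 2 * h2 ^ 3 - 87 * h10 * h6 ^ 3 - 6 * h2 ^ 5 * h6 ^ 3
    + 135 * h2 ^ 2 * h6 ^ 4) + (4 / 3) * h10 ^ 3 - 3 * h10 * h2 * h6 ^ 3 + (9 / 5) * h6 ^ 5

def inv2Poly (x1 h2 h6 h10 : ℂ) : ℂ :=
  4 * x1 ^ 16 * h2 ^ 2 - 10 * x1 ^ 14 * (2 * h2 ^ 3 + 3 * h6) + x1 ^ 12 * (44 * h2 ^ 4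
    + 138 * h2 * h6) + x1 ^ 10 * (180 * h10 - 44 * h2 ^ 5 - 402 * h2 ^ 2 * h6)
    + x1 ^ 8 * (44 * h2 ^ 6 - 464 * h10 * h2 + 402 * h2 ^ 3 * h6 + 294 * h6 ^ 2)
    + x1 ^ 6 * (296 * h10 * h2 ^ 2 - 20 * h2 ^ 7 - 138 * h2 ^ 4 * h6 - 306 * h2 * h6 ^ 2)
    + x1 ^ 4 * (4 * h2 ^ 8 - 76 * h10 * h2 ^ 3 - 114 * h10 * h6 + 30 * h2 ^ 5 * h6
    + 168 * h2 ^ 2 * h6 ^ 2) + x1 ^ 2 * (4 * h10 * h2 ^ 4 - 21 * h2 ^ 3 * h6 ^ 2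
    + (57 / 2) * h6 ^ 3) + h10 ^ 2 - (3 / 2) * h2 * h6 ^ 3

def inv3Poly (x1 h2 h6 h10 : ℂ) : ℂ :=
  -2 * x1 ^ 10 * h2 + 6 * x1 ^ 8 * h2 ^ 2 + x1 ^ 6 * (33 * h6 - 14 * h2 ^ 3)
    - x1 ^ 4 * (33 * h2 * h6 - 6 * h2 ^ 4) + x1 ^ 2 * (11 * h10 - 2 * h2 ^ 5) - h10 * h2
    + (3 / 2) * h6 ^ 2

/-- The basic invariant `y₁` of `H₄`, of degree 30. -/
def y1 (x : Fin 4 → ℂ) : ℂ :=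
  inv1Poly (x 0) (h2 (x 1) (x 2) (x 3)) (h6 (x 1) (x 2) (x 3)) (h10 (x 1) (x 2) (x 3))

/-- The basic invariant `y₂` of `H₄`, of degree 20. -/
def y2 (x : Fin 4 → ℂ) : ℂ :=
  inv2Poly (x 0) (h2 (x 1) (x 2) (x 3)) (h6 (x 1) (x 2) (x 3)) (h10 (x 1) (x 2) (x 3))

/-- The basic invariant `y₃` of `H₄`, of degree 12. -/
def y3 (x : Fin 4 → ℂ) : ℂ :=
  inv3Poly (x 0) (h2 (x 1) (x 2) (x 3)) (h6 (x 1) (x 2) (x 3)) (h10 (x 1) (x 2) (x 3))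

/-- The basic invariant `y₄` of `H₄`, of degree 2. -/
def y4 (x : Fin 4 → ℂ) : ℂ := x 0 ^ 2 + h2 (x 1) (x 2) (x 3)

/-! The polynomials in `t` and `Z` that express the basic invariants. -/

def y1Formula (t1 t2 t3 t4 Z : ℂ) : ℂ :=
  2 ^ 8 * 3 ^ 2 * 5 ^ 9 * (5760 * t1 ^ 2 - 51840 * Z ^ 2 * t2 * t3 ^ 2 + 187920 * t1 * t3 ^ 3
    + 302535 * t3 ^ 6 + 30720 * Z * t2 ^ 2 * t4 + 349920 * Z ^ 2 * t3 ^ 4 * t4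
    - 155520 * Z * t2 * t3 ^ 2 * t4 ^ 2 + 266240 * t2 ^ 2 * t4 ^ 3
    - 349920 * Z * t3 ^ 4 * t4 ^ 3 + 2782080 * t2 * t3 ^ 2 * t4 ^ 4
    - 393216 * Z ^ 2 * t2 * t4 ^ 5 + 4665600 * t1 * t3 * t4 ^ 5 + 45198000 * t3 ^ 4 * t4 ^ 5
    + 3120768 * Z ^ 2 * t3 ^ 2 * t4 ^ 6 + 3747840 * Z * t2 * t4 ^ 7
    - 25764480 * Z * t3 ^ 2 * t4 ^ 8 + 75859968 * t2 * t4 ^ 9 + 952477056 * t3 ^ 2 * t4 ^ 10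
    + 7962624 * Z ^ 2 * t4 ^ 11 + 4478976 * Z * t4 ^ 13 + 4105230336 * t4 ^ 15)

def y2Formula (t1 t2 t3 t4 Z : ℂ) : ℂ :=
  -2 ^ 4 * 3 ^ 2 * 5 ^ 6 * (256 * Z ^ 2 * t2 - 1440 * t1 * t3 - 5265 * t3 ^ 4
    - 1728 * Z ^ 2 * t3 ^ 2 * t4 - 1280 * Z * t2 * t4 ^ 2 + 8640 * Z * t3 ^ 2 * t4 ^ 3
    - 31488 * t2 * t4 ^ 4 - 370656 * t3 ^ 2 * t4 ^ 5 - 2304 * Z ^ 2 * t4 ^ 6 + 2304 * Z * t4 ^ 8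
    - 2566656 * t4 ^ 10)

def y3Formula (t2 t3 t4 : ℂ) : ℂ :=
  -2 ^ 3 * 5 ^ 4 * 3 * (16 * t2 + 297 * t3 ^ 2 * t4 + 4320 * t4 ^ 6)

def y4Formula (t4 : ℂ) : ℂ := 30 * t4

/-- The relations between the basic invariants at the point with flat coordinates `x` of the
intersection form and the flat coordinates `t` of the metric `η`, with the value `z` of `Z`. -/
def Relations (x t : Fin 4 → ℂ) (z : ℂ) : Prop :=
  y1 x = y1Formula (t 0) (t 1) (t 2) (t 3) z ∧
  y2 x = y2Formula (t 0) (t 1) (t 2) (t 3) z ∧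
  y3 x = y3Formula (t 1) (t 2) (t 3) ∧
  y4 x = y4Formula (t 3)

end H42

end

set_option linter.unusedVariables false
set_option linter.unusedSimpArgs false
set_option linter.unreachableTactic false
set_option linter.unusedTactic false

open Metric Set Filter Topology MeasureTheory

/-! ### Holomorphic functions of several variables -/

section Holomorphic

/-! The orbit space of `H₄` and the Frobenius manifold carry the same metric, and the right-hand
sides of the relations identify the two. On the `x` side, the products of the gradients of the basic
invariants are again invariant, hence polynomials in `y`: if `J` is the Jacobi matrix of the orbit
map `invMap`, then `J Jᵀ = orbitMetric ∘ invMap` (`jac_invMap_mul_transpose`). On the `t` side, the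
right-hand sides form a map `formMap Z` with Jacobi matrix `K`, and the intersection form satisfies
`K g Kᵀ = orbitMetric ∘ formMap` with the same matrix (`jac_formMap_mul_inter_mul_transpose`). Since
the cubic gives `t₂` as a polynomial in `Z, t₃, t₄`, the variables `t₁, Z, t₃, t₄` are free, and
both facts become finitely many polynomial identities.

For (i), where `det orbitMetric ≠ 0` the orbit map has a local holomorphic inverse, and its
composite with `formMap Z` is a system `x` satisfying the relations. Comparing the two matrix
identities gives `g^{ab} = δ^{ab}`. The Euler condition then comes for free: `x ⬝ x = y₄ = 30 t₄`,
and `E` is the `g`-gradient of `t₄` (`mulVec_euler_eq`).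

The construction needs `formMap Z t` to be a value of the orbit map. The invariants have no common
zero except the origin, so by homogeneity the orbit map is proper and its range is closed. The range
is also a neighbourhood of each of its points off the discriminant. A complex line minus a countable
set is connected, so every value off the discriminant is attained (`exists_invMap_eq`). Density
holds because `det orbitMetric` becomes a nonzero polynomial in `t₁, Z, t₃, t₄`.

For (ii), the transition map between two flat systems preserves the standard bilinear form
infinitesimally, so its derivative is constant (`fderiv_const_of_dotProduct_preserving`), and the
Euler condition excludes a translation. Hence any flat system is orthogonally equivalent, near one
point, to one satisfying the relations, and the identity theorem carries the relations to all of a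
connected `U`. -/

theorem norm_fderiv_le_of_norm_le_ball {E : Type*} [NormedAddCommGroup E] [NormedSpace ℂ E]
    {f : E → ℂ} {c : E} {r M : ℝ} (hr : 0 < r) (hf : DifferentiableOn ℂ f (ball c r))
    (hM : ∀ p ∈ ball c r, ‖f p‖ ≤ M) : ‖fderiv ℂ f c‖ ≤ (2 * M) / r := by
  refine Complex.norm_fderiv_le_div_of_mapsTo_ball hf (fun p hp => ?_) hr
  rw [mem_closedBall, dist_eq_norm]
  linarith [norm_sub_le (f p) (f c), hM p hp, hM c (mem_ball_self hr)]

/-- Cauchy's formula for the first derivative of `s ↦ f (p + s • v)`. In this form `p` enters only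
through values of `f`, over a circle that does not depend on `p`, so the integral can be
differentiated in `p`. -/
theorem deriv_line_eq_integral {E : Type*} [NormedAddCommGroup E] [NormedSpace ℂ E]
    {f : E → ℂ} {p v : E} {r ρ : ℝ} (hf : DifferentiableOn ℂ f (ball p r)) (hρ : 0 < ρ)
    (hv : ρ * ‖v‖ < r) :
    fderiv ℂ f p v = (2 * Real.pi * Complex.I)⁻¹ • ∫ θ in (0 : ℝ)..2 * Real.pi,
      (deriv (circleMap 0 ρ) θ * (1 / circleMap 0 ρ θ ^ 2)) * f (p + circleMap 0 ρ θ • v) := by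
  have hr : 0 < r := lt_of_le_of_lt (by positivity) hv
  have hmem : ∀ s ∈ closedBall (0 : ℂ) ρ, p + s • v ∈ ball p r := fun s hs => by
    rw [mem_ball, dist_eq_norm, add_sub_cancel_left, norm_smul]
    refine lt_of_le_of_lt ?_ hv
    gcongr
    simpa using hs
  have hd : ∀ s ∈ closedBall (0 : ℂ) ρ, DifferentiableAt ℂ (fun s : ℂ => f (p + s • v)) s :=
    fun s hs => DifferentiableAt.comp s
      (hf.differentiableAt (isOpen_ball.mem_nhds (hmem s hs))) (by fun_prop)
  have hc : DiffContOnCl ℂ (fun s : ℂ => f (p + s • v)) (ball 0 ρ) := by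
    refine DifferentiableOn.diffContOnCl fun s hs => (hd s ?_).differentiableWithinAt
    rwa [closure_ball _ hρ.ne'] at hs
  have h1 := hc.deriv_eq_smul_circleIntegral hρ
  have h2 : deriv (fun s : ℂ => f (p + s • v)) 0 = fderiv ℂ f p v := by
    have hfd : HasFDerivAt f (fderiv ℂ f p) (p + (0 : ℂ) • v) := by
      rw [zero_smul, add_zero]
      exact (hf.differentiableAt (isOpen_ball.mem_nhds (mem_ball_self hr))).hasFDerivAt
    have hl : HasDerivAt (fun s : ℂ => p + s • v) v 0 := by
      simpa using ((hasDerivAt_id (0 : ℂ)).smul_const v).const_add p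
    exact (hfd.comp_hasDerivAt (0 : ℂ) hl).deriv
  rw [h2] at h1
  have h3 : (2 * Real.pi * Complex.I : ℂ) ≠ 0 := Complex.two_pi_I_ne_zero
  rw [eq_inv_smul_iff₀ h3, ← h1, circleIntegral]
  refine intervalIntegral.integral_congr fun θ _ => ?_
  simp only [smul_eq_mul, sub_zero, mul_assoc]

variable {f : (Fin 4 → ℂ) → ℂ} {U : Set (Fin 4 → ℂ)}

/-- Near a given point the directional derivative is a Cauchy integral with a fixed radius.
Differentiation under the integral sign is justified by the Cauchy estimate, which needs only a
local bound for `f`. -/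
theorem differentiableOn_fderiv_apply (hU : IsOpen U) (hf : DifferentiableOn ℂ f U)
    (v : Fin 4 → ℂ) : DifferentiableOn ℂ (fun p => fderiv ℂ f p v) U := by
  intro p₀ hp₀
  refine DifferentiableAt.differentiableWithinAt ?_
  have hcont : ContinuousAt f p₀ := (hf.differentiableAt (hU.mem_nhds hp₀)).continuousAt
  obtain ⟨R, hR, hRU⟩ := Metric.mem_nhds_iff.1 (Filter.inter_mem (hU.mem_nhds hp₀)
    (hcont.norm.eventually_le_const (lt_add_one _) : ∀ᶠ p in 𝓝 p₀, ‖f p‖ ≤ ‖f p₀‖ + 1))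
  set M := ‖f p₀‖ + 1
  -- The radius `R`, within which `f` is bounded by `M`, is spent in thirds: the motion of `p`
  -- around `p₀`, the excursion along the circle, and the ball for the Cauchy estimate.
  set r := R / 3 with hr
  have hr0 : 0 < r := by positivity
  set ρ := r / (‖v‖ + 1) with hρ
  have hρ0 : 0 < ρ := by positivity
  have hv : ρ * ‖v‖ < r := by
    rw [hρ, div_mul_eq_mul_div, div_lt_iff₀ (by positivity)]
    nlinarith
  have hsub : ∀ p ∈ ball p₀ r, ball p r ⊆ ball p₀ R := fun p hp =>
    ball_subset_ball' (by rw [mem_ball] at hp; linarith)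
  have hsub2 : ∀ p ∈ ball p₀ r, ∀ θ, ball (p + circleMap 0 ρ θ • v) r ⊆ ball p₀ R :=
    fun p hp θ => ball_subset_ball' (by
      have h1 : dist (p + circleMap 0 ρ θ • v) p < r := by
        rw [dist_eq_norm, add_sub_cancel_left, norm_smul, norm_circleMap_zero, abs_of_pos hρ0]
        exact hv
      have h2 := dist_triangle (p + circleMap 0 ρ θ • v) p p₀
      rw [mem_ball] at hp
      linarith)
  have hfR : DifferentiableOn ℂ f (ball p₀ R) := hf.mono fun p hp => (hRU hp).1
  have hfat : ∀ p ∈ ball p₀ r, ∀ θ, DifferentiableAt ℂ f (p + circleMap 0 ρ θ • v) :=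
    fun p hp θ => hfR.differentiableAt
      (isOpen_ball.mem_nhds (hsub2 p hp θ (mem_ball_self hr0)))
  set k : ℝ → ℂ := fun θ => deriv (circleMap 0 ρ) θ * (1 / circleMap 0 ρ θ ^ 2) with hk
  have hkc : Continuous k := by
    have h0 : ∀ θ, circleMap 0 ρ θ ^ 2 ≠ 0 := fun θ =>
      pow_ne_zero _ (circleMap_ne_center hρ0.ne')
    simp only [hk, deriv_circleMap]
    fun_prop (disch := exact h0 _)
  have hcm : Continuous (circleMap 0 ρ) := continuous_circleMap 0 ρ
  have hFc : ∀ p ∈ ball p₀ r, Continuous fun θ => k θ * f (p + circleMap 0 ρ θ • v) :=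
    fun p hp => hkc.mul (continuous_iff_continuousAt.2 fun θ =>
      ContinuousAt.comp (f := fun θ => p + circleMap 0 ρ θ • v) (hfat p hp θ).continuousAt
        (by fun_prop))
  have key := intervalIntegral.hasFDerivAt_integral_of_dominated_of_fderiv_le (𝕜 := ℂ)
    (μ := volume) (a := 0) (b := 2 * Real.pi) (x₀ := p₀)
    (F := fun p θ => k θ * f (p + circleMap 0 ρ θ • v))
    (F' := fun p θ => k θ • fderiv ℂ f (p + circleMap 0 ρ θ • v))
    (bound := fun θ => ‖k θ‖ * (2 * M / r)) (s := ball p₀ r) (ball_mem_nhds _ hr0)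
    (by
      filter_upwards [ball_mem_nhds p₀ hr0] with p hp
      exact (hFc p hp).aestronglyMeasurable)
    ((hFc p₀ (mem_ball_self hr0)).intervalIntegrable _ _)
    (by
      refine hkc.aestronglyMeasurable.smul ?_
      have hm : Measurable fun θ => fderiv ℂ f (p₀ + circleMap 0 ρ θ • v) :=
        (measurable_fderiv ℂ f).comp (by fun_prop : Continuous _).measurable
      exact hm.aestronglyMeasurable)
    (by
      refine ae_of_all _ fun θ _ p hp => ?_
      rw [norm_smul]
      gcongr
      exact norm_fderiv_le_of_norm_le_ball hr0 (hfR.mono (hsub2 p hp θ))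
        fun q hq => (hRU (hsub2 p hp θ hq)).2)
    ((by fun_prop : Continuous _).intervalIntegrable _ _)
    (by
      refine ae_of_all _ fun θ _ p hp => ?_
      have h1 : HasFDerivAt (fun p : Fin 4 → ℂ => p + circleMap 0 ρ θ • v)
        (ContinuousLinearMap.id ℂ _) p := (hasFDerivAt_id p).add_const _
      have h2 := (hfat p hp θ).hasFDerivAt.comp p h1
      rw [ContinuousLinearMap.comp_id] at h2
      exact h2.const_mul (k θ))
  have heq : (fun p => fderiv ℂ f p v) =ᶠ[𝓝 p₀] fun p => (2 * Real.pi * Complex.I)⁻¹ •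
      ∫ θ in (0 : ℝ)..2 * Real.pi, k θ * f (p + circleMap 0 ρ θ • v) := by
    filter_upwards [ball_mem_nhds p₀ hr0] with p hp
    exact deriv_line_eq_integral (hfR.mono (hsub p hp)) hρ0 hv
  exact DifferentiableAt.congr_of_eventuallyEq
    (key.differentiableAt.const_smul (2 * Real.pi * Complex.I : ℂ)⁻¹) heq

theorem contDiffOn_nat_of_differentiableOn (hU : IsOpen U) (n : ℕ) :
    ∀ {f : (Fin 4 → ℂ) → ℂ}, DifferentiableOn ℂ f U → ContDiffOn ℂ n f U := by
  induction n with
  | zero => exact fun hf => contDiffOn_zero.2 hf.continuousOn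
  | succ n ih =>
    intro f hf
    rw [Nat.cast_add, Nat.cast_one, contDiffOn_succ_iff_fderiv_of_isOpen hU]
    refine ⟨hf, by simp, contDiffOn_clm_apply.2 fun v => ?_⟩
    exact ih (differentiableOn_fderiv_apply hU hf v)

theorem contDiffOn_pi_of_differentiableOn (hU : IsOpen U) (n : ℕ)
    {φ : (Fin 4 → ℂ) → Fin 4 → ℂ} (hφ : DifferentiableOn ℂ φ U) : ContDiffOn ℂ n φ U :=
  contDiffOn_pi.2 fun i => contDiffOn_nat_of_differentiableOn hU n (differentiableOn_pi.1 hφ i)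

/-- Identity theorem: a holomorphic function on a connected open set that vanishes near one point
vanishes. -/
theorem eq_zero_of_eventually_eq_zero (hU : IsOpen U) (hU' : IsPreconnected U)
    (hf : DifferentiableOn ℂ f U) {p : Fin 4 → ℂ} (hp : p ∈ U) (h0 : ∀ᶠ q in 𝓝 p, f q = 0) :
    ∀ q ∈ U, f q = 0 := by
  -- The set where `f` vanishes locally is open, and it is closed relative to `U`: around a limit
  -- point `q`, any `s` in a small ball is joined by a complex line to a point `a` of the set, and
  -- the one-variable identity theorem on the convex slice of the ball gives `f s = 0`.
  have hsub : U ⊆ {q | ∀ᶠ s in 𝓝 q, f s = 0} := by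
    refine hU'.subset_of_closure_inter_subset isOpen_setOfPred_eventually_nhds ⟨p, hp, h0⟩ ?_
    rintro q ⟨hq, hqU⟩
    obtain ⟨r, hr, hrU⟩ := Metric.isOpen_iff.1 hU q hqU
    obtain ⟨a, ha, haq⟩ := Metric.mem_closure_iff.1 hq r hr
    filter_upwards [ball_mem_nhds q hr] with s hs
    have haB : a ∈ ball q r := by rwa [mem_ball, dist_comm]
    set ℓ : ℂ → (Fin 4 → ℂ) := fun c => a + c • (s - a) with hℓ
    have hℓd : Differentiable ℂ ℓ := by fun_prop
    have hpre : IsPreconnected (ℓ ⁻¹' ball q r) := by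
      refine Convex.isPreconnected ?_
      intro c₁ h₁ c₂ h₂ α β hα hβ hαβ
      have : ℓ (α • c₁ + β • c₂) = α • ℓ c₁ + β • ℓ c₂ := by
        simp only [hℓ]
        have hb : β = 1 - α := by linarith
        subst hb
        ext i
        simp
        ring
      rw [mem_preimage, this]
      exact convex_ball q r h₁ h₂ hα hβ hαβ
    have hopen : IsOpen (ℓ ⁻¹' ball q r) := isOpen_ball.preimage hℓd.continuous
    have hg : AnalyticOnNhd ℂ (f ∘ ℓ) (ℓ ⁻¹' ball q r) :=
      (DifferentiableOn.comp (hf.mono hrU) hℓd.differentiableOn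
        (mapsTo_preimage _ _)).analyticOnNhd hopen
    have hℓ0 : ℓ 0 = a := by simp [hℓ]
    have hℓ1 : ℓ 1 = s := by simp [hℓ]
    have hz : f ∘ ℓ =ᶠ[𝓝 0] 0 := by
      have : Tendsto ℓ (𝓝 0) (𝓝 a) := hℓ0 ▸ hℓd.continuous.tendsto 0
      exact this.eventually ha
    have := hg.eqOn_zero_of_preconnected_of_eventuallyEq_zero hpre
      (show (0 : ℂ) ∈ _ by rw [mem_preimage, hℓ0]; exact haB) hz
      (show (1 : ℂ) ∈ _ by rw [mem_preimage, hℓ1]; exact hs)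
    simpa [hℓ1] using this
  exact fun q hq => (hsub hq).self_of_nhds

end Holomorphic

/-! ### Holomorphic isometries -/

/-- A holomorphic map whose derivatives preserve the standard bilinear form has a constant
derivative. -/
theorem fderiv_const_of_dotProduct_preserving {W : Set (Fin 4 → ℂ)} (hW : IsOpen W)
    (hW' : IsPreconnected W) {φ : (Fin 4 → ℂ) → Fin 4 → ℂ} (hφ : DifferentiableOn ℂ φ W)
    (h : ∀ p ∈ W, ∀ u v, fderiv ℂ φ p u ⬝ᵥ fderiv ℂ φ p v = u ⬝ᵥ v) :
    ∃ A, ∀ p ∈ W, fderiv ℂ φ p = A := by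
  have h2 : ContDiffOn ℂ 2 φ W := by exact_mod_cast contDiffOn_pi_of_differentiableOn hW 2 hφ
  have hd : DifferentiableOn ℂ (fderiv ℂ φ) W := by
    have := h2
    rw [show (2 : WithTop ℕ∞) = 1 + 1 by norm_num, contDiffOn_succ_iff_fderiv_of_isOpen hW] at this
    exact this.2.2.differentiableOn (by norm_num)
  refine hW.exists_is_const_of_fderiv_eq_zero hW' hd fun p hp => ?_
  have hsymm : ∀ u v, fderiv ℂ (fderiv ℂ φ) p u v = fderiv ℂ (fderiv ℂ φ) p v u :=
    ((h2.contDiffAt (hW.mem_nhds hp)).isSymmSndFDerivAt (by simp)).eq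
  set D := fderiv ℂ φ p with hD
  set H := fderiv ℂ (fderiv ℂ φ) p with hH
  -- The constancy of `Dφ u ⬝ Dφ v`, differentiated in the direction `w`.
  have hanti : ∀ w u v, H w u ⬝ᵥ D v + D u ⬝ᵥ H w v = 0 := by
    intro w u v
    have hdu : ∀ u, HasFDerivAt (fun q => fderiv ℂ φ q u)
        ((ContinuousLinearMap.apply ℂ _ u).comp H) p := fun u =>
      (ContinuousLinearMap.apply ℂ (Fin 4 → ℂ) u).hasFDerivAt.comp p
        (hd.differentiableAt (hW.mem_nhds hp)).hasFDerivAt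
    have hsum : HasFDerivAt (fun q => ∑ i, fderiv ℂ φ q u i * fderiv ℂ φ q v i)
        (∑ i, (D u i • ((ContinuousLinearMap.proj (R := ℂ) (φ := fun _ : Fin 4 => ℂ) i).comp
            ((ContinuousLinearMap.apply ℂ _ v).comp H)) +
          D v i • ((ContinuousLinearMap.proj (R := ℂ) (φ := fun _ : Fin 4 => ℂ) i).comp
            ((ContinuousLinearMap.apply ℂ _ u).comp H)))) p :=
      HasFDerivAt.fun_sum fun i _ =>
        (((ContinuousLinearMap.proj (R := ℂ) (φ := fun _ : Fin 4 => ℂ) i).hasFDerivAt).comp p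
          (hdu u)).mul
        (((ContinuousLinearMap.proj (R := ℂ) (φ := fun _ : Fin 4 => ℂ) i).hasFDerivAt).comp p
          (hdu v))
    have hconst : HasFDerivAt (fun q => ∑ i, fderiv ℂ φ q u i * fderiv ℂ φ q v i) 0 p :=
      (hasFDerivAt_const (𝕜 := ℂ) (u ⬝ᵥ v) p).congr_of_eventuallyEq
        (by filter_upwards [hW.mem_nhds hp] with q hq using h q hq u v)
    have := congrArg (fun L => L w) (hsum.unique hconst)
    simp only [sum_apply, add_apply,
      smul_apply, ContinuousLinearMap.comp_apply,
      ContinuousLinearMap.proj_apply, ContinuousLinearMap.apply_apply, smul_eq_mul,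
      zero_apply, Finset.sum_add_distrib] at this
    rw [add_comm]
    simpa [dotProduct, mul_comm] using this
  have hanti' : ∀ w u v, H w u ⬝ᵥ D v = -(H w v ⬝ᵥ D u) := fun w u v => by
    rw [eq_neg_iff_add_eq_zero, dotProduct_comm (H w v)]; exact hanti w u v
  -- The trilinear form `H w u ⬝ D v` is symmetric in `w, u` and antisymmetric in `u, v`.
  -- Alternating the two symmetries returns it with the opposite sign, as in the uniqueness of the
  -- Levi-Civita connection.
  have hzero : ∀ w u v, H w u ⬝ᵥ D v = 0 := by
    intro w u v
    have e1 := hanti' w u v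
    have e2 := hanti' u v w
    have e3 := hanti' v w u
    rw [hsymm u v] at e2
    rw [hsymm v w] at e3
    rw [hsymm u w] at e2
    have : H w u ⬝ᵥ D v = -(H w u ⬝ᵥ D v) := by
      rw [e3, neg_neg] at e1
      exact e1.trans e2
    exact self_eq_neg.1 this
  -- `D` preserves a nondegenerate form, so it is bijective; the vectors `D v` then test every
  -- component of `H w u`.
  have hinj : Function.Injective D := by
    refine (injective_iff_map_eq_zero D).2 fun u hu => ?_
    refine funext fun i => ?_
    have := h p hp u (Pi.single i 1)
    rw [← hD, hu, zero_dotProduct, dotProduct_single, mul_one] at this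
    exact this.symm
  have hsurj : Function.Surjective D :=
    (LinearMap.injective_iff_surjective (f := (D : (Fin 4 → ℂ) →ₗ[ℂ] (Fin 4 → ℂ)))).1 hinj
  refine ContinuousLinearMap.ext fun w => ContinuousLinearMap.ext fun u => funext fun i => ?_
  obtain ⟨v, hv⟩ := hsurj (Pi.single i 1)
  have := hzero w u v
  rw [hv, dotProduct_single, mul_one] at this
  exact this

noncomputable section

/-! ### Jacobi matrices and derivatives along coordinate lines -/

namespace AlgFrobenius

/-- The Jacobi matrix `∂fₐ/∂tₗ`. -/
def jac (f : (Fin 4 → ℂ) → Fin 4 → ℂ) (t : Fin 4 → ℂ) : Matrix (Fin 4) (Fin 4) ℂ :=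
  Matrix.of fun a l => partialD l (fun s => f s a) t

theorem jac_apply (f : (Fin 4 → ℂ) → Fin 4 → ℂ) (t : Fin 4 → ℂ) (a l : Fin 4) :
    jac f t a l = partialD l (fun s => f s a) t := rfl

theorem hasDerivAt_line {f : (Fin 4 → ℂ) → ℂ} {t : Fin 4 → ℂ} (hf : DifferentiableAt ℂ f t)
    (i : Fin 4) :
    HasDerivAt (fun s : ℂ => f (t + s • Pi.single i 1)) (partialD i f t) 0 := by
  have hfd : HasFDerivAt f (fderiv ℂ f t) (t + (0 : ℂ) • Pi.single i 1) := by
    rw [zero_smul, add_zero]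
    exact hf.hasFDerivAt
  have hl : HasDerivAt (fun s : ℂ => t + s • (Pi.single i 1 : Fin 4 → ℂ)) (Pi.single i 1) 0 := by
    simpa using ((hasDerivAt_id (0 : ℂ)).smul_const (Pi.single i 1 : Fin 4 → ℂ)).const_add t
  exact hfd.comp_hasDerivAt (0 : ℂ) hl

/-- The bridge to explicit computation: once differentiability is known, a partial derivative is
read off from a one-variable derivative along a coordinate line. -/
theorem partialD_eq_of_hasDerivAt {f : (Fin 4 → ℂ) → ℂ} {t : Fin 4 → ℂ}
    (hf : DifferentiableAt ℂ f t) {i : Fin 4} {d : ℂ}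
    (hd : HasDerivAt (fun s : ℂ => f (t + s • Pi.single i 1)) d 0) : partialD i f t = d :=
  (hasDerivAt_line hf i).unique hd

theorem hasDerivAt_line_apply (t : Fin 4 → ℂ) (i j : Fin 4) :
    HasDerivAt (fun s : ℂ => (t + s • (Pi.single i 1 : Fin 4 → ℂ)) j)
      ((Pi.single i 1 : Fin 4 → ℂ) j) 0 := by
  have h : HasDerivAt (fun s : ℂ => t j + s * (Pi.single i 1 : Fin 4 → ℂ) j)
      ((Pi.single i 1 : Fin 4 → ℂ) j) 0 := by
    simpa using ((hasDerivAt_id (0 : ℂ)).mul_const ((Pi.single i 1 : Fin 4 → ℂ) j)).const_add (t j)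
  exact h

end AlgFrobenius

namespace H42

open AlgFrobenius

theorem sqrtFive_sq : sqrtFive ^ 2 = 5 := by
  rw [sqrtFive, ← Complex.ofReal_pow, Real.sq_sqrt (by norm_num)]
  norm_num

/-! ### The gradients of the basic invariants of `H₃` -/

def gradEps1 (p q r : ℂ) : Fin 3 → ℂ := ![2 * p, 2 * q, 2 * r]

def gradEps2 (p q r : ℂ) : Fin 3 → ℂ :=
  ![2 * p * (q ^ 2 + r ^ 2), 2 * q * (p ^ 2 + r ^ 2), 2 * r * (p ^ 2 + q ^ 2)]

def gradEps3 (p q r : ℂ) : Fin 3 → ℂ :=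
  ![2 * p * (q ^ 2 * r ^ 2), 2 * q * (p ^ 2 * r ^ 2), 2 * r * (p ^ 2 * q ^ 2)]

def gradDelta (p q r : ℂ) : Fin 3 → ℂ :=
  ![2 * p * (q ^ 2 - r ^ 2) * (2 * p ^ 2 - q ^ 2 - r ^ 2),
    2 * q * (p ^ 2 - r ^ 2) * (p ^ 2 + r ^ 2 - 2 * q ^ 2),
    2 * r * (p ^ 2 - q ^ 2) * (2 * r ^ 2 - p ^ 2 - q ^ 2)]

def gradH2 (p q r : ℂ) : Fin 3 → ℂ := gradEps1 p q r

/-- Chain rule: the coefficients are the partial derivatives of `h6` as a polynomial in `eps1`,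
`eps2`, `eps3`, `delta`. `gradH10` is formed in the same way. -/
def gradH6 (p q r : ℂ) : Fin 3 → ℂ := fun a =>
    (eps2 p q r) * gradEps1 p q r a + (eps1 p q r) * gradEps2 p q r a + (-11) * gradEps3 p q r a
    + (sqrtFive) * gradDelta p q r a

def gradH10 (p q r : ℂ) : Fin 3 → ℂ := fun a =>
    (6 * eps1 p q r ^ 2 * eps2 p q r - 64 * eps1 p q r * eps3 p q r
    - 5 * eps2 p q r ^ 2) * gradEps1 p q r a + (3 * sqrtFive * delta p q r + 2 * eps1 p q r ^ 3
    - 10 * eps1 p q r * eps2 p q r + 95 * eps3 p q r) * gradEps2 p q r a + (-32 * eps1 p q r ^ 2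
    + 95 * eps2 p q r) * gradEps3 p q r a + (3 * sqrtFive * eps2 p q r) * gradDelta p q r a

/-- The discriminant of the cubic with roots `p², q², r²`. It eliminates even powers of `delta` in
favour of the symmetric functions. -/
theorem delta_sq (p q r : ℂ) : delta p q r ^ 2 = eps1 p q r ^ 2 * eps2 p q r ^ 2
    - 4 * eps2 p q r ^ 3 - 4 * eps1 p q r ^ 3 * eps3 p q r
    + 18 * eps1 p q r * eps2 p q r * eps3 p q r - 27 * eps3 p q r ^ 2 := by
  unfold delta eps1 eps2 eps3
  ring

/-- Start of the table of inner products for `eps1`, `eps2`, `eps3`, `delta`. Since `gradEps1` is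
twice the position vector, its product with the gradient of a homogeneous function is twice the
degree times the function. -/
theorem gradEps1_dot_gradEps1 (p q r : ℂ) :
    gradEps1 p q r ⬝ᵥ gradEps1 p q r = 4 * eps1 p q r := by
  simp [dotProduct, Fin.sum_univ_three, gradEps1, delta, eps1, eps2, eps3]
  ring

theorem gradEps1_dot_gradEps2 (p q r : ℂ) :
    gradEps1 p q r ⬝ᵥ gradEps2 p q r = 8 * eps2 p q r := by
  simp [dotProduct, Fin.sum_univ_three, gradEps1, gradEps2, delta, eps1, eps2, eps3]
  ring

theorem gradEps1_dot_gradEps3 (p q r : ℂ) :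
    gradEps1 p q r ⬝ᵥ gradEps3 p q r = 12 * eps3 p q r := by
  simp [dotProduct, Fin.sum_univ_three, gradEps1, gradEps3, delta, eps1, eps2, eps3]
  ring

theorem gradEps1_dot_gradDelta (p q r : ℂ) :
    gradEps1 p q r ⬝ᵥ gradDelta p q r = 12 * delta p q r := by
  simp [dotProduct, Fin.sum_univ_three, gradEps1, gradDelta, delta, eps1, eps2, eps3]
  ring

theorem gradEps2_dot_gradEps2 (p q r : ℂ) :
    gradEps2 p q r ⬝ᵥ gradEps2 p q r = 4 * eps1 p q r * eps2 p q r + 12 * eps3 p q r := by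
  simp [dotProduct, Fin.sum_univ_three, gradEps2, delta, eps1, eps2, eps3]
  ring

theorem gradEps2_dot_gradEps3 (p q r : ℂ) :
    gradEps2 p q r ⬝ᵥ gradEps3 p q r = 8 * eps1 p q r * eps3 p q r := by
  simp [dotProduct, Fin.sum_univ_three, gradEps2, gradEps3, delta, eps1, eps2, eps3]
  ring

theorem gradEps2_dot_gradDelta (p q r : ℂ) :
    gradEps2 p q r ⬝ᵥ gradDelta p q r = 4 * eps1 p q r * delta p q r := by
  simp [dotProduct, Fin.sum_univ_three, gradEps2, gradDelta, delta, eps1, eps2, eps3]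
  ring

theorem gradEps3_dot_gradEps3 (p q r : ℂ) :
    gradEps3 p q r ⬝ᵥ gradEps3 p q r = 4 * eps2 p q r * eps3 p q r := by
  simp [dotProduct, Fin.sum_univ_three, gradEps3, delta, eps1, eps2, eps3]
  ring

theorem gradEps3_dot_gradDelta (p q r : ℂ) :
    gradEps3 p q r ⬝ᵥ gradDelta p q r = 0 := by
  simp [dotProduct, Fin.sum_univ_three, gradEps3, gradDelta]
  ring

theorem gradDelta_dot_gradDelta (p q r : ℂ) :
    gradDelta p q r ⬝ᵥ gradDelta p q r = 4 * eps1 p q r ^ 3 * eps2 p q r - 36 * eps1 p q r ^ 2 * eps3 p q r - 12 * eps1 p q r * eps2 p q r ^ 2 + 108 * eps2 p q r * eps3 p q r := by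
  simp [dotProduct, Fin.sum_univ_three, gradDelta, delta, eps1, eps2, eps3]
  ring

theorem gradH2_dot_gradH2 (p q r : ℂ) :
    gradH2 p q r ⬝ᵥ gradH2 p q r = 4 * h2 p q r := by
  exact gradEps1_dot_gradEps1 p q r

theorem gradH2_dot_gradH6 (p q r : ℂ) :
    gradH2 p q r ⬝ᵥ gradH6 p q r = 12 * h6 p q r := by
  simp only [dotProduct, Fin.sum_univ_three, gradH2, gradH6, h6]
  linear_combination (norm := (simp only [dotProduct, Fin.sum_univ_three]; ring))
    (eps2 p q r) * gradEps1_dot_gradEps1 p q r + (eps1 p q r) * gradEps1_dot_gradEps2 p q r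
    + (-11) * gradEps1_dot_gradEps3 p q r + (sqrtFive) * gradEps1_dot_gradDelta p q r

theorem gradH2_dot_gradH10 (p q r : ℂ) :
    gradH2 p q r ⬝ᵥ gradH10 p q r = 20 * h10 p q r := by
  simp only [dotProduct, Fin.sum_univ_three, gradH2, gradH10, h10]
  linear_combination (norm := (simp only [dotProduct, Fin.sum_univ_three]; ring))
    (6 * eps1 p q r ^ 2 * eps2 p q r - 64 * eps1 p q r * eps3 p q r
    - 5 * eps2 p q r ^ 2) * gradEps1_dot_gradEps1 p q r + (3 * sqrtFive * delta p q r
    + 2 * eps1 p q r ^ 3 - 10 * eps1 p q r * eps2 p q r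
    + 95 * eps3 p q r) * gradEps1_dot_gradEps2 p q r + (-32 * eps1 p q r ^ 2
    + 95 * eps2 p q r) * gradEps1_dot_gradEps3 p q r
    + (3 * sqrtFive * eps2 p q r) * gradEps1_dot_gradDelta p q r

/-- The inner product is `H₃`-invariant, hence a polynomial in `h2, h6, h10`. The check is bilinear
expansion over the table above, with `√5² = 5`; the products involving `h10` also need `delta_sq`.
-/
theorem gradH6_dot_gradH6 (p q r : ℂ) :
    gradH6 p q r ⬝ᵥ gradH6 p q r = 8 * h2 p q r ^ 2 * h6 p q r + 8 * h10 p q r := by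
  simp only [dotProduct, Fin.sum_univ_three, gradH6, h2, h6, h10]
  linear_combination (norm := (simp only [dotProduct, Fin.sum_univ_three]; ring))
    (eps2 p q r ^ 2) * gradEps1_dot_gradEps1 p q r
    + (2 * eps1 p q r * eps2 p q r) * gradEps1_dot_gradEps2 p q r
    + (-22 * eps2 p q r) * gradEps1_dot_gradEps3 p q r
    + (2 * sqrtFive * eps2 p q r) * gradEps1_dot_gradDelta p q r
    + (eps1 p q r ^ 2) * gradEps2_dot_gradEps2 p q r
    + (-22 * eps1 p q r) * gradEps2_dot_gradEps3 p q r
    + (2 * sqrtFive * eps1 p q r) * gradEps2_dot_gradDelta p q r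
    + (121) * gradEps3_dot_gradEps3 p q r + (-22 * sqrtFive) * gradEps3_dot_gradDelta p q r
    + (sqrtFive ^ 2) * gradDelta_dot_gradDelta p q r + (4 * eps1 p q r ^ 3 * eps2 p q r
    - 36 * eps1 p q r ^ 2 * eps3 p q r - 12 * eps1 p q r * eps2 p q r ^ 2
    + 108 * eps2 p q r * eps3 p q r) * sqrtFive_sq

theorem gradH6_dot_gradH10 (p q r : ℂ) :
    gradH6 p q r ⬝ᵥ gradH10 p q r = 8 * h2 p q r ^ 4 * h6 p q r + 28 * h2 p q r * h6 p q r ^ 2 := by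
  simp only [dotProduct, Fin.sum_univ_three, gradH6, gradH10, h2, h6]
  linear_combination (norm := (simp only [dotProduct, Fin.sum_univ_three]; ring))
    (6 * eps1 p q r ^ 2 * eps2 p q r ^ 2 - 64 * eps1 p q r * eps2 p q r * eps3 p q r
    - 5 * eps2 p q r ^ 3) * gradEps1_dot_gradEps1 p q r + (3 * sqrtFive * eps2 p q r * delta p q r
    + 8 * eps1 p q r ^ 3 * eps2 p q r - 64 * eps1 p q r ^ 2 * eps3 p q r
    - 15 * eps1 p q r * eps2 p q r ^ 2
    + 95 * eps2 p q r * eps3 p q r) * gradEps1_dot_gradEps2 p q r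
    + (-98 * eps1 p q r ^ 2 * eps2 p q r + 704 * eps1 p q r * eps3 p q r
    + 150 * eps2 p q r ^ 2) * gradEps1_dot_gradEps3 p q r
    + (6 * sqrtFive * eps1 p q r ^ 2 * eps2 p q r - 64 * sqrtFive * eps1 p q r * eps3 p q r
    - 2 * sqrtFive * eps2 p q r ^ 2) * gradEps1_dot_gradDelta p q r
    + (3 * sqrtFive * eps1 p q r * delta p q r + 2 * eps1 p q r ^ 4
    - 10 * eps1 p q r ^ 2 * eps2 p q r
    + 95 * eps1 p q r * eps3 p q r) * gradEps2_dot_gradEps2 p q r + (-33 * sqrtFive * delta p q r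
    - 54 * eps1 p q r ^ 3 + 205 * eps1 p q r * eps2 p q r
    - 1045 * eps3 p q r) * gradEps2_dot_gradEps3 p q r + (3 * sqrtFive ^ 2 * delta p q r
    + 2 * sqrtFive * eps1 p q r ^ 3 - 7 * sqrtFive * eps1 p q r * eps2 p q r
    + 95 * sqrtFive * eps3 p q r) * gradEps2_dot_gradDelta p q r + (352 * eps1 p q r ^ 2
    - 1045 * eps2 p q r) * gradEps3_dot_gradEps3 p q r + (-32 * sqrtFive * eps1 p q r ^ 2
    + 62 * sqrtFive * eps2 p q r) * gradEps3_dot_gradDelta p q r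
    + (3 * sqrtFive ^ 2 * eps2 p q r) * gradDelta_dot_gradDelta p q r
    + (12 * eps1 p q r ^ 3 * eps2 p q r ^ 2 - 108 * eps1 p q r ^ 2 * eps2 p q r * eps3 p q r
    - 36 * eps1 p q r * eps2 p q r ^ 3 - 16 * eps1 p q r * delta p q r ^ 2
    + 324 * eps2 p q r ^ 2 * eps3 p q r) * sqrtFive_sq + (-80 * eps1 p q r) * delta_sq p q r

theorem gradH10_dot_gradH10 (p q r : ℂ) :
    gradH10 p q r ⬝ᵥ gradH10 p q r = 8 * h2 p q r ^ 4 * h10 p q r + 36 * h2 p q r ^ 3 * h6 p q r ^ 2 + 30 * h6 p q r ^ 3 := by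
  simp only [dotProduct, Fin.sum_univ_three, gradH10, h2, h6, h10]
  linear_combination (norm := (simp only [dotProduct, Fin.sum_univ_three]; ring))
    (36 * eps1 p q r ^ 4 * eps2 p q r ^ 2 - 768 * eps1 p q r ^ 3 * eps2 p q r * eps3 p q r
    - 60 * eps1 p q r ^ 2 * eps2 p q r ^ 3 + 4096 * eps1 p q r ^ 2 * eps3 p q r ^ 2
    + 640 * eps1 p q r * eps2 p q r ^ 2 * eps3 p q r
    + 25 * eps2 p q r ^ 4) * gradEps1_dot_gradEps1 p q r
    + (36 * sqrtFive * eps1 p q r ^ 2 * eps2 p q r * delta p q r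
    - 384 * sqrtFive * eps1 p q r * eps3 p q r * delta p q r
    - 30 * sqrtFive * eps2 p q r ^ 2 * delta p q r + 24 * eps1 p q r ^ 5 * eps2 p q r
    - 256 * eps1 p q r ^ 4 * eps3 p q r - 140 * eps1 p q r ^ 3 * eps2 p q r ^ 2
    + 2420 * eps1 p q r ^ 2 * eps2 p q r * eps3 p q r + 100 * eps1 p q r * eps2 p q r ^ 3
    - 12160 * eps1 p q r * eps3 p q r ^ 2
    - 950 * eps2 p q r ^ 2 * eps3 p q r) * gradEps1_dot_gradEps2 p q r
    + (-384 * eps1 p q r ^ 4 * eps2 p q r + 4096 * eps1 p q r ^ 3 * eps3 p q r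
    + 1460 * eps1 p q r ^ 2 * eps2 p q r ^ 2 - 12160 * eps1 p q r * eps2 p q r * eps3 p q r
    - 950 * eps2 p q r ^ 3) * gradEps1_dot_gradEps3 p q r
    + (36 * sqrtFive * eps1 p q r ^ 2 * eps2 p q r ^ 2
    - 384 * sqrtFive * eps1 p q r * eps2 p q r * eps3 p q r
    - 30 * sqrtFive * eps2 p q r ^ 3) * gradEps1_dot_gradDelta p q r
    + (9 * sqrtFive ^ 2 * delta p q r ^ 2 + 12 * sqrtFive * eps1 p q r ^ 3 * delta p q r
    - 60 * sqrtFive * eps1 p q r * eps2 p q r * delta p q r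
    + 570 * sqrtFive * eps3 p q r * delta p q r + 4 * eps1 p q r ^ 6
    - 40 * eps1 p q r ^ 4 * eps2 p q r + 380 * eps1 p q r ^ 3 * eps3 p q r
    + 100 * eps1 p q r ^ 2 * eps2 p q r ^ 2 - 1900 * eps1 p q r * eps2 p q r * eps3 p q r
    + 9025 * eps3 p q r ^ 2) * gradEps2_dot_gradEps2 p q r
    + (-192 * sqrtFive * eps1 p q r ^ 2 * delta p q r + 570 * sqrtFive * eps2 p q r * delta p q r
    - 128 * eps1 p q r ^ 5 + 1020 * eps1 p q r ^ 3 * eps2 p q r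
    - 6080 * eps1 p q r ^ 2 * eps3 p q r - 1900 * eps1 p q r * eps2 p q r ^ 2
    + 18050 * eps2 p q r * eps3 p q r) * gradEps2_dot_gradEps3 p q r
    + (18 * sqrtFive ^ 2 * eps2 p q r * delta p q r + 12 * sqrtFive * eps1 p q r ^ 3 * eps2 p q r
    - 60 * sqrtFive * eps1 p q r * eps2 p q r ^ 2
    + 570 * sqrtFive * eps2 p q r * eps3 p q r) * gradEps2_dot_gradDelta p q r
    + (1024 * eps1 p q r ^ 4 - 6080 * eps1 p q r ^ 2 * eps2 p q r
    + 9025 * eps2 p q r ^ 2) * gradEps3_dot_gradEps3 p q r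
    + (-192 * sqrtFive * eps1 p q r ^ 2 * eps2 p q r
    + 570 * sqrtFive * eps2 p q r ^ 2) * gradEps3_dot_gradDelta p q r
    + (9 * sqrtFive ^ 2 * eps2 p q r ^ 2) * gradDelta_dot_gradDelta p q r
    + (-30 * sqrtFive * delta p q r ^ 3 + 36 * eps1 p q r ^ 3 * eps2 p q r ^ 3
    - 36 * eps1 p q r ^ 3 * delta p q r ^ 2 - 324 * eps1 p q r ^ 2 * eps2 p q r ^ 2 * eps3 p q r
    - 108 * eps1 p q r * eps2 p q r ^ 4 + 18 * eps1 p q r * eps2 p q r * delta p q r ^ 2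
    + 972 * eps2 p q r ^ 3 * eps3 p q r + 1098 * eps3 p q r * delta p q r ^ 2) * sqrtFive_sq
    + (-150 * sqrtFive * delta p q r - 180 * eps1 p q r ^ 3 + 90 * eps1 p q r * eps2 p q r
    + 5490 * eps3 p q r) * delta_sq p q r

/-! ### Derivatives of the basic invariants of `H₃` along a curve -/

section Curve

variable {p q r : ℂ → ℂ} {v : Fin 3 → ℂ} {s : ℂ}

theorem hasDerivAt_eps1 (hp : HasDerivAt p (v 0) s) (hq : HasDerivAt q (v 1) s)
    (hr : HasDerivAt r (v 2) s) :
    HasDerivAt (fun s => eps1 (p s) (q s) (r s)) (gradEps1 (p s) (q s) (r s) ⬝ᵥ v) s := by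
  unfold eps1
  apply HasDerivAt.congr_deriv
  -- The first goal builds the derivative from the sum, product and power rules with its value left
  -- open; the second compares that value with the closed form.
  · with_reducible repeat' first
      | exact hp | exact hq | exact hr
      | apply HasDerivAt.fun_add | apply HasDerivAt.fun_sub | apply HasDerivAt.fun_mul
      | apply HasDerivAt.fun_pow
  · simp [dotProduct, Fin.sum_univ_three, gradEps1]

theorem hasDerivAt_eps2 (hp : HasDerivAt p (v 0) s) (hq : HasDerivAt q (v 1) s)
    (hr : HasDerivAt r (v 2) s) :
    HasDerivAt (fun s => eps2 (p s) (q s) (r s)) (gradEps2 (p s) (q s) (r s) ⬝ᵥ v) s := by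
  unfold eps2
  apply HasDerivAt.congr_deriv
  · with_reducible repeat' first
      | exact hp | exact hq | exact hr
      | apply HasDerivAt.fun_add | apply HasDerivAt.fun_sub | apply HasDerivAt.fun_mul
      | apply HasDerivAt.fun_pow
  · simp [dotProduct, Fin.sum_univ_three, gradEps2]
    ring

theorem hasDerivAt_eps3 (hp : HasDerivAt p (v 0) s) (hq : HasDerivAt q (v 1) s)
    (hr : HasDerivAt r (v 2) s) :
    HasDerivAt (fun s => eps3 (p s) (q s) (r s)) (gradEps3 (p s) (q s) (r s) ⬝ᵥ v) s := by
  unfold eps3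
  apply HasDerivAt.congr_deriv
  · with_reducible repeat' first
      | exact hp | exact hq | exact hr
      | apply HasDerivAt.fun_add | apply HasDerivAt.fun_sub | apply HasDerivAt.fun_mul
      | apply HasDerivAt.fun_pow
  · simp [dotProduct, Fin.sum_univ_three, gradEps3]
    ring

theorem hasDerivAt_delta (hp : HasDerivAt p (v 0) s) (hq : HasDerivAt q (v 1) s)
    (hr : HasDerivAt r (v 2) s) :
    HasDerivAt (fun s => delta (p s) (q s) (r s)) (gradDelta (p s) (q s) (r s) ⬝ᵥ v) s := by
  unfold delta
  apply HasDerivAt.congr_deriv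
  · with_reducible repeat' first
      | exact hp | exact hq | exact hr
      | apply HasDerivAt.fun_add | apply HasDerivAt.fun_sub | apply HasDerivAt.fun_mul
      | apply HasDerivAt.fun_pow
  · simp [dotProduct, Fin.sum_univ_three, gradDelta]
    ring

theorem hasDerivAt_h2 (hp : HasDerivAt p (v 0) s) (hq : HasDerivAt q (v 1) s)
    (hr : HasDerivAt r (v 2) s) :
    HasDerivAt (fun s => h2 (p s) (q s) (r s)) (gradH2 (p s) (q s) (r s) ⬝ᵥ v) s :=
  hasDerivAt_eps1 hp hq hr

theorem hasDerivAt_h6 (hp : HasDerivAt p (v 0) s) (hq : HasDerivAt q (v 1) s)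
    (hr : HasDerivAt r (v 2) s) :
    HasDerivAt (fun s => h6 (p s) (q s) (r s)) (gradH6 (p s) (q s) (r s) ⬝ᵥ v) s := by
  have d1 := hasDerivAt_eps1 hp hq hr
  have d2 := hasDerivAt_eps2 hp hq hr
  have d3 := hasDerivAt_eps3 hp hq hr
  have d4 := hasDerivAt_delta hp hq hr
  unfold h6
  apply HasDerivAt.congr_deriv
  · with_reducible repeat' first
      | exact d1 | exact d2 | exact d3 | exact d4 | exact hasDerivAt_const _ _
      | apply HasDerivAt.fun_add | apply HasDerivAt.fun_sub | apply HasDerivAt.fun_mul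
  · simp only [dotProduct, Fin.sum_univ_three, gradH6, Nat.cast_ofNat, Nat.add_one_sub_one,
      Nat.reduceSub, pow_one]
    ring

theorem hasDerivAt_h10 (hp : HasDerivAt p (v 0) s) (hq : HasDerivAt q (v 1) s)
    (hr : HasDerivAt r (v 2) s) :
    HasDerivAt (fun s => h10 (p s) (q s) (r s)) (gradH10 (p s) (q s) (r s) ⬝ᵥ v) s := by
  have d1 := hasDerivAt_eps1 hp hq hr
  have d2 := hasDerivAt_eps2 hp hq hr
  have d3 := hasDerivAt_eps3 hp hq hr
  have d4 := hasDerivAt_delta hp hq hr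
  unfold h10
  apply HasDerivAt.congr_deriv
  · with_reducible repeat' first
      | exact d1 | exact d2 | exact d3 | exact d4 | exact hasDerivAt_const _ _
      | apply HasDerivAt.fun_add | apply HasDerivAt.fun_sub | apply HasDerivAt.fun_mul
      | apply HasDerivAt.fun_pow
  · simp only [dotProduct, Fin.sum_univ_three, gradH10, Nat.cast_ofNat, Nat.add_one_sub_one,
      Nat.reduceSub, pow_one]
    ring

end Curve

end H42

end

noncomputable section

namespace H42

open AlgFrobenius

/-! ### The partial derivatives of the basic invariants of `H₄` with respect to `x₁, h₂, h₆, h₁₀` -/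

def inv1PolyX (x1 h2 h6 h10 : ℂ) : ℂ :=
    x1 ^ 23 * 256 * h2 ^ 3 - x1 ^ 21 * (1760 * h2 ^ 4 + 2640 * h2 * h6) + x1 ^ 19 * (5376 * h2 ^ 5
    + 13440 * h2 ^ 2 * h6 + 7200 * h10) + x1 ^ 17 * (-7968 * h2 ^ 6 - 28944 * h2 ^ 3 * h6
    - 51840 * h2 * h10 + 19440 * h6 ^ 2) + x1 ^ 15 * (4352 * h2 ^ 7 + 19968 * h2 ^ 4 * h6
    + 160384 * h2 ^ 2 * h10 - 90048 * h2 * h6 ^ 2) + x1 ^ 13 * (3808 * h2 ^ 8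
    - 235984 * h2 ^ 3 * h10 + 260232 * h2 ^ 2 * h6 ^ 2 - 106680 * h6 * h10)
    + x1 ^ 11 * (-5312 * h2 ^ 9 - 14976 * h2 ^ 6 * h6 + 170592 * h2 ^ 4 * h10
    - 328752 * h2 ^ 3 * h6 ^ 2 + 282096 * h2 * h6 * h10 - 69552 * h6 ^ 3)
    + x1 ^ 9 * (2688 * h2 ^ 10 + 16080 * h2 ^ 7 * h6 - 71600 * h2 ^ 5 * h10
    + 199680 * h2 ^ 4 * h6 ^ 2 - 253320 * h2 ^ 2 * h6 * h10 + 73500 * h2 * h6 ^ 3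
    + 32400 * h10 ^ 2) + x1 ^ 7 * (-640 * h2 ^ 11 - 5376 * h2 ^ 8 * h6 + 17152 * h2 ^ 6 * h10
    - 55392 * h2 ^ 5 * h6 ^ 2 + 87264 * h2 ^ 3 * h6 * h10 - 15648 * h2 ^ 2 * h6 ^ 3
    - 25856 * h2 * h10 ^ 2 - 7248 * h6 ^ 2 * h10) + x1 ^ 5 * (64 * h2 ^ 12 + 720 * h2 ^ 9 * h6
    - 2064 * h2 ^ 7 * h10 + 7992 * h2 ^ 6 * h6 ^ 2 - 13032 * h2 ^ 4 * h6 * h10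
    + 1728 * h2 ^ 3 * h6 ^ 3 + 7008 * h2 ^ 2 * h10 ^ 2 - 11448 * h2 * h6 ^ 2 * h10
    + 14364 * h6 ^ 4) + x1 ^ 3 * (64 * h2 ^ 8 * h10 - 336 * h2 ^ 7 * h6 ^ 2
    + 240 * h2 ^ 5 * h6 * h10 + 336 * h2 ^ 4 * h6 ^ 3 - 608 * h2 ^ 3 * h10 ^ 2
    + 1632 * h2 ^ 2 * h6 ^ 2 * h10 - 3636 * h2 * h6 ^ 4 + 1392 * h6 * h10 ^ 2)
    + x1 * (-12 * h2 ^ 5 * h6 ^ 3 + 16 * h2 ^ 4 * h10 ^ 2 - 84 * h2 ^ 3 * h6 ^ 2 * h10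
    + 270 * h2 ^ 2 * h6 ^ 4 - 174 * h6 ^ 3 * h10)

def inv1PolyH2 (x1 h2 h6 h10 : ℂ) : ℂ :=
    x1 ^ 24 * 32 * h2 ^ 2 - x1 ^ 22 * (320 * h2 ^ 3 + 120 * h6) + x1 ^ 20 * (1344 * h2 ^ 4
    + 1344 * h2 * h6) - x1 ^ 18 * (2656 * h2 ^ 5 + 4824 * h2 ^ 2 * h6 + 2880 * h10)
    + x1 ^ 16 * (1904 * h2 ^ 6 + 4992 * h2 ^ 3 * h6 + 20048 * h2 * h10 - 5628 * h6 ^ 2)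
    + x1 ^ 14 * (2176 * h2 ^ 7 - 50568 * h2 ^ 2 * h10 + 37176 * h2 * h6 ^ 2)
    + x1 ^ 12 * (-3984 * h2 ^ 8 - 7488 * h2 ^ 5 * h6 + 56864 * h2 ^ 3 * h10
    - 82188 * h2 ^ 2 * h6 ^ 2 + 23508 * h6 * h10) + x1 ^ 10 * (2688 * h2 ^ 9 + 11256 * h2 ^ 6 * h6
    - 35800 * h2 ^ 4 * h10 + 79872 * h2 ^ 3 * h6 ^ 2 - 50664 * h2 * h6 * h10 + 7350 * h6 ^ 3)
    + x1 ^ 8 * (-880 * h2 ^ 10 - 5376 * h2 ^ 7 * h6 + 12864 * h2 ^ 5 * h10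
    - 34620 * h2 ^ 4 * h6 ^ 2 + 32724 * h2 ^ 2 * h6 * h10 - 3912 * h2 * h6 ^ 3 - 3232 * h10 ^ 2)
    + x1 ^ 6 * (128 * h2 ^ 11 + 1080 * h2 ^ 8 * h6 - 2408 * h2 ^ 6 * h10 + 7992 * h2 ^ 5 * h6 ^ 2
    - 8688 * h2 ^ 3 * h6 * h10 + 864 * h2 ^ 2 * h6 ^ 3 + 2336 * h2 * h10 ^ 2
    - 1908 * h6 ^ 2 * h10) + x1 ^ 4 * (128 * h2 ^ 7 * h10 - 588 * h2 ^ 6 * h6 ^ 2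
    + 300 * h2 ^ 4 * h6 * h10 + 336 * h2 ^ 3 * h6 ^ 3 - 456 * h2 ^ 2 * h10 ^ 2
    + 816 * h2 * h6 ^ 2 * h10 - 909 * h6 ^ 4) + x1 ^ 2 * (-30 * h2 ^ 4 * h6 ^ 3
    + 32 * h2 ^ 3 * h10 ^ 2 - 126 * h2 ^ 2 * h6 ^ 2 * h10 + 270 * h2 * h6 ^ 4) - 3 * h6 ^ 3 * h10

def inv1PolyH6 (x1 h2 h6 h10 : ℂ) : ℂ :=
    -x1 ^ 22 * 120 * h2 + x1 ^ 20 * 672 * h2 ^ 2 + x1 ^ 18 * (-1608 * h2 ^ 3 + 2160 * h6)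
    + x1 ^ 16 * (1248 * h2 ^ 4 - 11256 * h2 * h6) + x1 ^ 14 * (37176 * h2 ^ 2 * h6 - 7620 * h10)
    + x1 ^ 12 * (-1248 * h2 ^ 6 - 54792 * h2 ^ 3 * h6 + 23508 * h2 * h10 - 17388 * h6 ^ 2)
    + x1 ^ 10 * (1608 * h2 ^ 7 + 39936 * h2 ^ 4 * h6 - 25332 * h2 ^ 2 * h10 + 22050 * h2 * h6 ^ 2)
    + x1 ^ 8 * (-672 * h2 ^ 8 - 13848 * h2 ^ 5 * h6 + 10908 * h2 ^ 3 * h10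
    - 5868 * h2 ^ 2 * h6 ^ 2 - 1812 * h6 * h10) + x1 ^ 6 * (120 * h2 ^ 9 + 2664 * h2 ^ 6 * h6
    - 2172 * h2 ^ 4 * h10 + 864 * h2 ^ 3 * h6 ^ 2 - 3816 * h2 * h6 * h10 + 9576 * h6 ^ 3)
    + x1 ^ 4 * (-168 * h2 ^ 7 * h6 + 60 * h2 ^ 5 * h10 + 252 * h2 ^ 4 * h6 ^ 2
    + 816 * h2 ^ 2 * h6 * h10 - 3636 * h2 * h6 ^ 3 + 348 * h10 ^ 2)
    + x1 ^ 2 * (-18 * h2 ^ 5 * h6 ^ 2 - 84 * h2 ^ 3 * h6 * h10 + 540 * h2 ^ 2 * h6 ^ 3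
    - 261 * h6 ^ 2 * h10) + -9 * h2 * h6 ^ 2 * h10 + 9 * h6 ^ 4

def inv1PolyH10 (x1 h2 h6 h10 : ℂ) : ℂ :=
    x1 ^ 20 * 360 - x1 ^ 18 * 2880 * h2 + x1 ^ 16 * 10024 * h2 ^ 2 - x1 ^ 14 * (16856 * h2 ^ 3
    + 7620 * h6) + x1 ^ 12 * (14216 * h2 ^ 4 + 23508 * h2 * h6) + x1 ^ 10 * (-7160 * h2 ^ 5
    - 25332 * h2 ^ 2 * h6 + 6480 * h10) + x1 ^ 8 * (2144 * h2 ^ 6 + 10908 * h2 ^ 3 * h6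
    - 6464 * h2 * h10 - 906 * h6 ^ 2) + x1 ^ 6 * (-344 * h2 ^ 7 - 2172 * h2 ^ 4 * h6
    + 2336 * h2 ^ 2 * h10 - 1908 * h2 * h6 ^ 2) + x1 ^ 4 * (16 * h2 ^ 8 + 60 * h2 ^ 5 * h6
    - 304 * h2 ^ 3 * h10 + 408 * h2 ^ 2 * h6 ^ 2 + 696 * h6 * h10) + x1 ^ 2 * (16 * h2 ^ 4 * h10
    - 42 * h2 ^ 3 * h6 ^ 2 - 87 * h6 ^ 3) + -3 * h2 * h6 ^ 3 + 4 * h10 ^ 2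

def inv2PolyX (x1 h2 h6 h10 : ℂ) : ℂ :=
    x1 ^ 15 * 64 * h2 ^ 2 - x1 ^ 13 * (280 * h2 ^ 3 + 420 * h6) + x1 ^ 11 * (528 * h2 ^ 4
    + 1656 * h2 * h6) + x1 ^ 9 * (-440 * h2 ^ 5 - 4020 * h2 ^ 2 * h6 + 1800 * h10)
    + x1 ^ 7 * (352 * h2 ^ 6 + 3216 * h2 ^ 3 * h6 - 3712 * h2 * h10 + 2352 * h6 ^ 2)
    + x1 ^ 5 * (-120 * h2 ^ 7 - 828 * h2 ^ 4 * h6 + 1776 * h2 ^ 2 * h10 - 1836 * h2 * h6 ^ 2)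
    + x1 ^ 3 * (16 * h2 ^ 8 + 120 * h2 ^ 5 * h6 - 304 * h2 ^ 3 * h10 + 672 * h2 ^ 2 * h6 ^ 2
    - 456 * h6 * h10) + x1 * (8 * h2 ^ 4 * h10 - 42 * h2 ^ 3 * h6 ^ 2 + 57 * h6 ^ 3)

def inv2PolyH2 (x1 h2 h6 h10 : ℂ) : ℂ :=
    x1 ^ 16 * 8 * h2 - x1 ^ 14 * 60 * h2 ^ 2 + x1 ^ 12 * (176 * h2 ^ 3 + 138 * h6)
    - x1 ^ 10 * (220 * h2 ^ 4 + 804 * h2 * h6) + x1 ^ 8 * (264 * h2 ^ 5 + 1206 * h2 ^ 2 * h6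
    - 464 * h10) + x1 ^ 6 * (-140 * h2 ^ 6 - 552 * h2 ^ 3 * h6 + 592 * h2 * h10 - 306 * h6 ^ 2)
    + x1 ^ 4 * (32 * h2 ^ 7 + 150 * h2 ^ 4 * h6 - 228 * h2 ^ 2 * h10 + 336 * h2 * h6 ^ 2)
    + x1 ^ 2 * (16 * h2 ^ 3 * h10 - 63 * h2 ^ 2 * h6 ^ 2) - (3/2) * h6 ^ 3

def inv2PolyH6 (x1 h2 h6 h10 : ℂ) : ℂ :=
    -x1 ^ 14 * 30 + x1 ^ 12 * 138 * h2 - x1 ^ 10 * 402 * h2 ^ 2 + x1 ^ 8 * (402 * h2 ^ 3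
    + 588 * h6) - x1 ^ 6 * (138 * h2 ^ 4 + 612 * h2 * h6) + x1 ^ 4 * (30 * h2 ^ 5
    + 336 * h2 ^ 2 * h6 - 114 * h10) + x1 ^ 2 * (-42 * h2 ^ 3 * h6 + (171/2) * h6 ^ 2)
    - (9/2) * h2 * h6 ^ 2

def inv2PolyH10 (x1 h2 h6 h10 : ℂ) : ℂ :=
    x1 ^ 10 * 180 - x1 ^ 8 * 464 * h2 + x1 ^ 6 * 296 * h2 ^ 2 - x1 ^ 4 * (76 * h2 ^ 3 + 114 * h6)
    + x1 ^ 2 * 4 * h2 ^ 4 + 2 * h10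

def inv3PolyX (x1 h2 h6 h10 : ℂ) : ℂ :=
    -x1 ^ 9 * 20 * h2 + x1 ^ 7 * 48 * h2 ^ 2 + x1 ^ 5 * (-84 * h2 ^ 3 + 198 * h6)
    + x1 ^ 3 * (24 * h2 ^ 4 - 132 * h2 * h6) + x1 * (-4 * h2 ^ 5 + 22 * h10)

def inv3PolyH2 (x1 h2 h6 h10 : ℂ) : ℂ :=
    -x1 ^ 10 * 2 + x1 ^ 8 * 12 * h2 - x1 ^ 6 * 42 * h2 ^ 2 + x1 ^ 4 * (24 * h2 ^ 3 - 33 * h6)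
    - x1 ^ 2 * 10 * h2 ^ 4 - h10

def inv3PolyH6 (x1 h2 h6 h10 : ℂ) : ℂ :=
    x1 ^ 6 * 33 - x1 ^ 4 * 33 * h2 + 3 * h6

def inv3PolyH10 (x1 h2 h6 h10 : ℂ) : ℂ :=
    x1 ^ 2 * 11 - h2

/-- Taking four arbitrary functions of a parameter certifies all four listed partial derivatives at
once; the chain rule through `h2, h6, h10` is later obtained by substitution. -/
theorem hasDerivAt_inv1Poly {x a b c : ℂ → ℂ} {x' a' b' c' s : ℂ}
    (hx : HasDerivAt x x' s) (ha : HasDerivAt a a' s) (hb : HasDerivAt b b' s)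
    (hc : HasDerivAt c c' s) :
    HasDerivAt (fun s => inv1Poly (x s) (a s) (b s) (c s))
      (x' * inv1PolyX (x s) (a s) (b s) (c s) + a' * inv1PolyH2 (x s) (a s) (b s) (c s)
        + b' * inv1PolyH6 (x s) (a s) (b s) (c s)
        + c' * inv1PolyH10 (x s) (a s) (b s) (c s)) s := by
  unfold inv1Poly
  apply HasDerivAt.congr_deriv
  · with_reducible repeat' first
      | exact hx | exact ha | exact hb | exact hc | exact hasDerivAt_const _ _
      | apply HasDerivAt.fun_add | apply HasDerivAt.fun_sub | apply HasDerivAt.fun_mul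
      | apply HasDerivAt.fun_pow
  · simp only [inv1PolyX, inv1PolyH2, inv1PolyH6, inv1PolyH10, Nat.cast_ofNat,
      Nat.add_one_sub_one, Nat.reduceSub, pow_one]
    ring

theorem hasDerivAt_inv2Poly {x a b c : ℂ → ℂ} {x' a' b' c' s : ℂ}
    (hx : HasDerivAt x x' s) (ha : HasDerivAt a a' s) (hb : HasDerivAt b b' s)
    (hc : HasDerivAt c c' s) :
    HasDerivAt (fun s => inv2Poly (x s) (a s) (b s) (c s))
      (x' * inv2PolyX (x s) (a s) (b s) (c s) + a' * inv2PolyH2 (x s) (a s) (b s) (c s)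
        + b' * inv2PolyH6 (x s) (a s) (b s) (c s)
        + c' * inv2PolyH10 (x s) (a s) (b s) (c s)) s := by
  unfold inv2Poly
  apply HasDerivAt.congr_deriv
  · with_reducible repeat' first
      | exact hx | exact ha | exact hb | exact hc | exact hasDerivAt_const _ _
      | apply HasDerivAt.fun_add | apply HasDerivAt.fun_sub | apply HasDerivAt.fun_mul
      | apply HasDerivAt.fun_pow
  · simp only [inv2PolyX, inv2PolyH2, inv2PolyH6, inv2PolyH10, Nat.cast_ofNat,
      Nat.add_one_sub_one, Nat.reduceSub, pow_one]
    ring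

theorem hasDerivAt_inv3Poly {x a b c : ℂ → ℂ} {x' a' b' c' s : ℂ}
    (hx : HasDerivAt x x' s) (ha : HasDerivAt a a' s) (hb : HasDerivAt b b' s)
    (hc : HasDerivAt c c' s) :
    HasDerivAt (fun s => inv3Poly (x s) (a s) (b s) (c s))
      (x' * inv3PolyX (x s) (a s) (b s) (c s) + a' * inv3PolyH2 (x s) (a s) (b s) (c s)
        + b' * inv3PolyH6 (x s) (a s) (b s) (c s)
        + c' * inv3PolyH10 (x s) (a s) (b s) (c s)) s := by
  unfold inv3Poly
  apply HasDerivAt.congr_deriv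
  · with_reducible repeat' first
      | exact hx | exact ha | exact hb | exact hc | exact hasDerivAt_const _ _
      | apply HasDerivAt.fun_add | apply HasDerivAt.fun_sub | apply HasDerivAt.fun_mul
      | apply HasDerivAt.fun_pow
  · simp only [inv3PolyX, inv3PolyH2, inv3PolyH6, inv3PolyH10, Nat.cast_ofNat,
      Nat.add_one_sub_one, Nat.reduceSub, pow_one]
    ring

/-! ### The intersection form on the orbit space -/

/-- The metric of the orbit space of `H₄` in the basic invariants. -/
def orbitMetric (y : Fin 4 → ℂ) : Matrix (Fin 4) (Fin 4) ℂ :=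
  !![160 * y 0 * y 1 * y 3 ^ 4 + 240 * y 0 * y 2 ^ 2 * y 3 ^ 2 + 96 * y 1 ^ 2 * y 2 * y 3 ^ 3 + (928/3) * y 1 * y 2 ^ 3 * y 3,
      -120 * y 0 * y 2 * y 3 ^ 3 + 48 * y 1 ^ 2 * y 3 ^ 4 - 112 * y 1 * y 2 ^ 2 * y 3 ^ 2 - 32 * y 2 ^ 4,
      -40 * y 0 * y 3 ^ 5 - 80 * y 1 ^ 2 - 16 * y 1 * y 2 * y 3 ^ 4 - (16/3) * y 2 ^ 3 * y 3 ^ 2,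
      60 * y 0;
    -120 * y 0 * y 2 * y 3 ^ 3 + 48 * y 1 ^ 2 * y 3 ^ 4 - 112 * y 1 * y 2 ^ 2 * y 3 ^ 2 - 32 * y 2 ^ 4,
      20 * y 0 * y 3 ^ 4 - 56 * y 1 * y 2 * y 3 ^ 3 + (152/3) * y 2 ^ 3 * y 3,
      -30 * y 0 - 24 * y 1 * y 3 ^ 5 + 8 * y 2 ^ 2 * y 3 ^ 3,
      40 * y 1;
    -40 * y 0 * y 3 ^ 5 - 80 * y 1 ^ 2 - 16 * y 1 * y 2 * y 3 ^ 4 - (16/3) * y 2 ^ 3 * y 3 ^ 2,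
      -30 * y 0 - 24 * y 1 * y 3 ^ 5 + 8 * y 2 ^ 2 * y 3 ^ 3,
      44 * y 1 * y 3 - 8 * y 2 * y 3 ^ 5,
      24 * y 2;
    60 * y 0,
      40 * y 1,
      24 * y 2,
      4 * y 3]

set_option maxRecDepth 2000 in
-- The left side is the square of the gradient of `y₁` in terms of `x₁, h₂, h₆, h₁₀`: the `x₁`
-- direction contributes the first product, and the rest uses the `H₃` table. On the right `x ^ 2 +
-- h2` stands for `y₄`. With `x₁, h₂, h₆, h₁₀` as independent variables this is a polynomial
-- identity, as are its companions below.
theorem metric_inv1_inv1 (x h2 h6 h10 : ℂ) :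
    inv1PolyX x h2 h6 h10 * inv1PolyX x h2 h6 h10
    + inv1PolyH2 x h2 h6 h10 * (4 * h2 * inv1PolyH2 x h2 h6 h10 + 12 * h6 * inv1PolyH6 x h2 h6 h10
    + 20 * h10 * inv1PolyH10 x h2 h6 h10)
    + inv1PolyH6 x h2 h6 h10 * (12 * h6 * inv1PolyH2 x h2 h6 h10 + (8 * h2 ^ 2 * h6
    + 8 * h10) * inv1PolyH6 x h2 h6 h10 + (8 * h2 ^ 4 * h6
    + 28 * h2 * h6 ^ 2) * inv1PolyH10 x h2 h6 h10)
    + inv1PolyH10 x h2 h6 h10 * (20 * h10 * inv1PolyH2 x h2 h6 h10 + (8 * h2 ^ 4 * h6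
    + 28 * h2 * h6 ^ 2) * inv1PolyH6 x h2 h6 h10 + (8 * h2 ^ 4 * h10 + 36 * h2 ^ 3 * h6 ^ 2
    + 30 * h6 ^ 3) * inv1PolyH10 x h2 h6 h10) =
      160 * inv1Poly x h2 h6 h10 * inv2Poly x h2 h6 h10 * (x ^ 2 + h2) ^ 4
      + 240 * inv1Poly x h2 h6 h10 * inv3Poly x h2 h6 h10 ^ 2 * (x ^ 2 + h2) ^ 2
      + 96 * inv2Poly x h2 h6 h10 ^ 2 * inv3Poly x h2 h6 h10 * (x ^ 2 + h2) ^ 3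
      + (928/3) * inv2Poly x h2 h6 h10 * inv3Poly x h2 h6 h10 ^ 3 * (x ^ 2 + h2) := by
  simp only [inv1PolyX, inv1PolyH2, inv1PolyH6, inv1PolyH10, inv1Poly, inv2Poly, inv3Poly]
  ring

set_option maxRecDepth 2000 in
theorem metric_inv1_inv2 (x h2 h6 h10 : ℂ) :
    inv1PolyX x h2 h6 h10 * inv2PolyX x h2 h6 h10
    + inv2PolyH2 x h2 h6 h10 * (4 * h2 * inv1PolyH2 x h2 h6 h10 + 12 * h6 * inv1PolyH6 x h2 h6 h10
    + 20 * h10 * inv1PolyH10 x h2 h6 h10)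
    + inv2PolyH6 x h2 h6 h10 * (12 * h6 * inv1PolyH2 x h2 h6 h10 + (8 * h2 ^ 2 * h6
    + 8 * h10) * inv1PolyH6 x h2 h6 h10 + (8 * h2 ^ 4 * h6
    + 28 * h2 * h6 ^ 2) * inv1PolyH10 x h2 h6 h10)
    + inv2PolyH10 x h2 h6 h10 * (20 * h10 * inv1PolyH2 x h2 h6 h10 + (8 * h2 ^ 4 * h6
    + 28 * h2 * h6 ^ 2) * inv1PolyH6 x h2 h6 h10 + (8 * h2 ^ 4 * h10 + 36 * h2 ^ 3 * h6 ^ 2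
    + 30 * h6 ^ 3) * inv1PolyH10 x h2 h6 h10) =
      -120 * inv1Poly x h2 h6 h10 * inv3Poly x h2 h6 h10 * (x ^ 2 + h2) ^ 3
      + 48 * inv2Poly x h2 h6 h10 ^ 2 * (x ^ 2 + h2) ^ 4
      - 112 * inv2Poly x h2 h6 h10 * inv3Poly x h2 h6 h10 ^ 2 * (x ^ 2 + h2) ^ 2
      - 32 * inv3Poly x h2 h6 h10 ^ 4 := by
  simp only [inv1PolyX, inv2PolyX, inv1PolyH2, inv1PolyH6, inv1PolyH10, inv2PolyH2, inv2PolyH6, inv2PolyH10, inv1Poly, inv2Poly, inv3Poly]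
  ring

set_option maxRecDepth 2000 in
theorem metric_inv1_inv3 (x h2 h6 h10 : ℂ) :
    inv1PolyX x h2 h6 h10 * inv3PolyX x h2 h6 h10
    + inv3PolyH2 x h2 h6 h10 * (4 * h2 * inv1PolyH2 x h2 h6 h10 + 12 * h6 * inv1PolyH6 x h2 h6 h10
    + 20 * h10 * inv1PolyH10 x h2 h6 h10)
    + inv3PolyH6 x h2 h6 h10 * (12 * h6 * inv1PolyH2 x h2 h6 h10 + (8 * h2 ^ 2 * h6
    + 8 * h10) * inv1PolyH6 x h2 h6 h10 + (8 * h2 ^ 4 * h6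
    + 28 * h2 * h6 ^ 2) * inv1PolyH10 x h2 h6 h10)
    + inv3PolyH10 x h2 h6 h10 * (20 * h10 * inv1PolyH2 x h2 h6 h10 + (8 * h2 ^ 4 * h6
    + 28 * h2 * h6 ^ 2) * inv1PolyH6 x h2 h6 h10 + (8 * h2 ^ 4 * h10 + 36 * h2 ^ 3 * h6 ^ 2
    + 30 * h6 ^ 3) * inv1PolyH10 x h2 h6 h10) =
      -40 * inv1Poly x h2 h6 h10 * (x ^ 2 + h2) ^ 5 - 80 * inv2Poly x h2 h6 h10 ^ 2
      - 16 * inv2Poly x h2 h6 h10 * inv3Poly x h2 h6 h10 * (x ^ 2 + h2) ^ 4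
      - (16/3) * inv3Poly x h2 h6 h10 ^ 3 * (x ^ 2 + h2) ^ 2 := by
  simp only [inv1PolyX, inv3PolyX, inv1PolyH2, inv1PolyH6, inv1PolyH10, inv3PolyH2, inv3PolyH6, inv3PolyH10, inv1Poly, inv2Poly, inv3Poly]
  ring

/-- Euler's identity: the gradient of `y₄ = x ⬝ x` is `2x`, so pairing with it multiplies an
invariant by twice its degree. -/
theorem metric_inv1_inv4 (x h2 h6 h10 : ℂ) :
    inv1PolyX x h2 h6 h10 * (2 * x) + (4 * h2 * inv1PolyH2 x h2 h6 h10
    + 12 * h6 * inv1PolyH6 x h2 h6 h10 + 20 * h10 * inv1PolyH10 x h2 h6 h10) =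
      60 * inv1Poly x h2 h6 h10 := by
  simp only [inv1PolyX, inv1PolyH2, inv1PolyH6, inv1PolyH10, inv1Poly]
  ring

theorem metric_inv2_inv2 (x h2 h6 h10 : ℂ) :
    inv2PolyX x h2 h6 h10 * inv2PolyX x h2 h6 h10
    + inv2PolyH2 x h2 h6 h10 * (4 * h2 * inv2PolyH2 x h2 h6 h10 + 12 * h6 * inv2PolyH6 x h2 h6 h10
    + 20 * h10 * inv2PolyH10 x h2 h6 h10)
    + inv2PolyH6 x h2 h6 h10 * (12 * h6 * inv2PolyH2 x h2 h6 h10 + (8 * h2 ^ 2 * h6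
    + 8 * h10) * inv2PolyH6 x h2 h6 h10 + (8 * h2 ^ 4 * h6
    + 28 * h2 * h6 ^ 2) * inv2PolyH10 x h2 h6 h10)
    + inv2PolyH10 x h2 h6 h10 * (20 * h10 * inv2PolyH2 x h2 h6 h10 + (8 * h2 ^ 4 * h6
    + 28 * h2 * h6 ^ 2) * inv2PolyH6 x h2 h6 h10 + (8 * h2 ^ 4 * h10 + 36 * h2 ^ 3 * h6 ^ 2
    + 30 * h6 ^ 3) * inv2PolyH10 x h2 h6 h10) =
      20 * inv1Poly x h2 h6 h10 * (x ^ 2 + h2) ^ 4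
      - 56 * inv2Poly x h2 h6 h10 * inv3Poly x h2 h6 h10 * (x ^ 2 + h2) ^ 3
      + (152/3) * inv3Poly x h2 h6 h10 ^ 3 * (x ^ 2 + h2) := by
  simp only [inv2PolyX, inv2PolyH2, inv2PolyH6, inv2PolyH10, inv1Poly, inv2Poly, inv3Poly]
  ring

theorem metric_inv2_inv3 (x h2 h6 h10 : ℂ) :
    inv2PolyX x h2 h6 h10 * inv3PolyX x h2 h6 h10
    + inv3PolyH2 x h2 h6 h10 * (4 * h2 * inv2PolyH2 x h2 h6 h10 + 12 * h6 * inv2PolyH6 x h2 h6 h10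
    + 20 * h10 * inv2PolyH10 x h2 h6 h10)
    + inv3PolyH6 x h2 h6 h10 * (12 * h6 * inv2PolyH2 x h2 h6 h10 + (8 * h2 ^ 2 * h6
    + 8 * h10) * inv2PolyH6 x h2 h6 h10 + (8 * h2 ^ 4 * h6
    + 28 * h2 * h6 ^ 2) * inv2PolyH10 x h2 h6 h10)
    + inv3PolyH10 x h2 h6 h10 * (20 * h10 * inv2PolyH2 x h2 h6 h10 + (8 * h2 ^ 4 * h6
    + 28 * h2 * h6 ^ 2) * inv2PolyH6 x h2 h6 h10 + (8 * h2 ^ 4 * h10 + 36 * h2 ^ 3 * h6 ^ 2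
    + 30 * h6 ^ 3) * inv2PolyH10 x h2 h6 h10) =
      -30 * inv1Poly x h2 h6 h10 - 24 * inv2Poly x h2 h6 h10 * (x ^ 2 + h2) ^ 5
      + 8 * inv3Poly x h2 h6 h10 ^ 2 * (x ^ 2 + h2) ^ 3 := by
  simp only [inv2PolyX, inv3PolyX, inv2PolyH2, inv2PolyH6, inv2PolyH10, inv3PolyH2, inv3PolyH6, inv3PolyH10, inv1Poly, inv2Poly, inv3Poly]
  ring

theorem metric_inv2_inv4 (x h2 h6 h10 : ℂ) :
    inv2PolyX x h2 h6 h10 * (2 * x) + (4 * h2 * inv2PolyH2 x h2 h6 h10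
    + 12 * h6 * inv2PolyH6 x h2 h6 h10 + 20 * h10 * inv2PolyH10 x h2 h6 h10) =
      40 * inv2Poly x h2 h6 h10 := by
  simp only [inv2PolyX, inv2PolyH2, inv2PolyH6, inv2PolyH10, inv2Poly]
  ring

theorem metric_inv3_inv3 (x h2 h6 h10 : ℂ) :
    inv3PolyX x h2 h6 h10 * inv3PolyX x h2 h6 h10
    + inv3PolyH2 x h2 h6 h10 * (4 * h2 * inv3PolyH2 x h2 h6 h10 + 12 * h6 * inv3PolyH6 x h2 h6 h10
    + 20 * h10 * inv3PolyH10 x h2 h6 h10)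
    + inv3PolyH6 x h2 h6 h10 * (12 * h6 * inv3PolyH2 x h2 h6 h10 + (8 * h2 ^ 2 * h6
    + 8 * h10) * inv3PolyH6 x h2 h6 h10 + (8 * h2 ^ 4 * h6
    + 28 * h2 * h6 ^ 2) * inv3PolyH10 x h2 h6 h10)
    + inv3PolyH10 x h2 h6 h10 * (20 * h10 * inv3PolyH2 x h2 h6 h10 + (8 * h2 ^ 4 * h6
    + 28 * h2 * h6 ^ 2) * inv3PolyH6 x h2 h6 h10 + (8 * h2 ^ 4 * h10 + 36 * h2 ^ 3 * h6 ^ 2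
    + 30 * h6 ^ 3) * inv3PolyH10 x h2 h6 h10) =
      44 * inv2Poly x h2 h6 h10 * (x ^ 2 + h2) - 8 * inv3Poly x h2 h6 h10 * (x ^ 2 + h2) ^ 5 := by
  simp only [inv3PolyX, inv3PolyH2, inv3PolyH6, inv3PolyH10, inv2Poly, inv3Poly]
  ring

theorem metric_inv3_inv4 (x h2 h6 h10 : ℂ) :
    inv3PolyX x h2 h6 h10 * (2 * x) + (4 * h2 * inv3PolyH2 x h2 h6 h10
    + 12 * h6 * inv3PolyH6 x h2 h6 h10 + 20 * h10 * inv3PolyH10 x h2 h6 h10) =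
      24 * inv3Poly x h2 h6 h10 := by
  simp only [inv3PolyX, inv3PolyH2, inv3PolyH6, inv3PolyH10, inv3Poly]
  ring

end H42

end

noncomputable section

namespace H42

open AlgFrobenius

/-! ### The orbit map of `H₄` -/

/-- The orbit map of `H₄`. -/
def invMap (x : Fin 4 → ℂ) : Fin 4 → ℂ := ![y1 x, y2 x, y3 x, y4 x]

theorem differentiable_h2 : Differentiable ℂ fun x : Fin 4 → ℂ => h2 (x 1) (x 2) (x 3) := by
  unfold h2 eps1
  fun_prop

theorem differentiable_h6 : Differentiable ℂ fun x : Fin 4 → ℂ => h6 (x 1) (x 2) (x 3) := by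
  unfold h6 eps1 eps2 eps3 delta
  fun_prop

theorem differentiable_h10 : Differentiable ℂ fun x : Fin 4 → ℂ => h10 (x 1) (x 2) (x 3) := by
  unfold h10 eps1 eps2 eps3 delta
  fun_prop

theorem differentiable_y1 : Differentiable ℂ y1 := by
  have d2 := differentiable_h2
  have d6 := differentiable_h6
  have d10 := differentiable_h10
  unfold y1 inv1Poly
  fun_prop

theorem differentiable_y2 : Differentiable ℂ y2 := by
  have d2 := differentiable_h2
  have d6 := differentiable_h6
  have d10 := differentiable_h10
  unfold y2 inv2Poly
  fun_prop

theorem differentiable_y3 : Differentiable ℂ y3 := by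
  have d2 := differentiable_h2
  have d6 := differentiable_h6
  have d10 := differentiable_h10
  unfold y3 inv3Poly
  fun_prop

theorem differentiable_y4 : Differentiable ℂ y4 := by
  have d2 := differentiable_h2
  unfold y4
  fun_prop

theorem differentiable_invMap : Differentiable ℂ invMap := by
  refine differentiable_pi.2 fun i => ?_
  fin_cases i
  exacts [differentiable_y1, differentiable_y2, differentiable_y3, differentiable_y4]

/-- The gradient of a function of `x₁, h₂, h₆, h₁₀` with given partial derivatives. -/
def chainGrad (x : Fin 4 → ℂ) (c : Fin 4 → ℂ) : Fin 4 → ℂ := fun a =>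
  (Pi.single a 1 : Fin 4 → ℂ) 0 * c 0
    + (gradH2 (x 1) (x 2) (x 3) ⬝ᵥ fun k => (Pi.single a 1 : Fin 4 → ℂ) k.succ) * c 1
    + (gradH6 (x 1) (x 2) (x 3) ⬝ᵥ fun k => (Pi.single a 1 : Fin 4 → ℂ) k.succ) * c 2
    + (gradH10 (x 1) (x 2) (x 3) ⬝ᵥ fun k => (Pi.single a 1 : Fin 4 → ℂ) k.succ) * c 3

/-- The `x₁` direction is orthogonal to the gradients of `h₂, h₆, h₁₀`, which live in `x₂, x₃, x₄`;
what remains is bilinear in the six inner products of the `H₃` gradients. The right side is arranged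
to agree with the `metric_inv` identities. -/
theorem chainGrad_dot (x c d : Fin 4 → ℂ) : chainGrad x c ⬝ᵥ chainGrad x d =
    c 0 * d 0
    + d 1 * (4 * h2 (x 1) (x 2) (x 3) * c 1 + 12 * h6 (x 1) (x 2) (x 3) * c 2
      + 20 * h10 (x 1) (x 2) (x 3) * c 3)
    + d 2 * (12 * h6 (x 1) (x 2) (x 3) * c 1
      + (8 * h2 (x 1) (x 2) (x 3) ^ 2 * h6 (x 1) (x 2) (x 3) + 8 * h10 (x 1) (x 2) (x 3)) * c 2
      + (8 * h2 (x 1) (x 2) (x 3) ^ 4 * h6 (x 1) (x 2) (x 3)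
        + 28 * h2 (x 1) (x 2) (x 3) * h6 (x 1) (x 2) (x 3) ^ 2) * c 3)
    + d 3 * (20 * h10 (x 1) (x 2) (x 3) * c 1
      + (8 * h2 (x 1) (x 2) (x 3) ^ 4 * h6 (x 1) (x 2) (x 3)
        + 28 * h2 (x 1) (x 2) (x 3) * h6 (x 1) (x 2) (x 3) ^ 2) * c 2
      + (8 * h2 (x 1) (x 2) (x 3) ^ 4 * h10 (x 1) (x 2) (x 3)
        + 36 * h2 (x 1) (x 2) (x 3) ^ 3 * h6 (x 1) (x 2) (x 3) ^ 2
        + 30 * h6 (x 1) (x 2) (x 3) ^ 3) * c 3) := by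
  have e22 := gradH2_dot_gradH2 (x 1) (x 2) (x 3)
  have e26 := gradH2_dot_gradH6 (x 1) (x 2) (x 3)
  have e210 := gradH2_dot_gradH10 (x 1) (x 2) (x 3)
  have e66 := gradH6_dot_gradH6 (x 1) (x 2) (x 3)
  have e610 := gradH6_dot_gradH10 (x 1) (x 2) (x 3)
  have e1010 := gradH10_dot_gradH10 (x 1) (x 2) (x 3)
  simp only [dotProduct, Fin.sum_univ_three] at e22 e26 e210 e66 e610 e1010
  simp only [chainGrad, dotProduct, Fin.sum_univ_four, Fin.sum_univ_three, Pi.single_apply,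
    Fin.reduceEq, Fin.reduceSucc, if_true, if_false]
  simp only [mul_zero, mul_one, zero_add, add_zero, zero_mul, one_mul]
  linear_combination (c 1 * d 1) * e22 + (c 1 * d 2 + c 2 * d 1) * e26
    + (c 1 * d 3 + c 3 * d 1) * e210 + (c 2 * d 2) * e66 + (c 2 * d 3 + c 3 * d 2) * e610
    + (c 3 * d 3) * e1010

/-- The partial derivatives of `y1` with respect to `x₁, h₂, h₆, h₁₀`. -/
def coef1 (x : Fin 4 → ℂ) : Fin 4 → ℂ :=
  ![inv1PolyX (x 0) (h2 (x 1) (x 2) (x 3)) (h6 (x 1) (x 2) (x 3))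
      (h10 (x 1) (x 2) (x 3)),
    inv1PolyH2 (x 0) (h2 (x 1) (x 2) (x 3)) (h6 (x 1) (x 2) (x 3))
      (h10 (x 1) (x 2) (x 3)),
    inv1PolyH6 (x 0) (h2 (x 1) (x 2) (x 3)) (h6 (x 1) (x 2) (x 3))
      (h10 (x 1) (x 2) (x 3)),
    inv1PolyH10 (x 0) (h2 (x 1) (x 2) (x 3)) (h6 (x 1) (x 2) (x 3))
      (h10 (x 1) (x 2) (x 3))]

theorem partialD_y1 (x : Fin 4 → ℂ) (a : Fin 4) :
    partialD a y1 x = chainGrad x (coef1 x) a := by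
  refine partialD_eq_of_hasDerivAt (differentiable_y1 x) ?_
  have l := hasDerivAt_line_apply x a
  have := hasDerivAt_inv1Poly (l 0)
    (hasDerivAt_h2 (v := fun k => (Pi.single a 1 : Fin 4 → ℂ) k.succ) (l 1) (l 2) (l 3))
    (hasDerivAt_h6 (v := fun k => (Pi.single a 1 : Fin 4 → ℂ) k.succ) (l 1) (l 2) (l 3))
    (hasDerivAt_h10 (v := fun k => (Pi.single a 1 : Fin 4 → ℂ) k.succ) (l 1) (l 2) (l 3))
  simp only [zero_smul, add_zero] at this
  exact this

/-- The partial derivatives of `y2` with respect to `x₁, h₂, h₆, h₁₀`. -/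
def coef2 (x : Fin 4 → ℂ) : Fin 4 → ℂ :=
  ![inv2PolyX (x 0) (h2 (x 1) (x 2) (x 3)) (h6 (x 1) (x 2) (x 3))
      (h10 (x 1) (x 2) (x 3)),
    inv2PolyH2 (x 0) (h2 (x 1) (x 2) (x 3)) (h6 (x 1) (x 2) (x 3))
      (h10 (x 1) (x 2) (x 3)),
    inv2PolyH6 (x 0) (h2 (x 1) (x 2) (x 3)) (h6 (x 1) (x 2) (x 3))
      (h10 (x 1) (x 2) (x 3)),
    inv2PolyH10 (x 0) (h2 (x 1) (x 2) (x 3)) (h6 (x 1) (x 2) (x 3))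
      (h10 (x 1) (x 2) (x 3))]

theorem partialD_y2 (x : Fin 4 → ℂ) (a : Fin 4) :
    partialD a y2 x = chainGrad x (coef2 x) a := by
  refine partialD_eq_of_hasDerivAt (differentiable_y2 x) ?_
  have l := hasDerivAt_line_apply x a
  have := hasDerivAt_inv2Poly (l 0)
    (hasDerivAt_h2 (v := fun k => (Pi.single a 1 : Fin 4 → ℂ) k.succ) (l 1) (l 2) (l 3))
    (hasDerivAt_h6 (v := fun k => (Pi.single a 1 : Fin 4 → ℂ) k.succ) (l 1) (l 2) (l 3))
    (hasDerivAt_h10 (v := fun k => (Pi.single a 1 : Fin 4 → ℂ) k.succ) (l 1) (l 2) (l 3))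
  simp only [zero_smul, add_zero] at this
  exact this

/-- The partial derivatives of `y3` with respect to `x₁, h₂, h₆, h₁₀`. -/
def coef3 (x : Fin 4 → ℂ) : Fin 4 → ℂ :=
  ![inv3PolyX (x 0) (h2 (x 1) (x 2) (x 3)) (h6 (x 1) (x 2) (x 3))
      (h10 (x 1) (x 2) (x 3)),
    inv3PolyH2 (x 0) (h2 (x 1) (x 2) (x 3)) (h6 (x 1) (x 2) (x 3))
      (h10 (x 1) (x 2) (x 3)),
    inv3PolyH6 (x 0) (h2 (x 1) (x 2) (x 3)) (h6 (x 1) (x 2) (x 3))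
      (h10 (x 1) (x 2) (x 3)),
    inv3PolyH10 (x 0) (h2 (x 1) (x 2) (x 3)) (h6 (x 1) (x 2) (x 3))
      (h10 (x 1) (x 2) (x 3))]

theorem partialD_y3 (x : Fin 4 → ℂ) (a : Fin 4) :
    partialD a y3 x = chainGrad x (coef3 x) a := by
  refine partialD_eq_of_hasDerivAt (differentiable_y3 x) ?_
  have l := hasDerivAt_line_apply x a
  have := hasDerivAt_inv3Poly (l 0)
    (hasDerivAt_h2 (v := fun k => (Pi.single a 1 : Fin 4 → ℂ) k.succ) (l 1) (l 2) (l 3))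
    (hasDerivAt_h6 (v := fun k => (Pi.single a 1 : Fin 4 → ℂ) k.succ) (l 1) (l 2) (l 3))
    (hasDerivAt_h10 (v := fun k => (Pi.single a 1 : Fin 4 → ℂ) k.succ) (l 1) (l 2) (l 3))
  simp only [zero_smul, add_zero] at this
  exact this

/-- The partial derivatives of `y4` with respect to `x₁, h₂, h₆, h₁₀`. -/
def coef4 (x : Fin 4 → ℂ) : Fin 4 → ℂ := ![2 * x 0, 1, 0, 0]

theorem partialD_y4 (x : Fin 4 → ℂ) (a : Fin 4) : partialD a y4 x = chainGrad x (coef4 x) a := by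
  refine partialD_eq_of_hasDerivAt (differentiable_y4 x) ?_
  have l := hasDerivAt_line_apply x a
  have := ((l 0).fun_pow 2).fun_add
    (hasDerivAt_h2 (v := fun k => (Pi.single a 1 : Fin 4 → ℂ) k.succ) (l 1) (l 2) (l 3))
  simp only [zero_smul, add_zero] at this
  refine this.congr_deriv ?_
  simp [chainGrad, coef4]
  ring

/-- The rows of the Jacobi matrix are the gradients of the invariants, so the product is their Gram
matrix, and that matrix depends on `x` only through the invariants. -/
theorem jac_invMap_mul_transpose (x : Fin 4 → ℂ) :
    jac invMap x * (jac invMap x).transpose = orbitMetric (invMap x) := by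
  have key : ∀ i, (jac invMap x) i = chainGrad x (![coef1 x, coef2 x, coef3 x, coef4 x] i) := by
    intro i
    ext a
    fin_cases i
    exacts [partialD_y1 x a, partialD_y2 x a, partialD_y3 x a, partialD_y4 x a]
  have hsymm : ∀ i j, orbitMetric (invMap x) i j = orbitMetric (invMap x) j i := by
    intro i j
    fin_cases i <;> fin_cases j <;> rfl
  -- By symmetry the ten entries on and above the diagonal suffice.
  have hle : ∀ i j, i ≤ j → (jac invMap x) i ⬝ᵥ (jac invMap x) j = orbitMetric (invMap x) i j := by
    intro i j hij
    rw [key i, key j, chainGrad_dot]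
    fin_cases i <;> fin_cases j <;> first | exact absurd hij (by decide) | skip
    · exact metric_inv1_inv1 (x 0) _ _ _
    · exact metric_inv1_inv2 (x 0) _ _ _
    · exact metric_inv1_inv3 (x 0) _ _ _
    · have := metric_inv1_inv4 (x 0) (h2 (x 1) (x 2) (x 3)) (h6 (x 1) (x 2) (x 3))
        (h10 (x 1) (x 2) (x 3))
      simpa [coef1, coef4, orbitMetric, invMap, y1] using this
    · exact metric_inv2_inv2 (x 0) _ _ _
    · exact metric_inv2_inv3 (x 0) _ _ _
    · have := metric_inv2_inv4 (x 0) (h2 (x 1) (x 2) (x 3)) (h6 (x 1) (x 2) (x 3))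
        (h10 (x 1) (x 2) (x 3))
      simpa [coef2, coef4, orbitMetric, invMap, y2] using this
    · exact metric_inv3_inv3 (x 0) _ _ _
    · have := metric_inv3_inv4 (x 0) (h2 (x 1) (x 2) (x 3)) (h6 (x 1) (x 2) (x 3))
        (h10 (x 1) (x 2) (x 3))
      simpa [coef3, coef4, orbitMetric, invMap, y3] using this
    · simp [coef4, orbitMetric, invMap, y4]
      ring
  ext i j
  rcases le_total i j with hij | hij
  · exact hle i j hij
  · rw [hsymm i j, ← hle j i hij, dotProduct_comm]
    rfl

end H42

end

noncomputable section

namespace H42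

open AlgFrobenius

/-! ### The common zeros of the basic invariants -/

/-- A Nullstellensatz certificate. On `y₄ = 0`, that is `h₂ = -x₁²`, a power of `x₁` lies in the
ideal of `y₁, y₂, y₃`. With weights `1, 6, 10` for `x, a, b` everything is homogeneous of weight
`46`, so the cofactors have weights `16, 26, 34`. -/
theorem pow_mem_ideal_inv (x a b : ℂ) :
    1940805148792061952000 * x ^ 46 =
      (-450381835255926600 * x ^ 16 - 868720658733542520 * x ^ 10 * a
      - 159712013053824390 * x ^ 6 * b - 19629872015876730 * x ^ 4 * a ^ 2 - 929536857675 * a * b)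
        * inv1Poly x (-x ^ 2) a b
      + (10782250826622566400 * x ^ 26 + 68287588568609587200 * x ^ 20 * a
      + 74015129225916770400 * x ^ 16 * b + 587897687342998772880 * x ^ 14 * a ^ 2
      + 175096796719983981120 * x ^ 10 * a * b + 1042883367545076039600 * x ^ 8 * a ^ 3
      + 28047933923716906920 * x ^ 6 * b ^ 2 + 192653486339817244200 * x ^ 4 * a ^ 2 * b
      + 23643305769233680500 * x ^ 2 * a ^ 4 + 1239382476900 * a * b ^ 2)
        * inv2Poly x (-x ^ 2) a b
      + (16391917126182484660080 * x ^ 16 * a ^ 3 - 2280580504920934236000 * x ^ 14 * b ^ 2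
      - 17704946316983892922680 * x ^ 12 * a ^ 2 * b - 12442939434384366470160 * x ^ 10 * a ^ 4
      + 269350345558905337920 * x ^ 8 * a * b ^ 2 + 1725656450973158495640 * x ^ 6 * a ^ 3 * b
      - 472842559538254557924 * x ^ 4 * a ^ 5 - 2319582047748206200 * x ^ 4 * b ^ 3
      - 15762289611423188480 * x ^ 2 * a ^ 2 * b ^ 2 + 1115444229210 * a ^ 4 * b)
        * inv3Poly x (-x ^ 2) a b := by
  simp only [inv1Poly, inv2Poly, inv3Poly]
  ring

/-- Vieta: `p²` is a root of the monic cubic whose coefficients are `eps1, eps2, eps3` up to sign,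
so their vanishing forces `p = 0`. -/
theorem sq_pow_three_eq (p q r : ℂ) : p ^ 6 = eps1 p q r * p ^ 4 - eps2 p q r * p ^ 2
    + eps3 p q r := by
  unfold eps1 eps2 eps3
  ring

/-- With `ε₁ = 0`, the equation `h₆ = 0` reads `√5 δ = 11 ε₃`. Then `h₁₀ = 0` becomes `ε₂ ε₃ = 0`,
while the discriminant formula becomes `5 ε₂³ = -64 ε₃²`; together these leave only zero. -/
theorem eps_eq_zero_of_h_eq_zero {p q r : ℂ} (e2 : h2 p q r = 0) (e6 : h6 p q r = 0)
    (e10 : h10 p q r = 0) : eps1 p q r = 0 ∧ eps2 p q r = 0 ∧ eps3 p q r = 0 := by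
  have e1 : eps1 p q r = 0 := e2
  have hd := delta_sq p q r
  have hs := sqrtFive_sq
  rw [h6, e1] at e6
  rw [h10, e1] at e10
  rw [e1] at hd
  have h23 : eps2 p q r * eps3 p q r = 0 := by
    linear_combination (1 / 128) * e10 - (3 / 128) * eps2 p q r * e6
  have hdisc : 5 * eps2 p q r ^ 3 = -64 * eps3 p q r ^ 2 := by
    linear_combination (-1 / 4 * (sqrtFive * delta p q r + 11 * eps3 p q r)) * e6
      + (1 / 4 * delta p q r ^ 2) * hs + (5 / 4) * hd
  refine ⟨e1, ?_⟩
  rcases mul_eq_zero.1 h23 with h | h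
  · refine ⟨h, ?_⟩
    rw [h] at hdisc
    have : eps3 p q r ^ 2 = 0 := by linear_combination (1 / 64) * hdisc
    exact pow_eq_zero_iff two_ne_zero |>.1 this
  · refine ⟨?_, h⟩
    rw [h] at hdisc
    have : eps2 p q r ^ 3 = 0 := by linear_combination (1 / 5) * hdisc
    exact pow_eq_zero_iff three_ne_zero |>.1 this

theorem eq_zero_of_invMap_eq_zero {x : Fin 4 → ℂ} (hx : invMap x = 0) : x = 0 := by
  have e1 : inv1Poly (x 0) (h2 (x 1) (x 2) (x 3)) (h6 (x 1) (x 2) (x 3))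
    (h10 (x 1) (x 2) (x 3)) = 0 := congrFun hx 0
  have e2 : inv2Poly (x 0) (h2 (x 1) (x 2) (x 3)) (h6 (x 1) (x 2) (x 3))
    (h10 (x 1) (x 2) (x 3)) = 0 := congrFun hx 1
  have e3 : inv3Poly (x 0) (h2 (x 1) (x 2) (x 3)) (h6 (x 1) (x 2) (x 3))
    (h10 (x 1) (x 2) (x 3)) = 0 := congrFun hx 2
  have e4 : x 0 ^ 2 + h2 (x 1) (x 2) (x 3) = 0 := congrFun hx 3
  have e4' : h2 (x 1) (x 2) (x 3) = -x 0 ^ 2 := by linear_combination e4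
  have hx0 : x 0 = 0 := by
    have := pow_mem_ideal_inv (x 0) (h6 (x 1) (x 2) (x 3)) (h10 (x 1) (x 2) (x 3))
    rw [← e4', e1, e2, e3] at this
    simpa using this
  -- At `x₁ = 0` the fourth equation gives `h₂ = 0`; then `y₃` reduces to `(3/2) h₆²` and, once `h₆
  -- = 0`, `y₂` reduces to `h₁₀²`.
  rw [hx0] at e2 e3 e4
  have z2 : h2 (x 1) (x 2) (x 3) = 0 := by simpa using e4
  have z6 : h6 (x 1) (x 2) (x 3) = 0 := by simpa [inv3Poly, z2] using e3
  have z10 : h10 (x 1) (x 2) (x 3) = 0 := by simpa [inv2Poly, z2, z6] using e2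
  obtain ⟨w1, w2, w3⟩ := eps_eq_zero_of_h_eq_zero z2 z6 z10
  have key : ∀ {p q r : ℂ}, eps1 p q r = 0 → eps2 p q r = 0 → eps3 p q r = 0 → p = 0 := by
    intro p q r w1 w2 w3
    have := sq_pow_three_eq p q r
    rw [w1, w2, w3] at this
    simpa using this
  have c1 : ∀ p q r : ℂ, eps1 p q r = eps1 q r p := fun p q r => by unfold eps1; ring
  have c2 : ∀ p q r : ℂ, eps2 p q r = eps2 q r p := fun p q r => by unfold eps2; ring
  have c3 : ∀ p q r : ℂ, eps3 p q r = eps3 q r p := fun p q r => by unfold eps3; ring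
  ext i
  fin_cases i
  · exact hx0
  · exact key w1 w2 w3
  · exact key (c1 _ _ _ ▸ w1) (c2 _ _ _ ▸ w2) (c3 _ _ _ ▸ w3)
  · exact key ((c1 _ _ _).trans (c1 _ _ _) ▸ w1) ((c2 _ _ _).trans (c2 _ _ _) ▸ w2)
      ((c3 _ _ _).trans (c3 _ _ _) ▸ w3)

/-! ### The orbit map is proper -/

theorem h2_smul (c p q r : ℂ) : h2 (c * p) (c * q) (c * r) = c ^ 2 * h2 p q r := by
  unfold h2 eps1
  ring

theorem h6_smul (c p q r : ℂ) : h6 (c * p) (c * q) (c * r) = c ^ 6 * h6 p q r := by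
  unfold h6 eps1 eps2 eps3 delta
  ring

theorem h10_smul (c p q r : ℂ) : h10 (c * p) (c * q) (c * r) = c ^ 10 * h10 p q r := by
  unfold h10 eps1 eps2 eps3 delta
  ring

/-- The degrees of the basic invariants. -/
def invDeg : Fin 4 → ℕ := ![30, 20, 12, 2]

theorem invMap_smul (c : ℂ) (x : Fin 4 → ℂ) (i : Fin 4) :
    invMap (c • x) i = c ^ invDeg i * invMap x i := by
  fin_cases i
  · change inv1Poly (c * x 0) (h2 (c * x 1) (c * x 2) (c * x 3)) (h6 (c * x 1) (c * x 2) (c * x 3))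
      (h10 (c * x 1) (c * x 2) (c * x 3)) = c ^ 30 * inv1Poly _ _ _ _
    rw [h2_smul, h6_smul, h10_smul, inv1Poly, inv1Poly]
    ring
  · change inv2Poly (c * x 0) (h2 (c * x 1) (c * x 2) (c * x 3)) (h6 (c * x 1) (c * x 2) (c * x 3))
      (h10 (c * x 1) (c * x 2) (c * x 3)) = c ^ 20 * inv2Poly _ _ _ _
    rw [h2_smul, h6_smul, h10_smul, inv2Poly, inv2Poly]
    ring
  · change inv3Poly (c * x 0) (h2 (c * x 1) (c * x 2) (c * x 3)) (h6 (c * x 1) (c * x 2) (c * x 3))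
      (h10 (c * x 1) (c * x 2) (c * x 3)) = c ^ 12 * inv3Poly _ _ _ _
    rw [h2_smul, h6_smul, h10_smul, inv3Poly, inv3Poly]
    ring
  · change (c * x 0) ^ 2 + h2 (c * x 1) (c * x 2) (c * x 3) = c ^ 2 * (x 0 ^ 2 + h2 _ _ _)
    rw [h2_smul]
    ring

/-- The minimum of `‖invMap‖` on the unit sphere is positive, since only the origin maps to zero.
The components have different degrees, all at least one, so scaling yields linear growth outside the
unit ball, which is enough for properness. -/
theorem exists_norm_le_norm_invMap :
    ∃ δ : ℝ, 0 < δ ∧ ∀ x, 1 ≤ ‖x‖ → δ * ‖x‖ ≤ ‖invMap x‖ := by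
  obtain ⟨u₀, hu₀, hmin⟩ := (isCompact_sphere (0 : Fin 4 → ℂ) 1).exists_isMinOn
    (NormedSpace.sphere_nonempty.2 zero_le_one)
    differentiable_invMap.continuous.norm.continuousOn
  refine ⟨‖invMap u₀‖, norm_pos_iff.2 fun h => ?_, fun x hx => ?_⟩
  · rw [eq_zero_of_invMap_eq_zero h] at hu₀
    simp at hu₀
  · have hx0 : 0 < ‖x‖ := by linarith
    set u : Fin 4 → ℂ := ((‖x‖ : ℂ)⁻¹) • x with hu
    have hxu : x = (‖x‖ : ℂ) • u := by
      rw [hu, smul_inv_smul₀]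
      exact_mod_cast hx0.ne'
    have hu1 : u ∈ sphere (0 : Fin 4 → ℂ) 1 := by
      rw [mem_sphere_zero_iff_norm, hu, norm_smul, norm_inv, Complex.norm_real, norm_norm]
      exact inv_mul_cancel₀ hx0.ne'
    have h1 : ‖invMap u‖ ≤ ‖invMap x‖ / ‖x‖ := by
      refine (pi_norm_le_iff_of_nonneg (by positivity)).2 fun i => ?_
      rw [le_div_iff₀ hx0]
      have h2 : ‖invMap x i‖ = ‖x‖ ^ invDeg i * ‖invMap u i‖ := by
        conv_lhs => rw [hxu, invMap_smul]
        rw [norm_mul, norm_pow, Complex.norm_real, norm_norm]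
      have h3 : ‖x‖ ≤ ‖x‖ ^ invDeg i :=
        le_self_pow₀ hx (by fin_cases i <;> simp [invDeg])
      calc ‖invMap u i‖ * ‖x‖ ≤ ‖x‖ ^ invDeg i * ‖invMap u i‖ := by
            rw [mul_comm]
            exact mul_le_mul_of_nonneg_right h3 (norm_nonneg _)
        _ = ‖invMap x i‖ := h2.symm
        _ ≤ ‖invMap x‖ := norm_le_pi_norm _ i
    have h4 : ‖invMap u₀‖ ≤ ‖invMap u‖ := hmin hu1
    exact (le_div_iff₀ hx0).1 (h4.trans h1)

theorem isClosed_range_invMap : IsClosed (range invMap) := by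
  obtain ⟨δ, hδ, h⟩ := exists_norm_le_norm_invMap
  have ht : Tendsto invMap (cocompact _) (cocompact _) := by
    rw [← cobounded_eq_cocompact, ← tendsto_norm_atTop_iff_cobounded]
    have h1 : Tendsto (fun x : Fin 4 → ℂ => δ * ‖x‖) (Bornology.cobounded _) atTop :=
      tendsto_norm_cobounded_atTop.const_mul_atTop hδ
    refine tendsto_atTop_mono' _ ?_ h1
    filter_upwards [tendsto_norm_cobounded_atTop.eventually_ge_atTop 1] with x hx using h x hx
  exact (isProperMap_iff_tendsto_cocompact.2
    ⟨differentiable_invMap.continuous, ht⟩).isClosedMap.isClosed_range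

/-! ### The image of the orbit map -/

theorem fderiv_apply_eq_jac_mulVec {f : (Fin 4 → ℂ) → Fin 4 → ℂ} {t : Fin 4 → ℂ}
    (hf : DifferentiableAt ℂ f t) (v : Fin 4 → ℂ) :
    fderiv ℂ f t v = (jac f t).mulVec v := by
  ext i
  have h1 : fderiv ℂ f t v i = fderiv ℂ (fun s => f s i) t v := by
    rw [fderiv_pi (differentiableAt_pi.1 hf)]
    rfl
  have h2 : v = ∑ j, v j • (Pi.single j 1 : Fin 4 → ℂ) := pi_eq_sum_univ' v
  rw [h1]
  conv_lhs => rw [h2]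
  rw [map_sum]
  simp only [map_smul, smul_eq_mul, Matrix.mulVec, dotProduct, jac_apply, partialD]
  exact Finset.sum_congr rfl fun j _ => mul_comm _ _

theorem hasStrictFDerivAt_of_differentiableOn {f : (Fin 4 → ℂ) → Fin 4 → ℂ}
    {U : Set (Fin 4 → ℂ)} (hU : IsOpen U) (hf : DifferentiableOn ℂ f U) {t : Fin 4 → ℂ}
    (ht : t ∈ U) : HasStrictFDerivAt f (fderiv ℂ f t) t :=
  ((contDiffOn_pi_of_differentiableOn hU 1 hf).contDiffAt (hU.mem_nhds ht)).hasStrictFDerivAt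
    (by simp)

theorem exists_equiv_of_det_jac_ne_zero {f : (Fin 4 → ℂ) → Fin 4 → ℂ} {t : Fin 4 → ℂ}
    (hf : DifferentiableAt ℂ f t) (hdet : (jac f t).det ≠ 0) :
    ∃ e : (Fin 4 → ℂ) ≃L[ℂ] (Fin 4 → ℂ), (e : (Fin 4 → ℂ) →L[ℂ] (Fin 4 → ℂ)) = fderiv ℂ f t := by
  have hinj : Function.Injective (fderiv ℂ f t : (Fin 4 → ℂ) →ₗ[ℂ] (Fin 4 → ℂ)) := by
    refine (injective_iff_map_eq_zero _).2 fun v hv => ?_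
    have hv' : (jac f t).mulVec v = 0 := by
      rw [← fderiv_apply_eq_jac_mulVec hf]
      exact hv
    exact Matrix.eq_zero_of_mulVec_eq_zero hdet hv'
  refine ⟨(LinearEquiv.ofInjectiveEndo _ hinj).toContinuousLinearEquiv, ?_⟩
  ext v
  rfl

theorem map_nhds_eq_of_det_jac_ne_zero {f : (Fin 4 → ℂ) → Fin 4 → ℂ} {U : Set (Fin 4 → ℂ)}
    (hU : IsOpen U) (hf : DifferentiableOn ℂ f U) {t : Fin 4 → ℂ} (ht : t ∈ U)
    (hdet : (jac f t).det ≠ 0) : map f (𝓝 t) = 𝓝 (f t) := by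
  obtain ⟨e, he⟩ := exists_equiv_of_det_jac_ne_zero (hf.differentiableAt (hU.mem_nhds ht)) hdet
  have := hasStrictFDerivAt_of_differentiableOn hU hf ht
  rw [← he] at this
  exact this.map_nhds_eq_of_equiv

theorem det_jac_invMap_sq (x : Fin 4 → ℂ) :
    (jac invMap x).det ^ 2 = (orbitMetric (invMap x)).det := by
  rw [← jac_invMap_mul_transpose, Matrix.det_mul, Matrix.det_transpose, sq]

/-- The determinant of the orbit metric is the square of the Jacobian of the orbit map, so off the
discriminant the inverse function theorem makes the orbit map locally open. -/
theorem range_invMap_mem_nhds {x : Fin 4 → ℂ} (hx : (orbitMetric (invMap x)).det ≠ 0) :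
    range invMap ∈ 𝓝 (invMap x) := by
  have hdet : (jac invMap x).det ≠ 0 := fun h => hx (by rw [← det_jac_invMap_sq, h]; simp)
  rw [← map_nhds_eq_of_det_jac_ne_zero isOpen_univ differentiable_invMap.differentiableOn
    (mem_univ x) hdet]
  exact range_mem_map

theorem differentiable_det_orbitMetric : Differentiable ℂ fun y => (orbitMetric y).det := by
  have h : ∀ i j, Differentiable ℂ fun y => orbitMetric y i j := by
    intro i j
    fin_cases i <;> fin_cases j <;> simp [orbitMetric] <;> fun_prop
  simp only [Matrix.det_apply]
  fun_prop

/-- A sample point off the discriminant. Two equal coordinates among the last three make `delta`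
vanish, which removes `√5` and leaves integer arithmetic. -/
theorem orbitMetric_det_base_ne_zero :
    (orbitMetric (invMap ![3, 1, 1, 2])).det ≠ 0 := by
  have e1 : eps1 1 1 2 = 6 := by norm_num [eps1]
  have e2 : eps2 1 1 2 = 9 := by norm_num [eps2]
  have e3 : eps3 1 1 2 = 4 := by norm_num [eps3]
  have e4 : delta 1 1 2 = 0 := by norm_num [delta]
  have k2 : h2 1 1 2 = 6 := by norm_num [h2, e1]
  have k6 : h6 1 1 2 = 10 := by norm_num [h6, e1, e2, e3, e4]
  have k10 : h10 1 1 2 = 270 := by norm_num [h10, e1, e2, e3, e4]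
  have hy : invMap ![3, 1, 1, 2] = ![384128614836000, 4339926180, -900570, 15] := by
    have y1e : y1 ![3, 1, 1, 2] = 384128614836000 := by
      simp only [y1, Matrix.cons_val, k2, k6, k10, inv1Poly]
      norm_num
    have y2e : y2 ![3, 1, 1, 2] = 4339926180 := by
      simp only [y2, Matrix.cons_val, k2, k6, k10, inv2Poly]
      norm_num
    have y3e : y3 ![3, 1, 1, 2] = -900570 := by
      simp only [y3, Matrix.cons_val, k2, k6, k10, inv3Poly]
      norm_num
    have y4e : y4 ![3, 1, 1, 2] = 15 := by
      simp only [y4, Matrix.cons_val, k2]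
      norm_num
    rw [invMap, y1e, y2e, y3e, y4e]
  rw [hy, orbitMetric, Matrix.det_succ_row_zero]
  simp [Fin.sum_univ_succ, Matrix.det_fin_three, Fin.succAbove]
  norm_num

/-- A holomorphic function on the plane that is not identically zero has countably many zeros. -/
theorem countable_zeros {h : ℂ → ℂ} (hh : Differentiable ℂ h) {s₀ : ℂ} (hs₀ : h s₀ ≠ 0) :
    (h ⁻¹' {0}).Countable := by
  have ha : AnalyticOnNhd ℂ h univ := hh.differentiableOn.analyticOnNhd isOpen_univ
  have hc : h ⁻¹' {0}ᶜ ∈ codiscrete ℂ := ha.preimage_zero_mem_codiscrete hs₀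
  have hd : IsDiscrete (h ⁻¹' {0}) := by simpa using (mem_codiscrete'.1 hc).2
  have := hd.to_subtype
  exact countable_coe_iff.1 (countable_of_Lindelof_of_discrete)

/-- Every point outside the discriminant is a value of the orbit map. -/
theorem exists_invMap_eq {y : Fin 4 → ℂ} (hy : (orbitMetric y).det ≠ 0) : ∃ x, invMap x = y := by
  set y₀ := invMap ![3, 1, 1, 2] with hy₀
  -- The complex line from the sample value to `y`. The discriminant does not vanish identically on
  -- it, so it meets the line in countably many points, whose complement in the real plane is
  -- connected.
  set ℓ : ℂ → Fin 4 → ℂ := fun s => y₀ + s • (y - y₀) with hℓ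
  have hℓd : Differentiable ℂ ℓ := by fun_prop
  have hℓ0 : ℓ 0 = y₀ := by simp [hℓ]
  have hℓ1 : ℓ 1 = y := by simp [hℓ]
  set h : ℂ → ℂ := fun s => (orbitMetric (ℓ s)).det with hh
  have hhd : Differentiable ℂ h := differentiable_det_orbitMetric.comp hℓd
  have h0 : h 0 ≠ 0 := by
    simp only [hh, hℓ0, hy₀]
    exact orbitMetric_det_base_ne_zero
  have hconn : IsPreconnected (h ⁻¹' {0})ᶜ :=
    ((countable_zeros hhd h0).isConnected_compl_of_one_lt_rank (by simp)).isPreconnected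
  -- Connectedness: off the discriminant a limit of interior points lies in the closed range, and
  -- the range is a neighbourhood of every such point, so being interior is also a relatively closed
  -- condition.
  have hsub : (h ⁻¹' {0})ᶜ ⊆ ℓ ⁻¹' interior (range invMap) := by
    refine hconn.subset_of_closure_inter_subset
      (isOpen_interior.preimage hℓd.continuous) ⟨0, h0, ?_⟩ ?_
    · rw [mem_preimage, hℓ0, mem_interior_iff_mem_nhds]
      exact range_invMap_mem_nhds orbitMetric_det_base_ne_zero
    · rintro s ⟨hs, hs'⟩
      have h1 : ℓ s ∈ range invMap := by
        have h2 : closure (ℓ ⁻¹' interior (range invMap)) ⊆ ℓ ⁻¹' range invMap :=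
          closure_minimal (preimage_mono interior_subset)
            (isClosed_range_invMap.preimage hℓd.continuous)
        exact h2 hs
      obtain ⟨x, hx⟩ := h1
      rw [mem_preimage, mem_interior_iff_mem_nhds, ← hx]
      exact range_invMap_mem_nhds (by rw [hx]; exact hs')
  have h1 : (1 : ℂ) ∈ (h ⁻¹' {0})ᶜ := by
    simp only [hh, mem_compl_iff, mem_preimage, hℓ1, mem_singleton_iff]
    exact hy
  have := interior_subset (hsub h1)
  rwa [hℓ1] at this

end H42

end

noncomputable section

/-! ### Calculus of partial and directional derivatives -/

namespace AlgFrobenius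

variable {f : (Fin 4 → ℂ) → ℂ} {U : Set (Fin 4 → ℂ)} {t : Fin 4 → ℂ}

theorem partialD_congr {g : (Fin 4 → ℂ) → ℂ} (hU : IsOpen U) (h : EqOn f g U) (ht : t ∈ U)
    (i : Fin 4) : partialD i f t = partialD i g t := by
  unfold partialD
  rw [(h.eventuallyEq_of_mem (hU.mem_nhds ht)).fderiv_eq]

theorem partialD_comm (hU : IsOpen U) (hf : DifferentiableOn ℂ f U) (ht : t ∈ U) (i j : Fin 4) :
    partialD i (partialD j f) t = partialD j (partialD i f) t := by
  have h2 : ContDiffOn ℂ 2 f U := by exact_mod_cast contDiffOn_nat_of_differentiableOn hU 2 hf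
  have hd : DifferentiableOn ℂ (fderiv ℂ f) U := by
    rw [show (2 : WithTop ℕ∞) = 1 + 1 by norm_num, contDiffOn_succ_iff_fderiv_of_isOpen hU] at h2
    exact h2.2.2.differentiableOn (by norm_num)
  have hsymm := ((h2.contDiffAt (hU.mem_nhds ht)).isSymmSndFDerivAt (by simp)).eq
    (Pi.single i 1) (Pi.single j 1)
  have key : ∀ v w : Fin 4 → ℂ, fderiv ℂ (fun s => fderiv ℂ f s v) t w =
      fderiv ℂ (fderiv ℂ f) t w v := fun v w => by
    have : HasFDerivAt (fun s => fderiv ℂ f s v)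
        ((ContinuousLinearMap.apply ℂ ℂ v).comp (fderiv ℂ (fderiv ℂ f) t)) t :=
      (ContinuousLinearMap.apply ℂ ℂ v).hasFDerivAt.comp t
        (hd.differentiableAt (hU.mem_nhds ht)).hasFDerivAt
    rw [this.fderiv]
    rfl
  change fderiv ℂ (fun s => fderiv ℂ f s _) t _ = fderiv ℂ (fun s => fderiv ℂ f s _) t _
  rw [key, key]
  exact hsymm

theorem sum_mul_partialD_eq (hf : DifferentiableAt ℂ f t) (v : Fin 4 → ℂ) :
    ∑ k, v k * partialD k f t = fderiv ℂ f t v := by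
  have h2 : v = ∑ j, v j • (Pi.single j 1 : Fin 4 → ℂ) := pi_eq_sum_univ' v
  conv_rhs => rw [h2]
  rw [map_sum]
  simp only [map_smul, smul_eq_mul, partialD]

theorem hasDerivAt_direction (hf : DifferentiableAt ℂ f t) (v : Fin 4 → ℂ) :
    HasDerivAt (fun s : ℂ => f (t + s • v)) (∑ k, v k * partialD k f t) 0 := by
  rw [sum_mul_partialD_eq hf]
  have hfd : HasFDerivAt f (fderiv ℂ f t) (t + (0 : ℂ) • v) := by
    rw [zero_smul, add_zero]
    exact hf.hasFDerivAt
  have hl : HasDerivAt (fun s : ℂ => t + s • v) v 0 := by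
    simpa using ((hasDerivAt_id (0 : ℂ)).smul_const v).const_add t
  exact hfd.comp_hasDerivAt (0 : ℂ) hl

theorem hasDerivAt_direction_apply (t v : Fin 4 → ℂ) (j : Fin 4) :
    HasDerivAt (fun s : ℂ => (t + s • v) j) (v j) 0 := by
  have h : HasDerivAt (fun s : ℂ => t j + s * v j) (v j) 0 := by
    simpa using ((hasDerivAt_id (0 : ℂ)).mul_const (v j)).const_add (t j)
  exact h

theorem partialD_apply (i j : Fin 4) :
    partialD i (fun s => s j) t = (Pi.single i 1 : Fin 4 → ℂ) j :=
  partialD_eq_of_hasDerivAt (by fun_prop) (hasDerivAt_line_apply t i j)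

end AlgFrobenius

namespace H42

open AlgFrobenius

/-! ### Polynomials in `t₁, Z, t₃, t₄` -/

/-- The prepotential in terms of `a = t₁`, `z = Z`, `b = t₃`, `c = t₄`. -/
def pot0 (a z b c : ℂ) : ℂ :=
    (1/2) * a ^ 2 * c + a * z ^ 3 * b - 12 * a * z * b * c ^ 4 + (27/4) * a * b ^ 3 * c
    - 11 * a * b * c ^ 6 + (1/4) * z ^ 8 - (10/7) * z ^ 7 * c ^ 2 - (53/6) * z ^ 6 * c ^ 4
    + 24 * z ^ 5 * c ^ 6 + 140 * z ^ 4 * c ^ 8 - (27/16) * z ^ 3 * b ^ 4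
    - (405/4) * z ^ 3 * b ^ 2 * c ^ 5 + (109/3) * z ^ 3 * c ^ 10 - 760 * z ^ 2 * c ^ 12
    + (81/4) * z * b ^ 4 * c ^ 4 + 1215 * z * b ^ 2 * c ^ 9 - 1716 * z * c ^ 14
    - (1701/320) * b ^ 6 * c - (17631/32) * b ^ 4 * c ^ 6 + (85455/44) * b ^ 2 * c ^ 11
    - (150191/168) * c ^ 16

/-- The first derivative `∂F/∂t1` in terms of `a = t₁`, `z = Z`, `b = t₃`, `c = t₄`. -/
def pot1 (a z b c : ℂ) : ℂ :=
    a * c + z ^ 3 * b - 12 * z * b * c ^ 4 + (27/4) * b ^ 3 * c - 11 * b * c ^ 6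

/-- The first derivative `∂F/∂t2` in terms of `a = t₁`, `z = Z`, `b = t₃`, `c = t₄`. -/
def pot2 (a z b c : ℂ) : ℂ :=
    a * b + (2/3) * z ^ 5 - (10/3) * z ^ 4 * c ^ 2 - 15 * z ^ 3 * c ^ 4 + (80/3) * z ^ 2 * c ^ 6
    + (380/3) * z * c ^ 8 - (27/16) * b ^ 4 - (405/4) * b ^ 2 * c ^ 5 + 143 * c ^ 10

/-- The first derivative `∂F/∂t3` in terms of `a = t₁`, `z = Z`, `b = t₃`, `c = t₄`. -/
def pot3 (a z b c : ℂ) : ℂ :=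
    a * z ^ 3 - 12 * a * z * c ^ 4 + (27/4) * a * b ^ 2 * c - 11 * a * c ^ 6 - 9 * z ^ 5 * b * c
    + 45 * z ^ 4 * b * c ^ 3 - (27/4) * z ^ 3 * b ^ 3 - 360 * z ^ 2 * b * c ^ 7
    + 81 * z * b ^ 3 * c ^ 4 + 720 * z * b * c ^ 9 - (729/80) * b ^ 5 * c - 837 * b ^ 3 * c ^ 6
    + (21492/11) * b * c ^ 11

/-- The first derivative `∂F/∂t4` in terms of `a = t₁`, `z = Z`, `b = t₃`, `c = t₄`. -/
def pot4 (a z b c : ℂ) : ℂ :=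
    (1/2) * a ^ 2 - (20/7) * z ^ 7 * c - (10/3) * z ^ 6 * c ^ 3 - (9/2) * z ^ 5 * b ^ 2
    + 28 * z ^ 5 * c ^ 5 + (45/2) * z ^ 4 * b ^ 2 * c ^ 2 + 180 * z ^ 4 * c ^ 7
    - 405 * z ^ 3 * b ^ 2 * c ^ 4 + (1960/3) * z ^ 3 * c ^ 9 - 180 * z ^ 2 * b ^ 2 * c ^ 6
    - 1280 * z ^ 2 * c ^ 11 + 5220 * z * b ^ 2 * c ^ 8 - 8800 * z * c ^ 13 + (243/40) * b ^ 6
    - (10935/4) * b ^ 4 * c ^ 5 + 13716 * b ^ 2 * c ^ 10 - (102184/21) * c ^ 15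

/-- The entries of the Hessian of the prepotential with respect to `t`. Each derivative of `Z` has
the denominator `discZ`, but the `Z`-derivatives of `pot1`, …, `pot4` are divisible by it, so the
entries are polynomials. -/
def pot11 (a z b c : ℂ) : ℂ :=
    c

def pot12 (a z b c : ℂ) : ℂ :=
    b

def pot13 (a z b c : ℂ) : ℂ :=
    z ^ 3 - 12 * z * c ^ 4 + (27/4) * b ^ 2 * c - 11 * c ^ 6

def pot14 (a z b c : ℂ) : ℂ :=
    a

def pot22 (a z b c : ℂ) : ℂ :=
    (10/9) * z ^ 2 - (40/9) * z * c ^ 2 - (95/9) * c ^ 4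

def pot23 (a z b c : ℂ) : ℂ :=
    a - 15 * z ^ 2 * b * c + 60 * z * b * c ^ 3 - (27/4) * b ^ 3 - 60 * b * c ^ 5

def pot24 (a z b c : ℂ) : ℂ :=
    -(20/3) * z ^ 4 * c - (20/3) * z ^ 3 * c ^ 3 - (15/2) * z ^ 2 * b ^ 2 + 20 * z ^ 2 * c ^ 5
    + 30 * z * b ^ 2 * c ^ 2 + (640/3) * z * c ^ 7 - 435 * b ^ 2 * c ^ 4 + (2200/3) * c ^ 9

def pot33 (a z b c : ℂ) : ℂ :=
    -9 * z ^ 5 * c + 45 * z ^ 4 * c ^ 3 - (81/4) * z ^ 3 * b ^ 2 + (405/2) * z ^ 2 * b ^ 2 * c ^ 2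
    - 360 * z ^ 2 * c ^ 7 - 567 * z * b ^ 2 * c ^ 4 + 720 * z * c ^ 9 + (729/16) * b ^ 4 * c
    - 1701 * b ^ 2 * c ^ 6 + (21492/11) * c ^ 11

def pot34 (a z b c : ℂ) : ℂ :=
    -9 * z ^ 5 * b + 135 * z ^ 4 * b * c ^ 2 - 720 * z ^ 3 * b * c ^ 4
    + (405/4) * z ^ 2 * b ^ 3 * c - 630 * z ^ 2 * b * c ^ 6 - 405 * z * b ^ 3 * c ^ 3
    + 7560 * z * b * c ^ 8 + (729/20) * b ^ 5 - (10125/2) * b ^ 3 * c ^ 5 + 17532 * b * c ^ 10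

def pot44 (a z b c : ℂ) : ℂ :=
    -(20/7) * z ^ 7 - 10 * z ^ 6 * c ^ 2 - 180 * z ^ 5 * c ^ 4 + 90 * z ^ 4 * b ^ 2 * c
    + 500 * z ^ 4 * c ^ 6 - 1935 * z ^ 3 * b ^ 2 * c ^ 3 + 6400 * z ^ 3 * c ^ 8
    + (405/8) * z ^ 2 * b ^ 4 - 270 * z ^ 2 * b ^ 2 * c ^ 5 - 2520 * z ^ 2 * c ^ 10
    - (405/2) * z * b ^ 4 * c ^ 2 + 21420 * z * b ^ 2 * c ^ 7 - 65120 * z * c ^ 12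
    - (21465/2) * b ^ 4 * c ^ 4 + 103500 * b ^ 2 * c ^ 9 - (172120/7) * c ^ 14

/-- The Hessian of the prepotential. -/
def hess (a z b c : ℂ) : Matrix (Fin 4) (Fin 4) ℂ :=
  !![pot11 a z b c, pot12 a z b c, pot13 a z b c, pot14 a z b c;
    pot12 a z b c, pot22 a z b c, pot23 a z b c, pot24 a z b c;
    pot13 a z b c, pot23 a z b c, pot33 a z b c, pot34 a z b c;
    pot14 a z b c, pot24 a z b c, pot34 a z b c, pot44 a z b c]

/-- The Euler derivative of a Hessian entry is its weight times the entry, and raising indices with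
the antidiagonal `η` reverses them; thus `inter11` is `28/15` times `pot44`, and similarly for the
others. -/
def inter11 (a z b c : ℂ) : ℂ :=
    -(16/3) * z ^ 7 - (56/3) * z ^ 6 * c ^ 2 - 336 * z ^ 5 * c ^ 4 + 168 * z ^ 4 * b ^ 2 * c
    + (2800/3) * z ^ 4 * c ^ 6 - 3612 * z ^ 3 * b ^ 2 * c ^ 3 + (35840/3) * z ^ 3 * c ^ 8
    + (189/2) * z ^ 2 * b ^ 4 - 504 * z ^ 2 * b ^ 2 * c ^ 5 - 4704 * z ^ 2 * c ^ 10
    - 378 * z * b ^ 4 * c ^ 2 + 39984 * z * b ^ 2 * c ^ 7 - (364672/3) * z * c ^ 12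
    - 20034 * b ^ 4 * c ^ 4 + 193200 * b ^ 2 * c ^ 9 - (137696/3) * c ^ 14

def inter12 (a z b c : ℂ) : ℂ :=
    -15 * z ^ 5 * b + 225 * z ^ 4 * b * c ^ 2 - 1200 * z ^ 3 * b * c ^ 4
    + (675/4) * z ^ 2 * b ^ 3 * c - 1050 * z ^ 2 * b * c ^ 6 - 675 * z * b ^ 3 * c ^ 3
    + 12600 * z * b * c ^ 8 + (243/4) * b ^ 5 - (16875/2) * b ^ 3 * c ^ 5 + 29220 * b * c ^ 10

def inter13 (a z b c : ℂ) : ℂ :=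
    -8 * z ^ 4 * c - 8 * z ^ 3 * c ^ 3 - 9 * z ^ 2 * b ^ 2 + 24 * z ^ 2 * c ^ 5
    + 36 * z * b ^ 2 * c ^ 2 + 256 * z * c ^ 7 - 522 * b ^ 2 * c ^ 4 + 880 * c ^ 9

def inter14 (a z b c : ℂ) : ℂ :=
    a

def inter22 (a z b c : ℂ) : ℂ :=
    -(66/5) * z ^ 5 * c + 66 * z ^ 4 * c ^ 3 - (297/10) * z ^ 3 * b ^ 2
    + 297 * z ^ 2 * b ^ 2 * c ^ 2 - 528 * z ^ 2 * c ^ 7 - (4158/5) * z * b ^ 2 * c ^ 4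
    + 1056 * z * c ^ 9 + (2673/40) * b ^ 4 * c - (12474/5) * b ^ 2 * c ^ 6 + (14328/5) * c ^ 11

def inter23 (a z b c : ℂ) : ℂ :=
    a - 15 * z ^ 2 * b * c + 60 * z * b * c ^ 3 - (27/4) * b ^ 3 - 60 * b * c ^ 5

def inter24 (a z b c : ℂ) : ℂ :=
    (4/5) * z ^ 3 - (48/5) * z * c ^ 4 + (27/5) * b ^ 2 * c - (44/5) * c ^ 6

def inter33 (a z b c : ℂ) : ℂ :=
    (16/27) * z ^ 2 - (64/27) * z * c ^ 2 - (152/27) * c ^ 4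

def inter34 (a z b c : ℂ) : ℂ :=
    (1/3) * b

def inter44 (a z b c : ℂ) : ℂ :=
    (2/15) * c

/-- The intersection form. -/
def inter (a z b c : ℂ) : Matrix (Fin 4) (Fin 4) ℂ :=
  !![inter11 a z b c, inter12 a z b c, inter13 a z b c, inter14 a z b c;
    inter12 a z b c, inter22 a z b c, inter23 a z b c, inter24 a z b c;
    inter13 a z b c, inter23 a z b c, inter33 a z b c, inter34 a z b c;
    inter14 a z b c, inter24 a z b c, inter34 a z b c, inter44 a z b c]

/-- The right-hand side for `y₁` with `t₂` eliminated through the cubic; `form2`, `form3`, `form4`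
play the same role for the other invariants. -/
def form1 (a z b c : ℂ) : ℂ :=
    25920000000000 * a ^ 2 + 845640000000000 * a * b ^ 3 + 20995200000000000 * a * b * c ^ 5
    + 138240000000000 * z ^ 7 * c + 1198080000000000 * z ^ 6 * c ^ 3
    - 233280000000000 * z ^ 5 * b ^ 2 - 5087232000000000 * z ^ 5 * c ^ 5
    + 1166400000000000 * z ^ 4 * b ^ 2 * c ^ 2 - 14929920000000000 * z ^ 4 * c ^ 7
    + 31492800000000000 * z ^ 3 * b ^ 2 * c ^ 4 + 356152320000000000 * z ^ 3 * c ^ 9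
    - 9331200000000000 * z ^ 2 * b ^ 2 * c ^ 6 + 61931520000000000 * z ^ 2 * c ^ 11
    - 359251200000000000 * z * b ^ 2 * c ^ 8 - 3928780800000000000 * z * c ^ 13
    + 1361407500000000 * b ^ 6 + 342484200000000000 * b ^ 4 * c ^ 5
    + 6274765440000000000 * b ^ 2 * c ^ 10 + 14863435776000000000 * c ^ 15

def form2 (a z b c : ℂ) : ℂ :=
    3240000000 * a * b - 576000000 * z ^ 5 + 2880000000 * z ^ 4 * c ^ 2
    + 77760000000 * z ^ 3 * c ^ 4 - 23040000000 * z ^ 2 * c ^ 6 - 887040000000 * z * c ^ 8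
    + 11846250000 * b ^ 4 + 1312200000000 * b ^ 2 * c ^ 5 + 4995648000000 * c ^ 10

def form3 (a z b c : ℂ) : ℂ :=
    -240000 * z ^ 3 + 2880000 * z * c ^ 4 - 6075000 * b ^ 2 * c - 62160000 * c ^ 6

def form4 (a z b c : ℂ) : ℂ :=
    30 * c

/-- The derivatives are with respect to `t₁, …, t₄`, not `a, z, b, c`. The second entry is the
`z`-derivative divided by `discZ`, and the others include the dependence of `Z` on `t₃` and `t₄`. -/
def form1Grad (a z b c : ℂ) : Fin 4 → ℂ :=
  ![51840000000000 * a + 845640000000000 * b ^ 3 + 20995200000000000 * b * c ^ 5,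
    322560000000000 * z ^ 4 * c + 2396160000000000 * z ^ 3 * c ^ 3
    - 388800000000000 * z ^ 2 * b ^ 2 - 7188480000000000 * z ^ 2 * c ^ 5
    + 1555200000000000 * z * b ^ 2 * c ^ 2 - 10321920000000000 * z * c ^ 7
    + 29937600000000000 * b ^ 2 * c ^ 4 + 327398400000000000 * c ^ 9,
    2536920000000000 * a * b ^ 2 + 20995200000000000 * a * c ^ 5 - 466560000000000 * z ^ 5 * b
    - 2021760000000000 * z ^ 4 * b * c ^ 2 + 30637440000000000 * z ^ 3 * b * c ^ 4
    + 5248800000000000 * z ^ 2 * b ^ 3 * c + 78382080000000000 * z ^ 2 * b * c ^ 6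
    - 20995200000000000 * z * b ^ 3 * c ^ 3 - 579156480000000000 * z * b * c ^ 8
    + 8168445000000000 * b ^ 5 + 965779200000000000 * b ^ 3 * c ^ 5
    + 8129652480000000000 * b * c ^ 10,
    104976000000000000 * a * b * c ^ 4 + 138240000000000 * z ^ 7
    + 3594240000000000 * z ^ 6 * c ^ 2 - 9953280000000000 * z ^ 5 * c ^ 4
    + 155520000000000 * z ^ 4 * b ^ 2 * c + 31795200000000000 * z ^ 4 * c ^ 6
    + 91134720000000000 * z ^ 3 * b ^ 2 * c ^ 3 + 3018470400000000000 * z ^ 3 * c ^ 8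
    + 2624400000000000 * z ^ 2 * b ^ 4 + 41523840000000000 * z ^ 2 * b ^ 2 * c ^ 5
    - 288645120000000000 * z ^ 2 * c ^ 10 - 10497600000000000 * z * b ^ 4 * c ^ 2
    - 1264688640000000000 * z * b ^ 2 * c ^ 7 - 36040273920000000000 * z * c ^ 12
    + 1510342200000000000 * b ^ 4 * c ^ 4 + 62513596800000000000 * b ^ 2 * c ^ 9
    + 244559831040000000000 * c ^ 14]

def form2Grad (a z b c : ℂ) : Fin 4 → ℂ :=
  ![3240000000 * b,
    -960000000 * z ^ 2 + 3840000000 * z * c ^ 2 + 73920000000 * c ^ 4,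
    3240000000 * a + 12960000000 * z ^ 2 * b * c - 51840000000 * z * b * c ^ 3
    + 47385000000 * b ^ 3 + 1626480000000 * b * c ^ 5,
    5760000000 * z ^ 4 * c + 264960000000 * z ^ 3 * c ^ 3 + 6480000000 * z ^ 2 * b ^ 2
    - 17280000000 * z ^ 2 * c ^ 5 - 25920000000 * z * b ^ 2 * c ^ 2 - 3294720000000 * z * c ^ 7
    + 6062040000000 * b ^ 2 * c ^ 4 + 54835200000000 * c ^ 9]

def form3Grad (a z b c : ℂ) : Fin 4 → ℂ :=
  ![0,
    -240000,
    -8910000 * b * c,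
    -4455000 * b ^ 2 - 388800000 * c ^ 5]

def form4Grad (a z b c : ℂ) : Fin 4 → ℂ :=
  ![0,
    0,
    0,
    30]

/-- The derivative of the cubic with respect to `Z`. -/
def discZ (z c : ℂ) : ℂ := 3 * z ^ 2 - 12 * c ^ 4

/-- The numerators of the derivatives of `Z`. -/
def numZ (z b c : ℂ) : Fin 4 → ℂ :=
  ![0, 1, -(27 / 2) * b * c, 48 * c ^ 3 * z + 66 * c ^ 5 - (27 / 4) * b ^ 2]

section Curve

variable {a z b c : ℂ → ℂ} {a' z' b' c' n s : ℂ}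

/-- Through `hn` the unknown `z'` appears only as `n = z' · discZ`, because the `z`-derivative of
the polynomial is divisible by `discZ`; the quotient is the coefficient of `n`. This keeps all later
computations free of denominators. -/
theorem hasDerivAt_pot0 (ha : HasDerivAt a a' s) (hz : HasDerivAt z z' s)
    (hb : HasDerivAt b b' s) (hc : HasDerivAt c c' s) (hn : z' * discZ (z s) (c s) = n) :
    HasDerivAt (fun s => pot0 (a s) (z s) (b s) (c s))
      (a' * (a s * c s + (z s) ^ 3 * b s - 12 * z s * b s * (c s) ^ 4 + (27/4) * (b s) ^ 3 * c s
      - 11 * b s * (c s) ^ 6) + n * (a s * b s + (2/3) * (z s) ^ 5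
      - (10/3) * (z s) ^ 4 * (c s) ^ 2 - 15 * (z s) ^ 3 * (c s) ^ 4
      + (80/3) * (z s) ^ 2 * (c s) ^ 6 + (380/3) * z s * (c s) ^ 8 - (27/16) * (b s) ^ 4
      - (405/4) * (b s) ^ 2 * (c s) ^ 5 + 143 * (c s) ^ 10) + b' * (a s * (z s) ^ 3
      - 12 * a s * z s * (c s) ^ 4 + (81/4) * a s * (b s) ^ 2 * c s - 11 * a s * (c s) ^ 6
      - (27/4) * (z s) ^ 3 * (b s) ^ 3 - (405/2) * (z s) ^ 3 * b s * (c s) ^ 5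
      + 81 * z s * (b s) ^ 3 * (c s) ^ 4 + 2430 * z s * b s * (c s) ^ 9
      - (5103/160) * (b s) ^ 5 * c s - (17631/8) * (b s) ^ 3 * (c s) ^ 6
      + (85455/22) * b s * (c s) ^ 11) + c' * ((1/2) * (a s) ^ 2
      - 48 * a s * z s * b s * (c s) ^ 3 + (27/4) * a s * (b s) ^ 3 - 66 * a s * b s * (c s) ^ 5
      - (20/7) * (z s) ^ 7 * c s - (106/3) * (z s) ^ 6 * (c s) ^ 3 + 144 * (z s) ^ 5 * (c s) ^ 5
      + 1120 * (z s) ^ 4 * (c s) ^ 7 - (2025/4) * (z s) ^ 3 * (b s) ^ 2 * (c s) ^ 4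
      + (1090/3) * (z s) ^ 3 * (c s) ^ 9 - 9120 * (z s) ^ 2 * (c s) ^ 11
      + 81 * z s * (b s) ^ 4 * (c s) ^ 3 + 10935 * z s * (b s) ^ 2 * (c s) ^ 8
      - 24024 * z s * (c s) ^ 13 - (1701/320) * (b s) ^ 6 - (52893/16) * (b s) ^ 4 * (c s) ^ 5
      + (85455/4) * (b s) ^ 2 * (c s) ^ 10 - (300382/21) * (c s) ^ 15)) s := by
  unfold pot0
  unfold discZ at hn
  apply HasDerivAt.congr_deriv
  · with_reducible repeat' first
      | exact ha | exact hz | exact hb | exact hc | exact hasDerivAt_const _ _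
      | apply HasDerivAt.fun_add | apply HasDerivAt.fun_sub | apply HasDerivAt.fun_mul
      | apply HasDerivAt.fun_pow | apply HasDerivAt.fun_neg
  · simp only [Nat.cast_ofNat, Nat.add_one_sub_one, Nat.reduceSub, pow_one]
    linear_combination ((a s) * (b s) + (2/3) * (z s) ^ 5 - (10/3) * (z s) ^ 4 * (c s) ^ 2 - 15 * (z s) ^ 3 * (c s) ^ 4 + (80/3) * (z s) ^ 2 * (c s) ^ 6 + (380/3) * (z s) * (c s) ^ 8 - (27/16) * (b s) ^ 4 - (405/4) * (b s) ^ 2 * (c s) ^ 5 + 143 * (c s) ^ 10) * hn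

theorem hasDerivAt_pot1 (ha : HasDerivAt a a' s) (hz : HasDerivAt z z' s)
    (hb : HasDerivAt b b' s) (hc : HasDerivAt c c' s) (hn : z' * discZ (z s) (c s) = n) :
    HasDerivAt (fun s => pot1 (a s) (z s) (b s) (c s))
      (a' * (c s) + n * (b s) + b' * ((z s) ^ 3 - 12 * z s * (c s) ^ 4 + (81/4) * (b s) ^ 2 * c s
      - 11 * (c s) ^ 6) + c' * (a s - 48 * z s * b s * (c s) ^ 3 + (27/4) * (b s) ^ 3
      - 66 * b s * (c s) ^ 5)) s := by
  unfold pot1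
  unfold discZ at hn
  apply HasDerivAt.congr_deriv
  · with_reducible repeat' first
      | exact ha | exact hz | exact hb | exact hc | exact hasDerivAt_const _ _
      | apply HasDerivAt.fun_add | apply HasDerivAt.fun_sub | apply HasDerivAt.fun_mul
      | apply HasDerivAt.fun_pow | apply HasDerivAt.fun_neg
  · simp only [Nat.cast_ofNat, Nat.add_one_sub_one, Nat.reduceSub, pow_one]
    linear_combination ((b s)) * hn

theorem hasDerivAt_pot2 (ha : HasDerivAt a a' s) (hz : HasDerivAt z z' s)
    (hb : HasDerivAt b b' s) (hc : HasDerivAt c c' s) (hn : z' * discZ (z s) (c s) = n) :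
    HasDerivAt (fun s => pot2 (a s) (z s) (b s) (c s))
      (a' * (b s) + n * ((10/9) * (z s) ^ 2 - (40/9) * z s * (c s) ^ 2 - (95/9) * (c s) ^ 4)
      + b' * (a s - (27/4) * (b s) ^ 3 - (405/2) * b s * (c s) ^ 5)
      + c' * (-(20/3) * (z s) ^ 4 * c s - 60 * (z s) ^ 3 * (c s) ^ 3 + 160 * (z s) ^ 2 * (c s) ^ 5
      + (3040/3) * z s * (c s) ^ 7 - (2025/4) * (b s) ^ 2 * (c s) ^ 4 + 1430 * (c s) ^ 9)) s := by
  unfold pot2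
  unfold discZ at hn
  apply HasDerivAt.congr_deriv
  · with_reducible repeat' first
      | exact ha | exact hz | exact hb | exact hc | exact hasDerivAt_const _ _
      | apply HasDerivAt.fun_add | apply HasDerivAt.fun_sub | apply HasDerivAt.fun_mul
      | apply HasDerivAt.fun_pow | apply HasDerivAt.fun_neg
  · simp only [Nat.cast_ofNat, Nat.add_one_sub_one, Nat.reduceSub, pow_one]
    linear_combination ((10/9) * (z s) ^ 2 - (40/9) * (z s) * (c s) ^ 2 - (95/9) * (c s) ^ 4) * hn

theorem hasDerivAt_pot3 (ha : HasDerivAt a a' s) (hz : HasDerivAt z z' s)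
    (hb : HasDerivAt b b' s) (hc : HasDerivAt c c' s) (hn : z' * discZ (z s) (c s) = n) :
    HasDerivAt (fun s => pot3 (a s) (z s) (b s) (c s))
      (a' * ((z s) ^ 3 - 12 * z s * (c s) ^ 4 + (27/4) * (b s) ^ 2 * c s - 11 * (c s) ^ 6)
      + n * (a s - 15 * (z s) ^ 2 * b s * c s + 60 * z s * b s * (c s) ^ 3 - (27/4) * (b s) ^ 3
      - 60 * b s * (c s) ^ 5) + b' * ((27/2) * a s * b s * c s - 9 * (z s) ^ 5 * c s
      + 45 * (z s) ^ 4 * (c s) ^ 3 - (81/4) * (z s) ^ 3 * (b s) ^ 2 - 360 * (z s) ^ 2 * (c s) ^ 7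
      + 243 * z s * (b s) ^ 2 * (c s) ^ 4 + 720 * z s * (c s) ^ 9 - (729/16) * (b s) ^ 4 * c s
      - 2511 * (b s) ^ 2 * (c s) ^ 6 + (21492/11) * (c s) ^ 11)
      + c' * (-48 * a s * z s * (c s) ^ 3 + (27/4) * a s * (b s) ^ 2 - 66 * a s * (c s) ^ 5
      - 9 * (z s) ^ 5 * b s + 135 * (z s) ^ 4 * b s * (c s) ^ 2
      - 2520 * (z s) ^ 2 * b s * (c s) ^ 6 + 324 * z s * (b s) ^ 3 * (c s) ^ 3
      + 6480 * z s * b s * (c s) ^ 8 - (729/80) * (b s) ^ 5 - 5022 * (b s) ^ 3 * (c s) ^ 5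
      + 21492 * b s * (c s) ^ 10)) s := by
  unfold pot3
  unfold discZ at hn
  apply HasDerivAt.congr_deriv
  · with_reducible repeat' first
      | exact ha | exact hz | exact hb | exact hc | exact hasDerivAt_const _ _
      | apply HasDerivAt.fun_add | apply HasDerivAt.fun_sub | apply HasDerivAt.fun_mul
      | apply HasDerivAt.fun_pow | apply HasDerivAt.fun_neg
  · simp only [Nat.cast_ofNat, Nat.add_one_sub_one, Nat.reduceSub, pow_one]
    linear_combination ((a s) - 15 * (z s) ^ 2 * (b s) * (c s) + 60 * (z s) * (b s) * (c s) ^ 3 - (27/4) * (b s) ^ 3 - 60 * (b s) * (c s) ^ 5) * hn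

theorem hasDerivAt_pot4 (ha : HasDerivAt a a' s) (hz : HasDerivAt z z' s)
    (hb : HasDerivAt b b' s) (hc : HasDerivAt c c' s) (hn : z' * discZ (z s) (c s) = n) :
    HasDerivAt (fun s => pot4 (a s) (z s) (b s) (c s))
      (a' * (a s) + n * (-(20/3) * (z s) ^ 4 * c s - (20/3) * (z s) ^ 3 * (c s) ^ 3
      - (15/2) * (z s) ^ 2 * (b s) ^ 2 + 20 * (z s) ^ 2 * (c s) ^ 5
      + 30 * z s * (b s) ^ 2 * (c s) ^ 2 + (640/3) * z s * (c s) ^ 7 - 435 * (b s) ^ 2 * (c s) ^ 4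
      + (2200/3) * (c s) ^ 9) + b' * (-9 * (z s) ^ 5 * b s + 45 * (z s) ^ 4 * b s * (c s) ^ 2
      - 810 * (z s) ^ 3 * b s * (c s) ^ 4 - 360 * (z s) ^ 2 * b s * (c s) ^ 6
      + 10440 * z s * b s * (c s) ^ 8 + (729/20) * (b s) ^ 5 - 10935 * (b s) ^ 3 * (c s) ^ 5
      + 27432 * b s * (c s) ^ 10) + c' * (-(20/7) * (z s) ^ 7 - 10 * (z s) ^ 6 * (c s) ^ 2
      + 140 * (z s) ^ 5 * (c s) ^ 4 + 45 * (z s) ^ 4 * (b s) ^ 2 * c s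
      + 1260 * (z s) ^ 4 * (c s) ^ 6 - 1620 * (z s) ^ 3 * (b s) ^ 2 * (c s) ^ 3
      + 5880 * (z s) ^ 3 * (c s) ^ 8 - 1080 * (z s) ^ 2 * (b s) ^ 2 * (c s) ^ 5
      - 14080 * (z s) ^ 2 * (c s) ^ 10 + 41760 * z s * (b s) ^ 2 * (c s) ^ 7
      - 114400 * z s * (c s) ^ 12 - (54675/4) * (b s) ^ 4 * (c s) ^ 4
      + 137160 * (b s) ^ 2 * (c s) ^ 9 - (510920/7) * (c s) ^ 14)) s := by
  unfold pot4
  unfold discZ at hn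
  apply HasDerivAt.congr_deriv
  · with_reducible repeat' first
      | exact ha | exact hz | exact hb | exact hc | exact hasDerivAt_const _ _
      | apply HasDerivAt.fun_add | apply HasDerivAt.fun_sub | apply HasDerivAt.fun_mul
      | apply HasDerivAt.fun_pow | apply HasDerivAt.fun_neg
  · simp only [Nat.cast_ofNat, Nat.add_one_sub_one, Nat.reduceSub, pow_one]
    linear_combination (-(20/3) * (z s) ^ 4 * (c s) - (20/3) * (z s) ^ 3 * (c s) ^ 3 - (15/2) * (z s) ^ 2 * (b s) ^ 2 + 20 * (z s) ^ 2 * (c s) ^ 5 + 30 * (z s) * (b s) ^ 2 * (c s) ^ 2 + (640/3) * (z s) * (c s) ^ 7 - 435 * (b s) ^ 2 * (c s) ^ 4 + (2200/3) * (c s) ^ 9) * hn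

theorem hasDerivAt_form1 (ha : HasDerivAt a a' s) (hz : HasDerivAt z z' s)
    (hb : HasDerivAt b b' s) (hc : HasDerivAt c c' s) (hn : z' * discZ (z s) (c s) = n) :
    HasDerivAt (fun s => form1 (a s) (z s) (b s) (c s))
      (a' * (51840000000000 * a s + 845640000000000 * (b s) ^ 3
      + 20995200000000000 * b s * (c s) ^ 5) + n * (322560000000000 * (z s) ^ 4 * c s
      + 2396160000000000 * (z s) ^ 3 * (c s) ^ 3 - 388800000000000 * (z s) ^ 2 * (b s) ^ 2
      - 7188480000000000 * (z s) ^ 2 * (c s) ^ 5 + 1555200000000000 * z s * (b s) ^ 2 * (c s) ^ 2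
      - 10321920000000000 * z s * (c s) ^ 7 + 29937600000000000 * (b s) ^ 2 * (c s) ^ 4
      + 327398400000000000 * (c s) ^ 9) + b' * (2536920000000000 * a s * (b s) ^ 2
      + 20995200000000000 * a s * (c s) ^ 5 - 466560000000000 * (z s) ^ 5 * b s
      + 2332800000000000 * (z s) ^ 4 * b s * (c s) ^ 2
      + 62985600000000000 * (z s) ^ 3 * b s * (c s) ^ 4
      - 18662400000000000 * (z s) ^ 2 * b s * (c s) ^ 6
      - 718502400000000000 * z s * b s * (c s) ^ 8 + 8168445000000000 * (b s) ^ 5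
      + 1369936800000000000 * (b s) ^ 3 * (c s) ^ 5 + 12549530880000000000 * b s * (c s) ^ 10)
      + c' * (104976000000000000 * a s * b s * (c s) ^ 4 + 138240000000000 * (z s) ^ 7
      + 3594240000000000 * (z s) ^ 6 * (c s) ^ 2 - 25436160000000000 * (z s) ^ 5 * (c s) ^ 4
      + 2332800000000000 * (z s) ^ 4 * (b s) ^ 2 * c s
      - 104509440000000000 * (z s) ^ 4 * (c s) ^ 6
      + 125971200000000000 * (z s) ^ 3 * (b s) ^ 2 * (c s) ^ 3
      + 3205370880000000000 * (z s) ^ 3 * (c s) ^ 8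
      - 55987200000000000 * (z s) ^ 2 * (b s) ^ 2 * (c s) ^ 5
      + 681246720000000000 * (z s) ^ 2 * (c s) ^ 10
      - 2874009600000000000 * z s * (b s) ^ 2 * (c s) ^ 7
      - 51074150400000000000 * z s * (c s) ^ 12 + 1712421000000000000 * (b s) ^ 4 * (c s) ^ 4
      + 62747654400000000000 * (b s) ^ 2 * (c s) ^ 9 + 222951536640000000000 * (c s) ^ 14)) s := by
  unfold form1
  unfold discZ at hn
  apply HasDerivAt.congr_deriv
  · with_reducible repeat' first
      | exact ha | exact hz | exact hb | exact hc | exact hasDerivAt_const _ _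
      | apply HasDerivAt.fun_add | apply HasDerivAt.fun_sub | apply HasDerivAt.fun_mul
      | apply HasDerivAt.fun_pow | apply HasDerivAt.fun_neg
  · simp only [Nat.cast_ofNat, Nat.add_one_sub_one, Nat.reduceSub, pow_one]
    linear_combination (322560000000000 * (z s) ^ 4 * (c s) + 2396160000000000 * (z s) ^ 3 * (c s) ^ 3 - 388800000000000 * (z s) ^ 2 * (b s) ^ 2 - 7188480000000000 * (z s) ^ 2 * (c s) ^ 5 + 1555200000000000 * (z s) * (b s) ^ 2 * (c s) ^ 2 - 10321920000000000 * (z s) * (c s) ^ 7 + 29937600000000000 * (b s) ^ 2 * (c s) ^ 4 + 327398400000000000 * (c s) ^ 9) * hn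

theorem hasDerivAt_form2 (ha : HasDerivAt a a' s) (hz : HasDerivAt z z' s)
    (hb : HasDerivAt b b' s) (hc : HasDerivAt c c' s) (hn : z' * discZ (z s) (c s) = n) :
    HasDerivAt (fun s => form2 (a s) (z s) (b s) (c s))
      (a' * (3240000000 * b s) + n * (-960000000 * (z s) ^ 2 + 3840000000 * z s * (c s) ^ 2
      + 73920000000 * (c s) ^ 4) + b' * (3240000000 * a s + 47385000000 * (b s) ^ 3
      + 2624400000000 * b s * (c s) ^ 5) + c' * (5760000000 * (z s) ^ 4 * c s
      + 311040000000 * (z s) ^ 3 * (c s) ^ 3 - 138240000000 * (z s) ^ 2 * (c s) ^ 5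
      - 7096320000000 * z s * (c s) ^ 7 + 6561000000000 * (b s) ^ 2 * (c s) ^ 4
      + 49956480000000 * (c s) ^ 9)) s := by
  unfold form2
  unfold discZ at hn
  apply HasDerivAt.congr_deriv
  · with_reducible repeat' first
      | exact ha | exact hz | exact hb | exact hc | exact hasDerivAt_const _ _
      | apply HasDerivAt.fun_add | apply HasDerivAt.fun_sub | apply HasDerivAt.fun_mul
      | apply HasDerivAt.fun_pow | apply HasDerivAt.fun_neg
  · simp only [Nat.cast_ofNat, Nat.add_one_sub_one, Nat.reduceSub, pow_one]
    linear_combination (-960000000 * (z s) ^ 2 + 3840000000 * (z s) * (c s) ^ 2 + 73920000000 * (c s) ^ 4) * hn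

theorem hasDerivAt_form3 (ha : HasDerivAt a a' s) (hz : HasDerivAt z z' s)
    (hb : HasDerivAt b b' s) (hc : HasDerivAt c c' s) (hn : z' * discZ (z s) (c s) = n) :
    HasDerivAt (fun s => form3 (a s) (z s) (b s) (c s))
      (n * (-240000) + b' * (-12150000 * b s * c s) + c' * (11520000 * z s * (c s) ^ 3
      - 6075000 * (b s) ^ 2 - 372960000 * (c s) ^ 5)) s := by
  unfold form3
  unfold discZ at hn
  apply HasDerivAt.congr_deriv
  · with_reducible repeat' first
      | exact ha | exact hz | exact hb | exact hc | exact hasDerivAt_const _ _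
      | apply HasDerivAt.fun_add | apply HasDerivAt.fun_sub | apply HasDerivAt.fun_mul
      | apply HasDerivAt.fun_pow | apply HasDerivAt.fun_neg
  · simp only [Nat.cast_ofNat, Nat.add_one_sub_one, Nat.reduceSub, pow_one]
    linear_combination (-240000) * hn

theorem hasDerivAt_form4 (ha : HasDerivAt a a' s) (hz : HasDerivAt z z' s)
    (hb : HasDerivAt b b' s) (hc : HasDerivAt c c' s) (hn : z' * discZ (z s) (c s) = n) :
    HasDerivAt (fun s => form4 (a s) (z s) (b s) (c s))
      (c' * (30)) s := by
  unfold form4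
  unfold discZ at hn
  apply HasDerivAt.congr_deriv
  · with_reducible repeat' first
      | exact ha | exact hz | exact hb | exact hc | exact hasDerivAt_const _ _
      | apply HasDerivAt.fun_add | apply HasDerivAt.fun_sub | apply HasDerivAt.fun_mul
      | apply HasDerivAt.fun_pow | apply HasDerivAt.fun_neg
  · linear_combination (0) * hn

/-- The hypotheses say that the velocity at `s` is the Euler field, with weights `1, 4/15, 1/3,
2/15` for `t₁, Z, t₃, t₄`. Weighted homogeneity of the Hessian entries then yields the intersection
form, here and in the nine lemmas below. -/
theorem hasDerivAt_pot11 (ha : HasDerivAt a (a s) s) (hz : HasDerivAt z (4 / 15 * z s) s)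
    (hb : HasDerivAt b (1 / 3 * b s) s) (hc : HasDerivAt c (2 / 15 * c s) s) :
    HasDerivAt (fun s => pot11 (a s) (z s) (b s) (c s))
      (inter44 (a s) (z s) (b s) (c s)) s := by
  simpa only [pot11, inter44] using hc

theorem hasDerivAt_pot12 (ha : HasDerivAt a (a s) s) (hz : HasDerivAt z (4 / 15 * z s) s)
    (hb : HasDerivAt b (1 / 3 * b s) s) (hc : HasDerivAt c (2 / 15 * c s) s) :
    HasDerivAt (fun s => pot12 (a s) (z s) (b s) (c s))
      (inter34 (a s) (z s) (b s) (c s)) s := by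
  simpa only [pot12, inter34] using hb

theorem hasDerivAt_pot13 (ha : HasDerivAt a (a s) s) (hz : HasDerivAt z (4 / 15 * z s) s)
    (hb : HasDerivAt b (1 / 3 * b s) s) (hc : HasDerivAt c (2 / 15 * c s) s) :
    HasDerivAt (fun s => pot13 (a s) (z s) (b s) (c s))
      (inter24 (a s) (z s) (b s) (c s)) s := by
  unfold pot13
  apply HasDerivAt.congr_deriv
  · with_reducible repeat' first
      | exact ha | exact hz | exact hb | exact hc | exact hasDerivAt_const _ _
      | apply HasDerivAt.fun_add | apply HasDerivAt.fun_sub | apply HasDerivAt.fun_mul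
      | apply HasDerivAt.fun_pow | apply HasDerivAt.fun_neg
  · simp only [inter24, Nat.cast_ofNat, Nat.add_one_sub_one, Nat.reduceSub, pow_one]
    ring

theorem hasDerivAt_pot14 (ha : HasDerivAt a (a s) s) (hz : HasDerivAt z (4 / 15 * z s) s)
    (hb : HasDerivAt b (1 / 3 * b s) s) (hc : HasDerivAt c (2 / 15 * c s) s) :
    HasDerivAt (fun s => pot14 (a s) (z s) (b s) (c s))
      (inter14 (a s) (z s) (b s) (c s)) s := by
  simpa only [pot14, inter14] using ha

theorem hasDerivAt_pot22 (ha : HasDerivAt a (a s) s) (hz : HasDerivAt z (4 / 15 * z s) s)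
    (hb : HasDerivAt b (1 / 3 * b s) s) (hc : HasDerivAt c (2 / 15 * c s) s) :
    HasDerivAt (fun s => pot22 (a s) (z s) (b s) (c s))
      (inter33 (a s) (z s) (b s) (c s)) s := by
  unfold pot22
  apply HasDerivAt.congr_deriv
  · with_reducible repeat' first
      | exact ha | exact hz | exact hb | exact hc | exact hasDerivAt_const _ _
      | apply HasDerivAt.fun_add | apply HasDerivAt.fun_sub | apply HasDerivAt.fun_mul
      | apply HasDerivAt.fun_pow | apply HasDerivAt.fun_neg
  · simp only [inter33, Nat.cast_ofNat, Nat.add_one_sub_one, Nat.reduceSub, pow_one]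
    ring

theorem hasDerivAt_pot23 (ha : HasDerivAt a (a s) s) (hz : HasDerivAt z (4 / 15 * z s) s)
    (hb : HasDerivAt b (1 / 3 * b s) s) (hc : HasDerivAt c (2 / 15 * c s) s) :
    HasDerivAt (fun s => pot23 (a s) (z s) (b s) (c s))
      (inter23 (a s) (z s) (b s) (c s)) s := by
  unfold pot23
  apply HasDerivAt.congr_deriv
  · with_reducible repeat' first
      | exact ha | exact hz | exact hb | exact hc | exact hasDerivAt_const _ _
      | apply HasDerivAt.fun_add | apply HasDerivAt.fun_sub | apply HasDerivAt.fun_mul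
      | apply HasDerivAt.fun_pow | apply HasDerivAt.fun_neg
  · simp only [inter23, Nat.cast_ofNat, Nat.add_one_sub_one, Nat.reduceSub, pow_one]
    ring

theorem hasDerivAt_pot24 (ha : HasDerivAt a (a s) s) (hz : HasDerivAt z (4 / 15 * z s) s)
    (hb : HasDerivAt b (1 / 3 * b s) s) (hc : HasDerivAt c (2 / 15 * c s) s) :
    HasDerivAt (fun s => pot24 (a s) (z s) (b s) (c s))
      (inter13 (a s) (z s) (b s) (c s)) s := by
  unfold pot24
  apply HasDerivAt.congr_deriv
  · with_reducible repeat' first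
      | exact ha | exact hz | exact hb | exact hc | exact hasDerivAt_const _ _
      | apply HasDerivAt.fun_add | apply HasDerivAt.fun_sub | apply HasDerivAt.fun_mul
      | apply HasDerivAt.fun_pow | apply HasDerivAt.fun_neg
  · simp only [inter13, Nat.cast_ofNat, Nat.add_one_sub_one, Nat.reduceSub, pow_one]
    ring

theorem hasDerivAt_pot33 (ha : HasDerivAt a (a s) s) (hz : HasDerivAt z (4 / 15 * z s) s)
    (hb : HasDerivAt b (1 / 3 * b s) s) (hc : HasDerivAt c (2 / 15 * c s) s) :
    HasDerivAt (fun s => pot33 (a s) (z s) (b s) (c s))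
      (inter22 (a s) (z s) (b s) (c s)) s := by
  unfold pot33
  apply HasDerivAt.congr_deriv
  · with_reducible repeat' first
      | exact ha | exact hz | exact hb | exact hc | exact hasDerivAt_const _ _
      | apply HasDerivAt.fun_add | apply HasDerivAt.fun_sub | apply HasDerivAt.fun_mul
      | apply HasDerivAt.fun_pow | apply HasDerivAt.fun_neg
  · simp only [inter22, Nat.cast_ofNat, Nat.add_one_sub_one, Nat.reduceSub, pow_one]
    ring

theorem hasDerivAt_pot34 (ha : HasDerivAt a (a s) s) (hz : HasDerivAt z (4 / 15 * z s) s)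
    (hb : HasDerivAt b (1 / 3 * b s) s) (hc : HasDerivAt c (2 / 15 * c s) s) :
    HasDerivAt (fun s => pot34 (a s) (z s) (b s) (c s))
      (inter12 (a s) (z s) (b s) (c s)) s := by
  unfold pot34
  apply HasDerivAt.congr_deriv
  · with_reducible repeat' first
      | exact ha | exact hz | exact hb | exact hc | exact hasDerivAt_const _ _
      | apply HasDerivAt.fun_add | apply HasDerivAt.fun_sub | apply HasDerivAt.fun_mul
      | apply HasDerivAt.fun_pow | apply HasDerivAt.fun_neg
  · simp only [inter12, Nat.cast_ofNat, Nat.add_one_sub_one, Nat.reduceSub, pow_one]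
    ring

theorem hasDerivAt_pot44 (ha : HasDerivAt a (a s) s) (hz : HasDerivAt z (4 / 15 * z s) s)
    (hb : HasDerivAt b (1 / 3 * b s) s) (hc : HasDerivAt c (2 / 15 * c s) s) :
    HasDerivAt (fun s => pot44 (a s) (z s) (b s) (c s))
      (inter11 (a s) (z s) (b s) (c s)) s := by
  unfold pot44
  apply HasDerivAt.congr_deriv
  · with_reducible repeat' first
      | exact ha | exact hz | exact hb | exact hc | exact hasDerivAt_const _ _
      | apply HasDerivAt.fun_add | apply HasDerivAt.fun_sub | apply HasDerivAt.fun_mul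
      | apply HasDerivAt.fun_pow | apply HasDerivAt.fun_neg
  · simp only [inter11, Nat.cast_ofNat, Nat.add_one_sub_one, Nat.reduceSub, pow_one]
    ring

end Curve

/-! ### The intersection form in the coordinates given by the formulas for the invariants -/

/-- The counterpart of `metric_inv1_inv1` on the Frobenius side, with the same polynomial on the
right. The variables `a, z, b, c` are free because `t₂` has been eliminated, so no use of the cubic
is needed. -/
theorem inter_form1_form1 (a z b c : ℂ) :
    form1Grad a z b c ⬝ᵥ (inter a z b c).mulVec (form1Grad a z b c) =
      160 * form1 a z b c * form2 a z b c * form4 a z b c ^ 4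
      + 240 * form1 a z b c * form3 a z b c ^ 2 * form4 a z b c ^ 2
      + 96 * form2 a z b c ^ 2 * form3 a z b c * form4 a z b c ^ 3
      + (928/3) * form2 a z b c * form3 a z b c ^ 3 * form4 a z b c := by
  simp only [Matrix.mulVec, dotProduct, Fin.sum_univ_four, inter, form1Grad, Matrix.of_apply,
    Matrix.cons_val]
  simp only [inter11, inter12, inter13, inter14, inter22, inter23, inter24, inter33, inter34, inter44, form1, form2, form3, form4]
  ring

theorem inter_form1_form2 (a z b c : ℂ) :
    form1Grad a z b c ⬝ᵥ (inter a z b c).mulVec (form2Grad a z b c) =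
      -120 * form1 a z b c * form3 a z b c * form4 a z b c ^ 3
      + 48 * form2 a z b c ^ 2 * form4 a z b c ^ 4
      - 112 * form2 a z b c * form3 a z b c ^ 2 * form4 a z b c ^ 2 - 32 * form3 a z b c ^ 4 := by
  simp only [Matrix.mulVec, dotProduct, Fin.sum_univ_four, inter, form1Grad, form2Grad, Matrix.of_apply,
    Matrix.cons_val]
  simp only [inter11, inter12, inter13, inter14, inter22, inter23, inter24, inter33, inter34, inter44, form1, form2, form3, form4]
  ring

theorem inter_form1_form3 (a z b c : ℂ) :
    form1Grad a z b c ⬝ᵥ (inter a z b c).mulVec (form3Grad a z b c) =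
      -40 * form1 a z b c * form4 a z b c ^ 5 - 80 * form2 a z b c ^ 2
      - 16 * form2 a z b c * form3 a z b c * form4 a z b c ^ 4
      - (16/3) * form3 a z b c ^ 3 * form4 a z b c ^ 2 := by
  simp only [Matrix.mulVec, dotProduct, Fin.sum_univ_four, inter, form1Grad, form3Grad, Matrix.of_apply,
    Matrix.cons_val]
  simp only [inter12, inter13, inter14, inter22, inter23, inter24, inter33, inter34, inter44, form1, form2, form3, form4]
  ring

theorem inter_form1_form4 (a z b c : ℂ) :
    form1Grad a z b c ⬝ᵥ (inter a z b c).mulVec (form4Grad a z b c) =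
      60 * form1 a z b c := by
  simp only [Matrix.mulVec, dotProduct, Fin.sum_univ_four, inter, form1Grad, form4Grad, Matrix.of_apply,
    Matrix.cons_val]
  simp only [inter14, inter24, inter34, inter44, form1]
  ring

theorem inter_form2_form2 (a z b c : ℂ) :
    form2Grad a z b c ⬝ᵥ (inter a z b c).mulVec (form2Grad a z b c) =
      20 * form1 a z b c * form4 a z b c ^ 4
      - 56 * form2 a z b c * form3 a z b c * form4 a z b c ^ 3
      + (152/3) * form3 a z b c ^ 3 * form4 a z b c := by
  simp only [Matrix.mulVec, dotProduct, Fin.sum_univ_four, inter, form2Grad, Matrix.of_apply,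
    Matrix.cons_val]
  simp only [inter11, inter12, inter13, inter14, inter22, inter23, inter24, inter33, inter34, inter44, form1, form2, form3, form4]
  ring

theorem inter_form2_form3 (a z b c : ℂ) :
    form2Grad a z b c ⬝ᵥ (inter a z b c).mulVec (form3Grad a z b c) =
      -30 * form1 a z b c - 24 * form2 a z b c * form4 a z b c ^ 5
      + 8 * form3 a z b c ^ 2 * form4 a z b c ^ 3 := by
  simp only [Matrix.mulVec, dotProduct, Fin.sum_univ_four, inter, form2Grad, form3Grad, Matrix.of_apply,
    Matrix.cons_val]
  simp only [inter12, inter13, inter14, inter22, inter23, inter24, inter33, inter34, inter44, form1, form2, form3, form4]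
  ring

theorem inter_form2_form4 (a z b c : ℂ) :
    form2Grad a z b c ⬝ᵥ (inter a z b c).mulVec (form4Grad a z b c) =
      40 * form2 a z b c := by
  simp only [Matrix.mulVec, dotProduct, Fin.sum_univ_four, inter, form2Grad, form4Grad, Matrix.of_apply,
    Matrix.cons_val]
  simp only [inter14, inter24, inter34, inter44, form2]
  ring

theorem inter_form3_form3 (a z b c : ℂ) :
    form3Grad a z b c ⬝ᵥ (inter a z b c).mulVec (form3Grad a z b c) =
      44 * form2 a z b c * form4 a z b c - 8 * form3 a z b c * form4 a z b c ^ 5 := by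
  simp only [Matrix.mulVec, dotProduct, Fin.sum_univ_four, inter, form3Grad, Matrix.of_apply,
    Matrix.cons_val]
  simp only [inter22, inter23, inter24, inter33, inter34, inter44, form2, form3, form4]
  ring

theorem inter_form3_form4 (a z b c : ℂ) :
    form3Grad a z b c ⬝ᵥ (inter a z b c).mulVec (form4Grad a z b c) =
      24 * form3 a z b c := by
  simp only [Matrix.mulVec, dotProduct, Fin.sum_univ_four, inter, form3Grad, form4Grad, Matrix.of_apply,
    Matrix.cons_val]
  simp only [inter24, inter34, inter44, form3]
  ring

theorem inter_form4_form4 (a z b c : ℂ) :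
    form4Grad a z b c ⬝ᵥ (inter a z b c).mulVec (form4Grad a z b c) =
      4 * form4 a z b c := by
  simp only [Matrix.mulVec, dotProduct, Fin.sum_univ_four, inter, form4Grad, Matrix.of_apply,
    Matrix.cons_val]
  simp only [inter44, form4]
  ring

end H42

end

noncomputable section

namespace H42

open AlgFrobenius

variable {U : Set (Fin 4 → ℂ)} {Z : (Fin 4 → ℂ) → ℂ} {t : Fin 4 → ℂ}

/-! ### The branch `Z` -/

theorem t2_eq (hP : ∀ t ∈ U, cubicP (t 1) (t 2) (t 3) (Z t) = 0) (ht : t ∈ U) :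
    t 1 = Z t ^ 3 - 12 * t 3 ^ 4 * Z t - 11 * t 3 ^ 6 + (27 / 4) * t 2 ^ 2 * t 3 := by
  have := hP t ht
  rw [cubicP] at this
  linear_combination -this

/-- Implicit differentiation of the cubic in the direction `v`, left in product form because `discZ`
is not yet known to be nonzero. -/
theorem sum_partialD_Z_mul_discZ (hU : IsOpen U) (hZ : DifferentiableOn ℂ Z U)
    (hP : ∀ t ∈ U, cubicP (t 1) (t 2) (t 3) (Z t) = 0) (ht : t ∈ U) (v : Fin 4 → ℂ) :
    (∑ k, v k * partialD k Z t) * discZ (Z t) (t 3) = ∑ k, v k * numZ (Z t) (t 2) (t 3) k := by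
  have hz := hasDerivAt_direction (hZ.differentiableAt (hU.mem_nhds ht)) v
  have he := hasDerivAt_direction_apply t v 1
  have hb := hasDerivAt_direction_apply t v 2
  have hc := hasDerivAt_direction_apply t v 3
  set z' := ∑ k, v k * partialD k Z t
  have h1 : HasDerivAt (fun s : ℂ => cubicP ((t + s • v) 1) ((t + s • v) 2) ((t + s • v) 3)
      (Z (t + s • v))) (z' * discZ (Z t) (t 3) - ∑ k, v k * numZ (Z t) (t 2) (t 3) k) 0 := by
    unfold cubicP
    apply HasDerivAt.congr_deriv
    · with_reducible repeat' first
        | exact he | exact hz | exact hb | exact hc | exact hasDerivAt_const _ _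
        | apply HasDerivAt.fun_add | apply HasDerivAt.fun_sub | apply HasDerivAt.fun_mul
        | apply HasDerivAt.fun_pow
    · simp only [Nat.cast_ofNat, Nat.add_one_sub_one, Nat.reduceSub, pow_one, zero_smul, add_zero,
        Fin.sum_univ_four, numZ, discZ, Matrix.cons_val]
      ring
  have h2 : HasDerivAt (fun s : ℂ => cubicP ((t + s • v) 1) ((t + s • v) 2) ((t + s • v) 3)
      (Z (t + s • v))) 0 0 := by
    refine (hasDerivAt_const (0 : ℂ) (0 : ℂ)).congr_of_eventuallyEq ?_
    have hcont : Tendsto (fun s : ℂ => t + s • v) (𝓝 0) (𝓝 t) := by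
      have : Continuous fun s : ℂ => t + s • v := by fun_prop
      simpa using this.tendsto 0
    filter_upwards [hcont.eventually (hU.mem_nhds ht)] with s hs using hP _ hs
  exact sub_eq_zero.1 (h1.unique h2)

theorem partialD_Z_mul_discZ (hU : IsOpen U) (hZ : DifferentiableOn ℂ Z U)
    (hP : ∀ t ∈ U, cubicP (t 1) (t 2) (t 3) (Z t) = 0) (ht : t ∈ U) (l : Fin 4) :
    partialD l Z t * discZ (Z t) (t 3) = numZ (Z t) (t 2) (t 3) l := by
  have := sum_partialD_Z_mul_discZ hU hZ hP ht (Pi.single l 1)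
  simpa [Pi.single_apply] using this

/-- Holomorphy of the branch excludes double roots: differentiating the cubic in `t₂` gives `∂Z/∂t₂
· discZ = 1`. -/
theorem discZ_ne_zero (hU : IsOpen U) (hZ : DifferentiableOn ℂ Z U)
    (hP : ∀ t ∈ U, cubicP (t 1) (t 2) (t 3) (Z t) = 0) (ht : t ∈ U) :
    discZ (Z t) (t 3) ≠ 0 := by
  intro h
  have := partialD_Z_mul_discZ hU hZ hP ht 1
  rw [h] at this
  simp [numZ] at this

/-- The Euler vector field. -/
def euler (t : Fin 4 → ℂ) : Fin 4 → ℂ := fun k => deg k * t k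

/-- The cubic is weighted homogeneous of weight `4/5`, so `Z` has a third of that weight. -/
theorem euler_Z (hU : IsOpen U) (hZ : DifferentiableOn ℂ Z U)
    (hP : ∀ t ∈ U, cubicP (t 1) (t 2) (t 3) (Z t) = 0) (ht : t ∈ U) :
    ∑ k, euler t k * partialD k Z t = 4 / 15 * Z t := by
  have h := sum_partialD_Z_mul_discZ hU hZ hP ht (euler t)
  refine mul_right_cancel₀ (discZ_ne_zero hU hZ hP ht) (h.trans ?_)
  simp only [euler, deg, numZ, discZ, Fin.sum_univ_four, Matrix.cons_val, t2_eq hP ht]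
  ring

/-! ### The derivatives of the prepotential -/

theorem hasDerivAt_Z_line (hU : IsOpen U) (hZ : DifferentiableOn ℂ Z U) (ht : t ∈ U) (l : Fin 4) :
    HasDerivAt (fun s : ℂ => Z (t + s • Pi.single l 1)) (partialD l Z t) 0 :=
  hasDerivAt_line (hZ.differentiableAt (hU.mem_nhds ht)) l

/-- The functions that are given by a polynomial in `t₁, Z, t₃, t₄`. -/
def lift (q : ℂ → ℂ → ℂ → ℂ → ℂ) (Z : (Fin 4 → ℂ) → ℂ) (t : Fin 4 → ℂ) : ℂ :=
  q (t 0) (Z t) (t 2) (t 3)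

/-- The first derivatives of the prepotential. -/
def potGrad (k : Fin 4) : ℂ → ℂ → ℂ → ℂ → ℂ := ![pot1, pot2, pot3, pot4] k

/-- The formulas for the basic invariants. -/
def formV (k : Fin 4) : ℂ → ℂ → ℂ → ℂ → ℂ := ![form1, form2, form3, form4] k

/-- The matrix of the derivatives of `formV`. -/
def formJac (a z b c : ℂ) : Matrix (Fin 4) (Fin 4) ℂ :=
  Matrix.of ![form1Grad a z b c, form2Grad a z b c, form3Grad a z b c, form4Grad a z b c]

theorem differentiableOn_lift_pot0 (hZ : DifferentiableOn ℂ Z U) :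
    DifferentiableOn ℂ (lift pot0 Z) U := by
  unfold lift pot0
  fun_prop

theorem differentiableOn_lift_potGrad (hZ : DifferentiableOn ℂ Z U) (k : Fin 4) :
    DifferentiableOn ℂ (lift (potGrad k) Z) U := by
  have h : ∀ k, DifferentiableOn ℂ (lift (![pot1, pot2, pot3, pot4] k) Z) U := by
    simp only [Fin.forall_fin_succ, Matrix.cons_val_zero, Matrix.cons_val_succ, IsEmpty.forall_iff,
      and_true]
    refine ⟨?_, ?_, ?_, ?_⟩
    · unfold lift pot1
      fun_prop
    · unfold lift pot2
      fun_prop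
    · unfold lift pot3
      fun_prop
    · unfold lift pot4
      fun_prop
  exact h k

theorem differentiableOn_lift_formV (hZ : DifferentiableOn ℂ Z U) (k : Fin 4) :
    DifferentiableOn ℂ (lift (formV k) Z) U := by
  have h : ∀ k, DifferentiableOn ℂ (lift (![form1, form2, form3, form4] k) Z) U := by
    simp only [Fin.forall_fin_succ, Matrix.cons_val_zero, Matrix.cons_val_succ, IsEmpty.forall_iff,
      and_true]
    refine ⟨?_, ?_, ?_, ?_⟩
    · unfold lift form1
      fun_prop
    · unfold lift form2
      fun_prop
    · unfold lift form3
      fun_prop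
    · unfold lift form4
      fun_prop
  exact h k

theorem prepot_eqOn (hP : ∀ t ∈ U, cubicP (t 1) (t 2) (t 3) (Z t) = 0) :
    EqOn (prepot Z) (lift pot0 Z) U := by
  intro t ht
  simp only [prepot, prepotPoly, lift, pot0, t2_eq hP ht]
  ring

theorem partialD_pot0 (hU : IsOpen U) (hZ : DifferentiableOn ℂ Z U)
    (hP : ∀ t ∈ U, cubicP (t 1) (t 2) (t 3) (Z t) = 0) (ht : t ∈ U) (l : Fin 4) :
    partialD l (lift pot0 Z) t = lift (potGrad l) Z t := by
  have h := hasDerivAt_pot0 (hasDerivAt_line_apply t l 0) (hasDerivAt_Z_line hU hZ ht l)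
    (hasDerivAt_line_apply t l 2) (hasDerivAt_line_apply t l 3)
    (by simpa using partialD_Z_mul_discZ hU hZ hP ht l)
  refine (partialD_eq_of_hasDerivAt
    ((differentiableOn_lift_pot0 hZ).differentiableAt (hU.mem_nhds ht)) h).trans ?_
  simp only [zero_smul, add_zero, lift, potGrad]
  fin_cases l <;> simp [numZ, pot1, pot2, pot3, pot4] <;> ring

theorem partialD_potGrad (hU : IsOpen U) (hZ : DifferentiableOn ℂ Z U)
    (hP : ∀ t ∈ U, cubicP (t 1) (t 2) (t 3) (Z t) = 0) (ht : t ∈ U) (l k : Fin 4) :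
    partialD l (lift (potGrad k) Z) t = lift (fun a z b c => hess a z b c l k) Z t := by
  have hd := (differentiableOn_lift_potGrad hZ k).differentiableAt (hU.mem_nhds ht)
  have l0 := hasDerivAt_line_apply t l 0
  have lz := hasDerivAt_Z_line hU hZ ht l
  have l2 := hasDerivAt_line_apply t l 2
  have l3 := hasDerivAt_line_apply t l 3
  have hn : partialD l Z t * discZ (Z (t + (0 : ℂ) • Pi.single l 1))
      ((t + (0 : ℂ) • (Pi.single l 1 : Fin 4 → ℂ)) 3) = numZ (Z t) (t 2) (t 3) l := by
    simpa using partialD_Z_mul_discZ hU hZ hP ht l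
  fin_cases k
  · refine (partialD_eq_of_hasDerivAt hd (hasDerivAt_pot1 l0 lz l2 l3 hn)).trans ?_
    simp only [zero_smul, add_zero, lift]
    fin_cases l <;> simp [numZ, hess, pot11, pot12, pot13, pot14] <;> ring
  · refine (partialD_eq_of_hasDerivAt hd (hasDerivAt_pot2 l0 lz l2 l3 hn)).trans ?_
    simp only [zero_smul, add_zero, lift]
    fin_cases l <;> simp [numZ, hess, pot12, pot22, pot23, pot24] <;> ring
  · refine (partialD_eq_of_hasDerivAt hd (hasDerivAt_pot3 l0 lz l2 l3 hn)).trans ?_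
    simp only [zero_smul, add_zero, lift]
    fin_cases l <;> simp [numZ, hess, pot13, pot23, pot33, pot34] <;> ring
  · refine (partialD_eq_of_hasDerivAt hd (hasDerivAt_pot4 l0 lz l2 l3 hn)).trans ?_
    simp only [zero_smul, add_zero, lift]
    fin_cases l <;> simp [numZ, hess, pot14, pot24, pot34, pot44] <;> ring

theorem partialD_formV (hU : IsOpen U) (hZ : DifferentiableOn ℂ Z U)
    (hP : ∀ t ∈ U, cubicP (t 1) (t 2) (t 3) (Z t) = 0) (ht : t ∈ U) (l k : Fin 4) :
    partialD l (lift (formV k) Z) t = lift (fun a z b c => formJac a z b c k l) Z t := by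
  have hd := (differentiableOn_lift_formV hZ k).differentiableAt (hU.mem_nhds ht)
  have l0 := hasDerivAt_line_apply t l 0
  have lz := hasDerivAt_Z_line hU hZ ht l
  have l2 := hasDerivAt_line_apply t l 2
  have l3 := hasDerivAt_line_apply t l 3
  have hn : partialD l Z t * discZ (Z (t + (0 : ℂ) • Pi.single l 1))
      ((t + (0 : ℂ) • (Pi.single l 1 : Fin 4 → ℂ)) 3) = numZ (Z t) (t 2) (t 3) l := by
    simpa using partialD_Z_mul_discZ hU hZ hP ht l
  fin_cases k
  · refine (partialD_eq_of_hasDerivAt hd (hasDerivAt_form1 l0 lz l2 l3 hn)).trans ?_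
    simp only [zero_smul, add_zero, lift]
    fin_cases l <;> simp [numZ, formJac, form1Grad] <;> ring
  · refine (partialD_eq_of_hasDerivAt hd (hasDerivAt_form2 l0 lz l2 l3 hn)).trans ?_
    simp only [zero_smul, add_zero, lift]
    fin_cases l <;> simp [numZ, formJac, form2Grad] <;> ring
  · refine (partialD_eq_of_hasDerivAt hd (hasDerivAt_form3 l0 lz l2 l3 hn)).trans ?_
    simp only [zero_smul, add_zero, lift]
    fin_cases l <;> simp [numZ, formJac, form3Grad] <;> ring
  · refine (partialD_eq_of_hasDerivAt hd (hasDerivAt_form4 l0 lz l2 l3 hn)).trans ?_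
    simp only [zero_smul, add_zero, lift]
    fin_cases l <;> simp [formJac, form4Grad]

end H42

end

noncomputable section

namespace H42

open AlgFrobenius

variable {U : Set (Fin 4 → ℂ)} {Z : (Fin 4 → ℂ) → ℂ} {t : Fin 4 → ℂ}

/-! ### The intersection form -/

theorem hasDerivAt_hess {a z b c : ℂ → ℂ} {s : ℂ}
    (ha : HasDerivAt a (a s) s) (hz : HasDerivAt z (4 / 15 * z s) s)
    (hb : HasDerivAt b (1 / 3 * b s) s) (hc : HasDerivAt c (2 / 15 * c s) s) (l m : Fin 4) :
    HasDerivAt (fun s => hess (a s) (z s) (b s) (c s) l m)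
      (inter (a s) (z s) (b s) (c s) l.rev m.rev) s := by
  have hrev : ∀ (x11 x12 x13 x14 x22 x23 x24 x33 x34 x44 : ℂ) (l m : Fin 4),
      !![x11, x12, x13, x14; x12, x22, x23, x24; x13, x23, x33, x34; x14, x24, x34, x44]
        l.rev m.rev =
      !![x44, x34, x24, x14; x34, x33, x23, x13; x24, x23, x22, x12; x14, x13, x12, x11] l m := by
    intro x11 x12 x13 x14 x22 x23 x24 x33 x34 x44 l m
    fin_cases l <;> fin_cases m <;> rfl
  have h12 := hasDerivAt_pot12 ha hz hb hc
  have h13 := hasDerivAt_pot13 ha hz hb hc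
  have h14 := hasDerivAt_pot14 ha hz hb hc
  have h23 := hasDerivAt_pot23 ha hz hb hc
  have h24 := hasDerivAt_pot24 ha hz hb hc
  have h34 := hasDerivAt_pot34 ha hz hb hc
  rw [inter, hrev]
  revert l m
  simp only [Fin.forall_fin_succ, hess, Matrix.of_apply, Matrix.cons_val_zero,
    Matrix.cons_val_succ, IsEmpty.forall_iff, and_true]
  exact ⟨⟨hasDerivAt_pot11 ha hz hb hc, h12, h13, h14⟩,
    ⟨h12, hasDerivAt_pot22 ha hz hb hc, h23, h24⟩,
    ⟨h13, h23, hasDerivAt_pot33 ha hz hb hc, h34⟩, ⟨h14, h24, h34, hasDerivAt_pot44 ha hz hb hc⟩⟩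

theorem hess_symm (a z b c : ℂ) (l m : Fin 4) : hess a z b c l m = hess a z b c m l := by
  revert l m
  simp [Fin.forall_fin_succ, hess]

theorem partialD_prepot (hU : IsOpen U) (hZ : DifferentiableOn ℂ Z U)
    (hP : ∀ t ∈ U, cubicP (t 1) (t 2) (t 3) (Z t) = 0) (l : Fin 4) :
    EqOn (partialD l (prepot Z)) (lift (potGrad l) Z) U := fun _ ht =>
  (partialD_congr hU (prepot_eqOn hP) ht l).trans (partialD_pot0 hU hZ hP ht l)

theorem partialD_partialD_prepot (hU : IsOpen U) (hZ : DifferentiableOn ℂ Z U)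
    (hP : ∀ t ∈ U, cubicP (t 1) (t 2) (t 3) (Z t) = 0) (l m : Fin 4) :
    EqOn (partialD l (partialD m (prepot Z))) (lift (fun a z b c => hess a z b c l m) Z) U :=
  fun _ ht => (partialD_congr hU (partialD_prepot hU hZ hP m) ht l).trans
    (partialD_potGrad hU hZ hP ht l m)

theorem cLow_prepot (hU : IsOpen U) (hZ : DifferentiableOn ℂ Z U)
    (hP : ∀ t ∈ U, cubicP (t 1) (t 2) (t 3) (Z t) = 0) (ht : t ∈ U) (l m k : Fin 4) :
    cLow (prepot Z) t l m k = partialD l (lift (fun a z b c => hess a z b c m k) Z) t :=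
  partialD_congr hU (partialD_partialD_prepot hU hZ hP m k) ht l

theorem differentiableOn_lift_hess (hU : IsOpen U) (hZ : DifferentiableOn ℂ Z U)
    (hP : ∀ t ∈ U, cubicP (t 1) (t 2) (t 3) (Z t) = 0) (l m : Fin 4) :
    DifferentiableOn ℂ (lift (fun a z b c => hess a z b c l m) Z) U :=
  (differentiableOn_fderiv_apply hU (differentiableOn_lift_potGrad hZ m) (Pi.single l 1)).congr
    fun _ ht => (partialD_potGrad hU hZ hP ht l m).symm

/-- Symmetry of third derivatives moves the index `k` to the outermost derivative, so that
contraction with `E` becomes a directional derivative of a Hessian entry. -/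
theorem cLow_prepot_swap (hU : IsOpen U) (hZ : DifferentiableOn ℂ Z U)
    (hP : ∀ t ∈ U, cubicP (t 1) (t 2) (t 3) (Z t) = 0) (ht : t ∈ U) (l m k : Fin 4) :
    cLow (prepot Z) t l m k = partialD k (lift (fun a z b c => hess a z b c l m) Z) t := by
  have h1 : partialD l (lift (fun a z b c => hess a z b c m k) Z) t =
      partialD l (partialD k (lift (potGrad m) Z)) t :=
    partialD_congr hU (fun s hs => by
      rw [partialD_potGrad hU hZ hP hs]
      exact hess_symm _ _ _ _ _ _) ht l
  rw [cLow_prepot hU hZ hP ht, h1, partialD_comm hU (differentiableOn_lift_potGrad hZ m) ht]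
  exact partialD_congr hU (fun s hs => partialD_potGrad hU hZ hP hs l m) ht k

theorem sum_euler_cLow (hU : IsOpen U) (hZ : DifferentiableOn ℂ Z U)
    (hP : ∀ t ∈ U, cubicP (t 1) (t 2) (t 3) (Z t) = 0) (ht : t ∈ U) (l m : Fin 4) :
    ∑ k, euler t k * cLow (prepot Z) t l m k =
      inter (t 0) (Z t) (t 2) (t 3) l.rev m.rev := by
  simp only [cLow_prepot_swap hU hZ hP ht]
  have h := hasDerivAt_direction ((differentiableOn_lift_hess hU hZ hP l m).differentiableAt
    (hU.mem_nhds ht)) (euler t)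
  have hz := hasDerivAt_direction (hZ.differentiableAt (hU.mem_nhds ht)) (euler t)
  rw [euler_Z hU hZ hP ht] at hz
  -- Only the velocity at `s = 0` matters, so the straight line `t + s • euler t` serves instead of
  -- the Euler flow.
  have key := hasDerivAt_hess
    (a := fun s : ℂ => (t + s • euler t) 0) (z := fun s : ℂ => Z (t + s • euler t))
    (b := fun s : ℂ => (t + s • euler t) 2) (c := fun s : ℂ => (t + s • euler t) 3) (s := 0)
    (by simpa [euler, deg] using hasDerivAt_direction_apply t (euler t) 0) (by simpa using hz)
    (by simpa [euler, deg] using hasDerivAt_direction_apply t (euler t) 2)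
    (by simpa [euler, deg] using hasDerivAt_direction_apply t (euler t) 3) l m
  refine (h.unique key).trans ?_
  simp only [zero_smul, add_zero]

/-- The first column of the Hessian is `(t₄, t₃, t₂, t₁)`, whose derivatives give the constant
antidiagonal matrix; the entry `t₂` is where the cubic is used. -/
theorem eta_prepot (hU : IsOpen U) (hZ : DifferentiableOn ℂ Z U)
    (hP : ∀ t ∈ U, cubicP (t 1) (t 2) (t 3) (Z t) = 0) (ht : t ∈ U) :
    eta (prepot Z) t = Matrix.of fun i j => if j = i.rev then 1 else 0 := by
  have h0 : EqOn (lift (fun a z b c => hess a z b c 0 0) Z) (fun s => s 3) U := fun s _ => by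
    simp [lift, hess, pot11]
  have h1 : EqOn (lift (fun a z b c => hess a z b c 1 0) Z) (fun s => s 2) U := fun s _ => by
    simp [lift, hess, pot12]
  have h2 : EqOn (lift (fun a z b c => hess a z b c 2 0) Z) (fun s => s 1) U := fun s hs => by
    simp only [lift, hess, pot13, t2_eq hP hs, Matrix.of_apply, Matrix.cons_val]
    ring
  have h3 : EqOn (lift (fun a z b c => hess a z b c 3 0) Z) (fun s => s 0) U := fun s _ => by
    simp [lift, hess, pot14]
  ext i j
  rw [eta, Matrix.of_apply, Matrix.of_apply, cLow_prepot hU hZ hP ht]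
  fin_cases j
  · exact ((partialD_congr hU h0 ht i).trans (partialD_apply i 3)).trans
      (by fin_cases i <;> simp [Fin.ext_iff])
  · exact ((partialD_congr hU h1 ht i).trans (partialD_apply i 2)).trans
      (by fin_cases i <;> simp [Fin.ext_iff])
  · exact ((partialD_congr hU h2 ht i).trans (partialD_apply i 1)).trans
      (by fin_cases i <;> simp [Fin.ext_iff])
  · exact ((partialD_congr hU h3 ht i).trans (partialD_apply i 0)).trans
      (by fin_cases i <;> simp [Fin.ext_iff])

theorem eta_prepot_inv (hU : IsOpen U) (hZ : DifferentiableOn ℂ Z U)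
    (hP : ∀ t ∈ U, cubicP (t 1) (t 2) (t 3) (Z t) = 0) (ht : t ∈ U) :
    (eta (prepot Z) t)⁻¹ = Matrix.of fun i j => if j = i.rev then 1 else 0 := by
  rw [eta_prepot hU hZ hP ht]
  apply Matrix.inv_eq_left_inv
  ext i j
  simp only [Matrix.mul_apply, Matrix.of_apply, Matrix.one_apply, ite_mul, one_mul, zero_mul,
    Finset.sum_ite_eq', Finset.mem_univ, if_true, Fin.rev_rev, eq_comm (a := j)]

theorem interForm_prepot (hU : IsOpen U) (hZ : DifferentiableOn ℂ Z U)
    (hP : ∀ t ∈ U, cubicP (t 1) (t 2) (t 3) (Z t) = 0) (ht : t ∈ U) :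
    interForm (prepot Z) deg t = inter (t 0) (Z t) (t 2) (t 3) := by
  ext i j
  have h := sum_euler_cLow hU hZ hP ht i.rev j.rev
  rw [Fin.rev_rev, Fin.rev_rev] at h
  simp [interForm, cUp, eta_prepot_inv hU hZ hP ht, ← h, euler]

/-- The Euler field is the `g`-gradient of `t₄`. Since `t₄` is proportional to `x ⬝ x`, this makes
the Euler condition on flat coordinates automatic. -/
theorem interForm_prepot_three (hU : IsOpen U) (hZ : DifferentiableOn ℂ Z U)
    (hP : ∀ t ∈ U, cubicP (t 1) (t 2) (t 3) (Z t) = 0) (ht : t ∈ U) (l : Fin 4) :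
    interForm (prepot Z) deg t l 3 = deg l * t l := by
  rw [interForm_prepot hU hZ hP ht]
  fin_cases l
  · simp [inter, inter14, deg]
  · have := t2_eq hP ht
    simp only [inter, inter24, deg, Matrix.of_apply, Matrix.cons_val, Fin.mk_one, this]
    ring
  · simp [inter, inter34, deg]
  · simp [inter, inter44, deg]

/-! ### The formulas for the basic invariants -/

/-- The formulas for the basic invariants as a map. -/
def formMap (Z : (Fin 4 → ℂ) → ℂ) (t : Fin 4 → ℂ) : Fin 4 → ℂ := fun k => lift (formV k) Z t

theorem differentiableOn_formMap (hZ : DifferentiableOn ℂ Z U) :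
    DifferentiableOn ℂ (formMap Z) U :=
  differentiableOn_pi.2 fun k => differentiableOn_lift_formV hZ k

theorem jac_formMap (hU : IsOpen U) (hZ : DifferentiableOn ℂ Z U)
    (hP : ∀ t ∈ U, cubicP (t 1) (t 2) (t 3) (Z t) = 0) (ht : t ∈ U) :
    jac (formMap Z) t = formJac (t 0) (Z t) (t 2) (t 3) := by
  ext k l
  exact partialD_formV hU hZ hP ht l k

theorem relations_iff (hP : ∀ t ∈ U, cubicP (t 1) (t 2) (t 3) (Z t) = 0) (ht : t ∈ U)
    (x : Fin 4 → ℂ) : Relations x t (Z t) ↔ invMap x = formMap Z t := by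
  have h1 : y1Formula (t 0) (t 1) (t 2) (t 3) (Z t) = form1 (t 0) (Z t) (t 2) (t 3) := by
    simp only [y1Formula, form1, t2_eq hP ht]
    ring
  have h2 : y2Formula (t 0) (t 1) (t 2) (t 3) (Z t) = form2 (t 0) (Z t) (t 2) (t 3) := by
    simp only [y2Formula, form2, t2_eq hP ht]
    ring
  have h3 : y3Formula (t 1) (t 2) (t 3) = form3 (t 0) (Z t) (t 2) (t 3) := by
    simp only [y3Formula, form3, t2_eq hP ht]
    ring
  have h4 : y4Formula (t 3) = form4 (t 0) (Z t) (t 2) (t 3) := rfl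
  rw [Relations, h1, h2, h3, h4, funext_iff]
  simp only [Fin.forall_fin_succ, invMap, formMap, lift, formV, Matrix.cons_val_zero,
    Matrix.cons_val_succ, IsEmpty.forall_iff, and_true]

theorem inter_symm (a z b c : ℂ) : (inter a z b c).transpose = inter a z b c := by
  ext l m
  revert l m
  simp [Fin.forall_fin_succ, inter]

theorem formJac_mul_inter_mul_transpose (a z b c : ℂ) :
    formJac a z b c * inter a z b c * (formJac a z b c).transpose =
      orbitMetric ![form1 a z b c, form2 a z b c, form3 a z b c, form4 a z b c] := by
  have hs : ∀ v w : Fin 4 → ℂ,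
      v ⬝ᵥ (inter a z b c).mulVec w = w ⬝ᵥ (inter a z b c).mulVec v := fun v w => by
    rw [Matrix.dotProduct_mulVec, dotProduct_comm, ← Matrix.mulVec_transpose, inter_symm]
  have h : ∀ k l, (formJac a z b c * inter a z b c * (formJac a z b c).transpose) k l =
      ![form1Grad a z b c, form2Grad a z b c, form3Grad a z b c, form4Grad a z b c] k ⬝ᵥ
        (inter a z b c).mulVec
          (![form1Grad a z b c, form2Grad a z b c, form3Grad a z b c, form4Grad a z b c] l) := by
    intro k l
    rw [formJac]
    generalize ![form1Grad a z b c, form2Grad a z b c, form3Grad a z b c, form4Grad a z b c] = M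
    generalize inter a z b c = G
    simp only [Matrix.mul_apply, Matrix.mulVec, dotProduct, Matrix.transpose_apply,
      Matrix.of_apply, Fin.sum_univ_four]
    ring
  ext k l
  rw [h]
  revert k l
  simp only [Fin.forall_fin_succ, orbitMetric, Matrix.of_apply, Matrix.cons_val_zero,
    Matrix.cons_val_succ, Matrix.cons_val, IsEmpty.forall_iff, and_true]
  exact ⟨⟨inter_form1_form1 a z b c, inter_form1_form2 a z b c, inter_form1_form3 a z b c,
      inter_form1_form4 a z b c⟩,
    ⟨(hs _ _).trans (inter_form1_form2 a z b c), inter_form2_form2 a z b c,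
      inter_form2_form3 a z b c, inter_form2_form4 a z b c⟩,
    ⟨(hs _ _).trans (inter_form1_form3 a z b c), (hs _ _).trans (inter_form2_form3 a z b c),
      inter_form3_form3 a z b c, inter_form3_form4 a z b c⟩,
    ⟨(hs _ _).trans (inter_form1_form4 a z b c), (hs _ _).trans (inter_form2_form4 a z b c),
      (hs _ _).trans (inter_form3_form4 a z b c), inter_form4_form4 a z b c⟩⟩

theorem jac_formMap_mul_inter_mul_transpose (hU : IsOpen U) (hZ : DifferentiableOn ℂ Z U)
    (hP : ∀ t ∈ U, cubicP (t 1) (t 2) (t 3) (Z t) = 0) (ht : t ∈ U) :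
    jac (formMap Z) t * interForm (prepot Z) deg t * (jac (formMap Z) t).transpose =
      orbitMetric (formMap Z t) := by
  rw [jac_formMap hU hZ hP ht, interForm_prepot hU hZ hP ht, formJac_mul_inter_mul_transpose]
  congr 1
  ext k
  revert k
  simp [Fin.forall_fin_succ, formMap, lift, formV]

end H42

end

noncomputable section

/-! ### Chain rule for Jacobi matrices and consequences of flatness -/

namespace AlgFrobenius

variable {U : Set (Fin 4 → ℂ)} {t : Fin 4 → ℂ}

theorem jac_comp {f g : (Fin 4 → ℂ) → Fin 4 → ℂ} (hf : DifferentiableAt ℂ f (g t))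
    (hg : DifferentiableAt ℂ g t) : jac (f ∘ g) t = jac f (g t) * jac g t := by
  refine Matrix.mulVec_injective (funext fun v => ?_)
  rw [← Matrix.mulVec_mulVec, ← H42.fderiv_apply_eq_jac_mulVec hg,
    ← H42.fderiv_apply_eq_jac_mulVec hf, ← H42.fderiv_apply_eq_jac_mulVec (hf.comp t hg),
    fderiv_comp t hf hg]
  rfl

theorem jac_congr {f g : (Fin 4 → ℂ) → Fin 4 → ℂ} (hU : IsOpen U) (h : EqOn f g U)
    (ht : t ∈ U) : jac f t = jac g t := by
  ext a l
  exact partialD_congr hU (fun s hs => congrFun (h hs) a) ht l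

theorem jac_id : jac (fun s => s) t = 1 := by
  ext a l
  rw [jac_apply, partialD_apply, Matrix.one_apply, Pi.single_apply]

theorem jac_mul_interForm_apply (F : (Fin 4 → ℂ) → ℂ) (deg : Fin 4 → ℂ)
    (x : (Fin 4 → ℂ) → Fin 4 → ℂ) (a b : Fin 4) :
    ∑ l : Fin 4, ∑ m : Fin 4, interForm F deg t l m *
      partialD l (fun s => x s a) t * partialD m (fun s => x s b) t =
    (jac x t * interForm F deg t * (jac x t).transpose) a b := by
  simp only [Matrix.mul_apply, Matrix.transpose_apply, jac_apply, Finset.sum_mul]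
  rw [Finset.sum_comm]
  refine Finset.sum_congr rfl fun m _ => Finset.sum_congr rfl fun l _ => ?_
  rw [mul_comm (interForm F deg t l m)]

theorem IsFlatCoordinates.jac_mul {F : (Fin 4 → ℂ) → ℂ} {deg : Fin 4 → ℂ} {d : ℂ}
    {x : (Fin 4 → ℂ) → Fin 4 → ℂ} (h : IsFlatCoordinates F deg d U x) (ht : t ∈ U) :
    jac x t * interForm F deg t * (jac x t).transpose = 1 := by
  ext a b
  rw [← jac_mul_interForm_apply, h.2.1 t ht, Matrix.one_apply]

theorem IsFlatCoordinates.det_jac_ne_zero {F : (Fin 4 → ℂ) → ℂ} {deg : Fin 4 → ℂ} {d : ℂ}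
    {x : (Fin 4 → ℂ) → Fin 4 → ℂ} (h : IsFlatCoordinates F deg d U x) (ht : t ∈ U) :
    (jac x t).det ≠ 0 := by
  intro h0
  have := congrArg Matrix.det (h.jac_mul ht)
  simp [h0] at this

theorem IsFlatCoordinates.mulVec_jac {F : (Fin 4 → ℂ) → ℂ} {deg : Fin 4 → ℂ} {d : ℂ}
    {x : (Fin 4 → ℂ) → Fin 4 → ℂ} (h : IsFlatCoordinates F deg d U x) (ht : t ∈ U) :
    (jac x t).mulVec (fun k => deg k * t k) = ((1 - d) / 2) • x t := by
  ext a
  rw [Pi.smul_apply, smul_eq_mul, ← h.2.2 t ht a]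
  simp only [Matrix.mulVec, dotProduct, jac_apply]
  exact Finset.sum_congr rfl fun l _ => mul_comm _ _

/-- The inverse function theorem, with differentiability of the inverse at every target point whose
preimage lies in `U` and has invertible Jacobi matrix, not only at `f t`. -/
theorem exists_localInverse {f : (Fin 4 → ℂ) → Fin 4 → ℂ} (hU : IsOpen U)
    (hf : DifferentiableOn ℂ f U) (ht : t ∈ U) (hdet : (jac f t).det ≠ 0) :
    ∃ e : OpenPartialHomeomorph (Fin 4 → ℂ) (Fin 4 → ℂ), (e : (Fin 4 → ℂ) → Fin 4 → ℂ) = f ∧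
      t ∈ e.source ∧ ∀ y ∈ e.target, e.symm y ∈ U → (jac f (e.symm y)).det ≠ 0 →
        DifferentiableAt ℂ e.symm y := by
  obtain ⟨e, he⟩ := H42.exists_equiv_of_det_jac_ne_zero (hf.differentiableAt (hU.mem_nhds ht)) hdet
  have hs := H42.hasStrictFDerivAt_of_differentiableOn hU hf ht
  rw [← he] at hs
  refine ⟨hs.toOpenPartialHomeomorph f, hs.toOpenPartialHomeomorph_coe,
    hs.mem_toOpenPartialHomeomorph_source, fun y hy hyU hdy => ?_⟩
  have hd := hf.differentiableAt (hU.mem_nhds hyU)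
  obtain ⟨e', he'⟩ := H42.exists_equiv_of_det_jac_ne_zero hd hdy
  have hd' := hd.hasFDerivAt
  rw [← he'] at hd'
  exact ((hs.toOpenPartialHomeomorph f).hasFDerivAt_symm hy hd').differentiableAt

end AlgFrobenius

namespace H42

open AlgFrobenius

variable {U : Set (Fin 4 → ℂ)} {Z : (Fin 4 → ℂ) → ℂ} {t : Fin 4 → ℂ}

/-! ### Density of the points with an invertible orbit metric -/

/-- On this axis only the antidiagonal `60y, -30y, -30y, 60y` survives. -/
theorem det_orbitMetric_single (y : ℂ) : (orbitMetric ![y, 0, 0, 0]).det = 3240000 * y ^ 4 := by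
  simp [orbitMetric, Matrix.det_succ_row_zero, Fin.sum_univ_succ, Fin.succAbove]
  ring

/-- With the projection `u ↦ u 1` in place of `Z`, `formMap` is the polynomial map in the free
variables `t₁, Z, t₃, t₄`; the second coordinate is then `Z`, not `t₂`. -/
theorem formMap_single : formMap (fun u => u 1) ![1, 0, 0, 0] = ![25920000000000, 0, 0, 0] := by
  ext k
  revert k
  simp [Fin.forall_fin_succ, formMap, lift, formV, form1, form2, form3, form4]

theorem formMap_chart (s : Fin 4 → ℂ) :
    formMap (fun u => u 1) ![s 0, Z s, s 2, s 3] = formMap Z s := by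
  ext k
  simp only [formMap, lift, Matrix.cons_val]

theorem det_jac_chart (hU : IsOpen U) (hZ : DifferentiableOn ℂ Z U)
    (hP : ∀ t ∈ U, cubicP (t 1) (t 2) (t 3) (Z t) = 0) (ht : t ∈ U) :
    (jac (fun s => ![s 0, Z s, s 2, s 3]) t).det ≠ 0 := by
  have h : jac (fun s => ![s 0, Z s, s 2, s 3]) t =
      !![1, 0, 0, 0; partialD 0 Z t, partialD 1 Z t, partialD 2 Z t, partialD 3 Z t;
        0, 0, 1, 0; 0, 0, 0, 1] := by
    ext a l
    fin_cases a
    · exact (partialD_apply l 0).trans (by fin_cases l <;> simp)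
    · fin_cases l <;> rfl
    · exact (partialD_apply l 2).trans (by fin_cases l <;> simp)
    · exact (partialD_apply l 3).trans (by fin_cases l <;> simp)
  have h1 := partialD_Z_mul_discZ hU hZ hP ht 1
  have h2 : partialD 1 Z t ≠ 0 := fun h0 => by
    rw [h0] at h1
    simp [numZ] at h1
  rw [h]
  simpa [Matrix.det_succ_row_zero, Fin.sum_univ_succ, Fin.succAbove] using h2

/-- The map `t ↦ (t₁, Z, t₃, t₄)` is locally open because `∂Z/∂t₂ ≠ 0`. If the determinant vanished
near a point, then as a polynomial in these variables it would vanish on an open set, hence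
everywhere, against its value at `(1, 0, 0, 0)`. -/
theorem subset_closure_det_orbitMetric_ne_zero (hU : IsOpen U) (hZ : DifferentiableOn ℂ Z U)
    (hP : ∀ t ∈ U, cubicP (t 1) (t 2) (t 3) (Z t) = 0) :
    U ⊆ closure {t | t ∈ U ∧ (orbitMetric (formMap Z t)).det ≠ 0} := by
  intro p hp
  by_contra hcl
  set chart : (Fin 4 → ℂ) → Fin 4 → ℂ := fun s => ![s 0, Z s, s 2, s 3] with hchart
  have hcd : DifferentiableOn ℂ chart U := by
    rw [differentiableOn_pi]
    intro k
    fin_cases k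
    · exact (differentiable_apply (0 : Fin 4)).differentiableOn
    · exact hZ
    · exact (differentiable_apply (2 : Fin 4)).differentiableOn
    · exact (differentiable_apply (3 : Fin 4)).differentiableOn
  have hq : Differentiable ℂ fun u : Fin 4 → ℂ =>
      (orbitMetric (formMap (fun u => u 1) u)).det := by
    rw [← differentiableOn_univ]
    exact differentiable_det_orbitMetric.comp_differentiableOn
      (differentiableOn_formMap (differentiable_apply (1 : Fin 4)).differentiableOn)
  have h0 : ∀ᶠ s in 𝓝 p, (orbitMetric (formMap (fun u => u 1) (chart s))).det = 0 := by
    filter_upwards [hU.mem_nhds hp, isClosed_closure.isOpen_compl.mem_nhds hcl] with s hs hs'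
    by_contra hne
    rw [hchart, formMap_chart] at hne
    exact hs' (subset_closure ⟨hs, hne⟩)
  have h1 : ∀ᶠ u in 𝓝 (chart p), (orbitMetric (formMap (fun u => u 1) u)).det = 0 := by
    rw [← map_nhds_eq_of_det_jac_ne_zero hU hcd hp (det_jac_chart hU hZ hP hp), eventually_map]
    exact h0
  have h2 := eq_zero_of_eventually_eq_zero isOpen_univ isPreconnected_univ hq.differentiableOn
    (mem_univ _) h1 ![1, 0, 0, 0] (mem_univ _)
  simp only [formMap_single, det_orbitMetric_single] at h2
  norm_num at h2

/-! ### Flat coordinates -/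

theorem y4_eq_dotProduct (x : Fin 4 → ℂ) : y4 x = x ⬝ᵥ x := by
  simp only [y4, h2, eps1, dotProduct, Fin.sum_univ_four]
  ring

/-- With `J` the Jacobi matrix of `x`, differentiating `x ⬝ x = 30 t₄` gives `Jᵀ x = 15 e₄`. Since
`g e₄ = E`, it follows that `J E = (1/15) J g Jᵀ x = x / 15`, and `1/15 = (1 - d)/2`. -/
theorem mulVec_euler_eq (hU : IsOpen U) (hZ : DifferentiableOn ℂ Z U)
    (hP : ∀ t ∈ U, cubicP (t 1) (t 2) (t 3) (Z t) = 0) {V : Set (Fin 4 → ℂ)} (hV : IsOpen V)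
    (hVU : V ⊆ U) {x : (Fin 4 → ℂ) → Fin 4 → ℂ} (hx : DifferentiableOn ℂ x V)
    (hy : ∀ s ∈ V, invMap (x s) = formMap Z s) (ht : t ∈ V)
    (hg : jac x t * interForm (prepot Z) deg t * (jac x t).transpose = 1) :
    (jac x t).mulVec (euler t) = (1 / 15 : ℂ) • x t := by
  have hxt := hx.differentiableAt (hV.mem_nhds ht)
  have hgrad : (jac x t).transpose.mulVec (x t) = Pi.single 3 15 := by
    ext m
    have hl : ∀ b, HasDerivAt (fun s : ℂ => x (t + s • Pi.single m 1) b) (jac x t b m) 0 :=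
      fun b => hasDerivAt_line (differentiableAt_pi.1 hxt b) m
    have h1 : HasDerivAt (fun s : ℂ => x (t + s • Pi.single m 1) ⬝ᵥ x (t + s • Pi.single m 1))
        (2 * ∑ b, jac x t b m * x t b) 0 := by
      have := HasDerivAt.fun_sum (u := Finset.univ) fun b _ => (hl b).fun_mul (hl b)
      refine this.congr_deriv ?_
      rw [Finset.mul_sum]
      refine Finset.sum_congr rfl fun b _ => ?_
      rw [zero_smul, add_zero]
      ring
    have h2 : partialD m (fun s => x s ⬝ᵥ x s) t = 2 * ∑ b, jac x t b m * x t b := by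
      refine partialD_eq_of_hasDerivAt ?_ h1
      have := differentiableAt_pi.1 hxt
      unfold dotProduct
      fun_prop
    have h3 : partialD m (fun s => x s ⬝ᵥ x s) t = partialD m (fun s => 30 * s 3) t := by
      refine partialD_congr hV (fun s hs => ?_) ht m
      have := congrFun (hy s hs) 3
      rw [← y4_eq_dotProduct]
      exact this
    have h4 : partialD m (fun s => 30 * s 3) t = 30 * (Pi.single m 1 : Fin 4 → ℂ) 3 :=
      partialD_eq_of_hasDerivAt (by fun_prop) ((hasDerivAt_line_apply t m 3).const_mul 30)
    have h5 := (h2.symm.trans h3).trans h4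
    rw [Matrix.mulVec, dotProduct]
    simp only [Matrix.transpose_apply, Pi.single_apply, eq_comm (a := (3 : Fin 4))] at h5 ⊢
    split_ifs at h5 ⊢ <;> linear_combination h5 / 2
  have h6 : euler t = (1 / 15 : ℂ) •
      (interForm (prepot Z) deg t).mulVec (Pi.single 3 15) := by
    ext l
    rw [Pi.smul_apply, Matrix.mulVec_single, smul_eq_mul]
    simp only [Pi.smul_apply, Matrix.col_apply, interForm_prepot_three hU hZ hP (hVU ht), euler]
    simp
    ring
  rw [h6, Matrix.mulVec_smul, ← hgrad, Matrix.mulVec_mulVec, Matrix.mulVec_mulVec, hg,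
    Matrix.one_mulVec]

theorem exists_isFlatCoordinates (hU : IsOpen U) (hZ : DifferentiableOn ℂ Z U)
    (hP : ∀ t ∈ U, cubicP (t 1) (t 2) (t 3) (Z t) = 0) {p : Fin 4 → ℂ} (hp : p ∈ U)
    (hdet : (orbitMetric (formMap Z p)).det ≠ 0) :
    ∃ V : Set (Fin 4 → ℂ), IsOpen V ∧ p ∈ V ∧ V ⊆ U ∧ ∃ x : (Fin 4 → ℂ) → Fin 4 → ℂ,
      IsFlatCoordinates (prepot Z) deg charge V x ∧ InjOn x V ∧
        ∀ t ∈ V, Relations (x t) t (Z t) := by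
  obtain ⟨x₀, hx₀⟩ := exists_invMap_eq hdet
  have hJ : ∀ x, (orbitMetric (invMap x)).det ≠ 0 → (jac invMap x).det ≠ 0 := fun x hx h =>
    hx (by rw [← det_jac_invMap_sq, h]; simp)
  have hinv : DifferentiableOn ℂ invMap univ := differentiable_invMap.differentiableOn
  have hform := differentiableOn_formMap hZ
  obtain ⟨e, hef, he₀, hed⟩ := exists_localInverse isOpen_univ hinv (mem_univ x₀)
    (hJ x₀ (by rwa [hx₀]))
  have hdetp : (jac (formMap Z) p).det ≠ 0 := fun h0 => hdet (by
    rw [← jac_formMap_mul_inter_mul_transpose hU hZ hP hp]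
    simp [h0])
  -- This second local inverse, of `formMap Z`, serves only to shrink `V` so that `x` becomes
  -- injective.
  obtain ⟨r, hrf, hr₀, -⟩ := exists_localInverse hU hform hp hdetp
  set W := e.target ∩ {y | (orbitMetric y).det ≠ 0} with hW
  have hWo : IsOpen W :=
    e.open_target.inter (isOpen_ne_fun differentiable_det_orbitMetric.continuous continuous_const)
  set V := (U ∩ formMap Z ⁻¹' W) ∩ r.source with hVdef
  have hV : IsOpen V := (hform.continuousOn.isOpen_inter_preimage hU hWo).inter r.open_source
  have hVU : V ⊆ U := fun t ht => ht.1.1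
  have heq : ∀ y ∈ e.target, invMap (e.symm y) = y := fun y hy => by
    rw [← hef]
    exact e.right_inv hy
  have hxi : ∀ t ∈ V, invMap (e.symm (formMap Z t)) = formMap Z t :=
    fun t ht => heq _ ht.1.2.1
  have hJt : ∀ t ∈ V, (jac invMap (e.symm (formMap Z t))).det ≠ 0 := fun t ht =>
    hJ _ (by rw [hxi t ht]; exact ht.1.2.2)
  have hxd : ∀ t ∈ V, DifferentiableAt ℂ (e.symm ∘ formMap Z) t := fun t ht =>
    (hed _ ht.1.2.1 (mem_univ _) (hJt t ht)).comp t
      (hform.differentiableAt (hU.mem_nhds (hVU ht)))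
  have hxo : DifferentiableOn ℂ (e.symm ∘ formMap Z) V := fun t ht =>
    (hxd t ht).differentiableWithinAt
  -- By the chain rule `K = J X`, where `K, J, X` are the Jacobi matrices of `formMap Z`, `invMap`
  -- and `x`. Both `K g Kᵀ` and `J Jᵀ` equal the orbit metric, so cancelling the invertible `J` and
  -- `Jᵀ` leaves `X g Xᵀ = 1`.
  have hg : ∀ t ∈ V, jac (e.symm ∘ formMap Z) t * interForm (prepot Z) deg t *
      (jac (e.symm ∘ formMap Z) t).transpose = 1 := by
    intro t ht
    have hc : jac (formMap Z) t =
        jac invMap (e.symm (formMap Z t)) * jac (e.symm ∘ formMap Z) t := by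
      rw [← jac_congr hV (f := invMap ∘ (e.symm ∘ formMap Z)) (fun s hs => hxi s hs) ht]
      exact jac_comp (differentiable_invMap _) (hxd t ht)
    have h1 := jac_formMap_mul_inter_mul_transpose hU hZ hP (hVU ht)
    have h2 := jac_invMap_mul_transpose (e.symm (formMap Z t))
    rw [hxi t ht, ← h1, hc, Matrix.transpose_mul] at h2
    have hu : IsUnit (jac invMap (e.symm (formMap Z t))) :=
      (Matrix.isUnit_iff_isUnit_det _).2 (isUnit_iff_ne_zero.2 (hJt t ht))
    have hu' : IsUnit (jac invMap (e.symm (formMap Z t))).transpose :=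
      (Matrix.isUnit_iff_isUnit_det _).2 (by
        rw [Matrix.det_transpose]
        exact isUnit_iff_ne_zero.2 (hJt t ht))
    refine hu.mul_left_cancel (hu'.mul_right_cancel ?_)
    rw [mul_one, h2]
    simp only [Matrix.mul_assoc]
  refine ⟨V, hV, ⟨⟨hp, ?_, hdet⟩, hr₀⟩, hVU, e.symm ∘ formMap Z, ⟨hxo, fun t ht a b => ?_,
    fun t ht a => ?_⟩, fun s hs t ht hst => ?_, fun t ht => ?_⟩
  · rw [← hx₀, ← hef]
    exact e.map_source he₀
  · rw [jac_mul_interForm_apply, hg t ht, Matrix.one_apply]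
  · have h := congrFun (mulVec_euler_eq hU hZ hP hV hVU hxo hxi ht (hg t ht)) a
    simp only [Matrix.mulVec, dotProduct, jac_apply, euler, Pi.smul_apply, smul_eq_mul] at h
    calc _ = _ := Finset.sum_congr rfl fun l _ => mul_comm _ _
      _ = _ := h
      _ = _ := by
        rw [charge]
        ring
  · refine r.injOn hs.2 ht.2 ?_
    rw [hrf, ← hxi s hs, ← hxi t ht]
    exact congrArg invMap hst
  · exact (relations_iff hP (hVU ht) _).2 (hxi t ht)

/-- The transition map `x' ∘ x⁻¹` has orthogonal, hence constant, Jacobi matrix `T`. Applying Jacobi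
matrices to `E` gives `(1 - d)/2 · x' = (1 - d)/2 · T x`, which removes the possible translation
since `d ≠ 1`. -/
theorem exists_orthogonal_eventually_eq (hU : IsOpen U) {V : Set (Fin 4 → ℂ)} (hV : IsOpen V)
    (hVU : V ⊆ U) {p : Fin 4 → ℂ} (hp : p ∈ V) {x x' : (Fin 4 → ℂ) → Fin 4 → ℂ}
    (hx : IsFlatCoordinates (prepot Z) deg charge U x)
    (hx' : IsFlatCoordinates (prepot Z) deg charge V x') :
    ∃ T : Matrix (Fin 4) (Fin 4) ℂ, T * T.transpose = 1 ∧ ∀ᶠ s in 𝓝 p, x' s = T.mulVec (x s) := by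
  obtain ⟨e, hef, hpe, hed⟩ := exists_localInverse hU hx.1 (hVU hp) (hx.det_jac_ne_zero (hVU hp))
  have hWo : IsOpen (e.target ∩ e.symm ⁻¹' V) := e.isOpen_inter_preimage_symm hV
  have hxp : x p ∈ e.target ∩ e.symm ⁻¹' V := by
    rw [← hef]
    exact ⟨e.map_source hpe, by rwa [mem_preimage, e.left_inv hpe]⟩
  obtain ⟨ε, hε, hball⟩ := Metric.isOpen_iff.1 hWo _ hxp
  have hsd : ∀ q ∈ ball (x p) ε, DifferentiableAt ℂ e.symm q := fun q hq =>
    hed q (hball hq).1 (hVU (hball hq).2) (hx.det_jac_ne_zero (hVU (hball hq).2))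
  have hφd : ∀ q ∈ ball (x p) ε, DifferentiableAt ℂ (x' ∘ e.symm) q := fun q hq =>
    (hx'.1.differentiableAt (hV.mem_nhds (hball hq).2)).comp q (hsd q hq)
  have hinv : ∀ q ∈ ball (x p) ε, jac e.symm q * jac x (e.symm q) = 1 := by
    intro q hq
    rw [mul_eq_one_comm, ← jac_comp (hx.1.differentiableAt (hU.mem_nhds (hVU (hball hq).2)))
      (hsd q hq), ← jac_id (t := q)]
    refine jac_congr isOpen_ball (fun r hr => ?_) hq
    rw [Function.comp_apply, ← hef]
    exact e.right_inv (hball hr).1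
  have hjac : ∀ q ∈ ball (x p) ε,
      jac (x' ∘ e.symm) q * jac x (e.symm q) = jac x' (e.symm q) := by
    intro q hq
    rw [jac_comp (hx'.1.differentiableAt (hV.mem_nhds (hball hq).2)) (hsd q hq), Matrix.mul_assoc,
      hinv q hq, Matrix.mul_one]
  have horth : ∀ q ∈ ball (x p) ε,
      jac (x' ∘ e.symm) q * (jac (x' ∘ e.symm) q).transpose = 1 := by
    intro q hq
    have h1 := hx'.jac_mul (hball hq).2
    rw [← hjac q hq, Matrix.transpose_mul] at h1
    rw [← h1]
    have h2 := hx.jac_mul (hVU (hball hq).2)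
    calc _ = jac (x' ∘ e.symm) q * (jac x (e.symm q) * interForm (prepot Z) deg (e.symm q) *
          (jac x (e.symm q)).transpose) * (jac (x' ∘ e.symm) q).transpose := by
            rw [h2, Matrix.mul_one]
      _ = _ := by simp only [Matrix.mul_assoc]
  obtain ⟨A, hA⟩ := fderiv_const_of_dotProduct_preserving (φ := x' ∘ e.symm)
    (isOpen_ball (x := x p) (ε := ε)) (convex_ball _ _).isPreconnected
    (fun q hq => (hφd q hq).differentiableWithinAt) (fun q hq u v => by
      rw [fderiv_apply_eq_jac_mulVec (hφd q hq), fderiv_apply_eq_jac_mulVec (hφd q hq),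
        Matrix.dotProduct_mulVec, ← Matrix.mulVec_transpose, Matrix.mulVec_mulVec,
        mul_eq_one_comm.1 (horth q hq), Matrix.one_mulVec])
  have hxp' : x p ∈ ball (x p) ε := mem_ball_self hε
  have hconst : ∀ q ∈ ball (x p) ε, jac (x' ∘ e.symm) q = jac (x' ∘ e.symm) (x p) := by
    intro q hq
    refine Matrix.mulVec_injective (funext fun v => ?_)
    rw [← fderiv_apply_eq_jac_mulVec (hφd q hq), ← fderiv_apply_eq_jac_mulVec (hφd _ hxp'),
      hA q hq, hA _ hxp']
  refine ⟨jac (x' ∘ e.symm) (x p), horth _ hxp', ?_⟩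
  have hcont : ContinuousAt x p := (hx.1.differentiableAt (hU.mem_nhds (hVU hp))).continuousAt
  filter_upwards [hcont.eventually (isOpen_ball.mem_nhds hxp'), hV.mem_nhds hp,
    e.open_source.mem_nhds hpe] with s hs hsV hse
  have hsymm : e.symm (x s) = s := by
    rw [← hef]
    exact e.left_inv hse
  have h1 := hjac _ hs
  rw [hconst _ hs, hsymm] at h1
  have h2 := hx'.mulVec_jac hsV
  rw [← h1, ← Matrix.mulVec_mulVec, hx.mulVec_jac (hVU hsV), Matrix.mulVec_smul] at h2
  refine (smul_right_injective (Fin 4 → ℂ) ?_ h2).symm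
  norm_num [charge]

/-- Both sides of each relation are holomorphic in `t`, so the identity theorem spreads their
equality from a neighbourhood of one point. -/
theorem relations_of_eventually (hU : IsOpen U) (hU' : IsPreconnected U)
    (hZ : DifferentiableOn ℂ Z U) (hP : ∀ t ∈ U, cubicP (t 1) (t 2) (t 3) (Z t) = 0)
    {x : (Fin 4 → ℂ) → Fin 4 → ℂ} (hx : DifferentiableOn ℂ x U) {p : Fin 4 → ℂ} (hp : p ∈ U)
    (h : ∀ᶠ s in 𝓝 p, Relations (x s) s (Z s)) (ht : t ∈ U) : Relations (x t) t (Z t) := by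
  rw [relations_iff hP ht]
  ext k
  have hd : DifferentiableOn ℂ (fun s => invMap (x s) k - formMap Z s k) U :=
    (differentiableOn_pi.1 (differentiable_invMap.comp_differentiableOn hx) k).sub
      (differentiableOn_pi.1 (differentiableOn_formMap hZ) k)
  refine sub_eq_zero.1 (eq_zero_of_eventually_eq_zero hU hU' hd hp ?_ t ht)
  filter_upwards [h, hU.mem_nhds hp] with s hs hsU
  rw [(relations_iff hP hsU _).1 hs, sub_self]

end H42

end

/-! ### The theorem -/

theorem mainTheorem6
    (U : Set (Fin 4 → ℂ)) (hU : IsOpen U)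
    (Z : (Fin 4 → ℂ) → ℂ) (hZ : DifferentiableOn ℂ Z U)
    (hP : ∀ t ∈ U, H42.cubicP (t 1) (t 2) (t 3) (Z t) = 0) :
    (U ⊆ closure {p | ∃ V : Set (Fin 4 → ℂ), IsOpen V ∧ p ∈ V ∧ V ⊆ U ∧
      ∃ x : (Fin 4 → ℂ) → Fin 4 → ℂ,
        AlgFrobenius.IsFlatCoordinates (H42.prepot Z) H42.deg H42.charge V x ∧
        Set.InjOn x V ∧
        ∀ t ∈ V, H42.Relations (x t) t (Z t)}) ∧
    (IsPreconnected U →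
      ∀ x : (Fin 4 → ℂ) → Fin 4 → ℂ,
        AlgFrobenius.IsFlatCoordinates (H42.prepot Z) H42.deg H42.charge U x →
        ∃ T : Matrix (Fin 4) (Fin 4) ℂ, T * T.transpose = 1 ∧
          ∀ t ∈ U, H42.Relations (T.mulVec (x t)) t (Z t)) := by
  have hdense : U ⊆ closure {p | ∃ V : Set (Fin 4 → ℂ), IsOpen V ∧ p ∈ V ∧ V ⊆ U ∧
      ∃ x : (Fin 4 → ℂ) → Fin 4 → ℂ,
        AlgFrobenius.IsFlatCoordinates (H42.prepot Z) H42.deg H42.charge V x ∧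
        Set.InjOn x V ∧
        ∀ t ∈ V, H42.Relations (x t) t (Z t)} :=
    (H42.subset_closure_det_orbitMetric_ne_zero hU hZ hP).trans
      (closure_mono fun p hp => H42.exists_isFlatCoordinates hU hZ hP hp.1 hp.2)
  refine ⟨hdense, fun hU' x hx => ?_⟩
  rcases U.eq_empty_or_nonempty with rfl | ⟨p₀, hp₀⟩
  · exact ⟨1, by simp, fun t ht => ht.elim⟩
  -- Density supplies one point with a local system `x'` satisfying the relations; comparing the
  -- given system with it there fixes `T`.
  obtain ⟨p, V, hV, hp, hVU, x', hx', -, hrel⟩ := closure_nonempty_iff.1 ⟨p₀, hdense hp₀⟩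
  obtain ⟨T, hT, hTx⟩ := H42.exists_orthogonal_eventually_eq hU hV hVU hp hx hx'
  have hTd : DifferentiableOn ℂ (fun t => T.mulVec (x t)) U :=
    (LinearMap.toContinuousLinearMap T.mulVecLin).differentiable.comp_differentiableOn hx.1
  refine ⟨T, hT, fun t ht => H42.relations_of_eventually hU hU' hZ hP hTd (hVU hp) ?_ ht⟩
  filter_upwards [hTx, hV.mem_nhds hp] with s hs hsV
  exact hs ▸ hrel s hsV
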